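/- Let $\Omega>0$ and let $p,q\in C^2(\mathbb R)$ be complex-valued and $\Omega$-periodic. Put $$L=J\frac{d}{dx}+Q,\qquad J=\begin{pmatrix}i&0\\0&-i\end{pmatrix},\qquad Q=\begin{pmatrix}0&-iq\\ip&0\end{pmatrix}.$$ For $E\in\mathbb C$ let $T(E)$ be the restriction of the translation $(Ty)(x)=y(x+\Omega)$ to the space of solutions $y:\mathbb R\to\mathbb C^2$ of $Ly=Ey$; a Floquet solution is a nonzero solution $y$ with $y(\cdot+\Omega)=\rho y$ for some $\rho\in\mathbb C$. Let $\delta(E,x_0)\in\{0,1,2,\dots,\infty\}$ be the algebraic multiplicity of $E$ as an eigenvalue of the Dirichlet problem $Ly=Ey$, $y_1(x_0)=y_1(x_0+\Omega)=0$ on $[x_0,x_0+\Omega]$, let $\delta_i(E)=\min_{x\in\mathbb R}\delta(E,x)$, and, for $d_0\in\mathbb C$, let $$D(E)=e^{d_0E}E^{\delta_i(0)}\prod_{\lambda\in\mathbb C\setminus\{0\}}\Bigl(\bigl(1-\tfrac E\lambda\bigr)e^{E/\lambda}\Bigr)^{\delta_i(\lambda)},\qquad U(E)=\frac{(\operatorname{tr}T(E))^2-4}{D(E)^2}.$$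 Suppose that, for all but finitely many $E\in\mathbb C$, the equation $Ly=Ey$ has two linearly independent Floquet solutions. Then: (a) If $q\not\equiv0$, then $\delta_i(E)<\infty$ for all $E\in\mathbb C$, the product defining $D$ converges, and for a suitable constant $d_0\in\mathbb C$ the function $U$ is a polynomial (that is, there is a polynomial $P$ with $(\operatorname{tr}T(E))^2-4=P(E)D(E)^2$ for all $E\in\mathbb C$, so that $U(E)=P(E)$ wherever $D(E)\neq0$). (b) $Q$ is an algebro-geometric AKNS potential; that is, $p,q\in C^\infty(\mathbb R)$ and there are $n\ge0$ and functions $f_\ell,g_\ell,h_\ell:\mathbb R\to\mathbb C$ $(\ell\ge0)$ with $f_0=-iq$, $g_0=1$, $h_0=ip$ and $$f_{\ell+1}=\tfrac i2f_\ell'-iq\,g_{\ell+1},\qquad g_{\ell+1}'=pf_\ell+qh_\ell,\qquad h_{\ell+1}=-\tfrac i2h_\ell'+ip\,g_{\ell+1}\qquad(\ell\ge0),$$ such that $f_{n+1}=h_{n+1}=0$ on $\mathbb R$. -/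

import Mathlib

noncomputable section

namespace AKNS

open Complex

/-- The constant matrix `J = diag(i, -i)`. -/
def J : Matrix (Fin 2) (Fin 2) ℂ := !![I, 0; 0, -I]

/-- The off-diagonal potential `Q = [[0, -iq], [ip, 0]]`. -/
def Q (p q : ℝ → ℂ) (x : ℝ) : Matrix (Fin 2) (Fin 2) ℂ := !![0, -I * q x; I * p x, 0]

/-- The Dirac-type differential expression `L = J d/dx + Q`, applied to `y : ℝ → ℂ²`. -/
def L (p q : ℝ → ℂ) (y : ℝ → Fin 2 → ℂ) (x : ℝ) : Fin 2 → ℂ :=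
  J.mulVec (deriv y x) + (Q p q x).mulVec (y x)

theorem L_zero (p q : ℝ → ℂ) (x : ℝ) : L p q 0 x = 0 := by
  have h : deriv (0 : ℝ → Fin 2 → ℂ) x = 0 := deriv_const x (0 : Fin 2 → ℂ)
  simp [L, h]

theorem L_add (p q : ℝ → ℂ) {y z : ℝ → Fin 2 → ℂ} (hy : Differentiable ℝ y)
    (hz : Differentiable ℝ z) (x : ℝ) : L p q (y + z) x = L p q y x + L p q z x := by
  simp only [L, deriv_add (hy x) (hz x), Pi.add_apply, Matrix.mulVec_add]
  abel

theorem L_smul (p q : ℝ → ℂ) (c : ℂ) {y : ℝ → Fin 2 → ℂ} (hy : Differentiable ℝ y)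
    (x : ℝ) : L p q (c • y) x = c • L p q y x := by
  simp only [L, deriv_const_smul c (hy x), Pi.smul_apply, Matrix.mulVec_smul, smul_add]

/-- The space `V(E)` of all solutions on `ℝ` of `L y = E y`. -/
def solutionSpace (p q : ℝ → ℂ) (E : ℂ) : Submodule ℂ (ℝ → Fin 2 → ℂ) where
  carrier := {y | Differentiable ℝ y ∧ ∀ x, L p q y x = E • y x}
  zero_mem' := ⟨differentiable_const _, fun x => by simp [L_zero]⟩
  add_mem' := fun {y z} hy hz => ⟨hy.1.add hz.1, fun x => by
    rw [L_add p q hy.1 hz.1, hy.2, hz.2, Pi.add_apply, smul_add]⟩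
  smul_mem' := fun c y hy => ⟨hy.1.const_smul c, fun x => by
    rw [L_smul p q c hy.1, hy.2, Pi.smul_apply, smul_comm]⟩

/-- A Floquet solution of `L y = E y`: a nonzero solution with `y(x + Ω) = ρ y(x)` for a
constant multiplier `ρ`. -/
def IsFloquetSolution (p q : ℝ → ℂ) (Ω : ℝ) (E : ℂ) (y : ℝ → Fin 2 → ℂ) : Prop :=
  y ∈ solutionSpace p q E ∧ y ≠ 0 ∧ ∃ ρ : ℂ, ∀ x, y (x + Ω) = ρ • y x

/-- `L y = E y` has two linearly independent Floquet solutions. -/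
def HasTwoFloquetSolutions (p q : ℝ → ℂ) (Ω : ℝ) (E : ℂ) : Prop :=
  ∃ y z : ℝ → Fin 2 → ℂ, IsFloquetSolution p q Ω E y ∧ IsFloquetSolution p q Ω E z ∧
    LinearIndependent ℂ ![y, z]

theorem shift_mem {p q : ℝ → ℂ} {Ω : ℝ} (hp : Function.Periodic p Ω)
    (hq : Function.Periodic q Ω) {E : ℂ} {y : ℝ → Fin 2 → ℂ} (hy : y ∈ solutionSpace p q E) :
    (fun x => y (x + Ω)) ∈ solutionSpace p q E := by
  refine ⟨hy.1.comp (differentiable_id.add_const Ω), fun x => ?_⟩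
  have h := hy.2 (x + Ω)
  simp only [L, Q, hp x, hq x] at h
  simpa only [L, Q, deriv_comp_add_const] using h

/-- `T(E)`: the restriction of the translation `(T y)(x) = y(x + Ω)` to `V(E)`. -/
def monodromy {p q : ℝ → ℂ} {Ω : ℝ} (hp : Function.Periodic p Ω)
    (hq : Function.Periodic q Ω) (E : ℂ) : solutionSpace p q E →ₗ[ℂ] solutionSpace p q E where
  toFun y := ⟨fun x => y.1 (x + Ω), shift_mem hp hq y.2⟩
  map_add' _ _ := rfl
  map_smul' _ _ := rfl

/-- The function `(tr T(E))² - 4`. -/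
def discr {p q : ℝ → ℂ} {Ω : ℝ} (hp : Function.Periodic p Ω)
    (hq : Function.Periodic q Ω) (E : ℂ) : ℂ :=
  (LinearMap.trace ℂ (solutionSpace p q E) (monodromy hp hq E)) ^ 2 - 4

/-- The preimage of `W` under `L - E` with the Dirichlet conditions
`y₁(x₀) = y₁(x₀ + Ω) = 0`. -/
def dirichletStep (p q : ℝ → ℂ) (Ω : ℝ) (E : ℂ) (x₀ : ℝ)
    (W : Submodule ℂ (ℝ → Fin 2 → ℂ)) : Submodule ℂ (ℝ → Fin 2 → ℂ) where
  carrier := {y | Differentiable ℝ y ∧ y x₀ 0 = 0 ∧ y (x₀ + Ω) 0 = 0 ∧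
    (fun x => L p q y x - E • y x) ∈ W}
  zero_mem' := by
    refine ⟨differentiable_const _, rfl, rfl, ?_⟩
    have h : (fun x => L p q 0 x - E • (0 : ℝ → Fin 2 → ℂ) x) = 0 := by
      funext x
      simp [L_zero]
    rw [h]
    exact W.zero_mem
  add_mem' := by
    intro y z hy hz
    refine ⟨hy.1.add hz.1, by simp [hy.2.1, hz.2.1], by simp [hy.2.2.1, hz.2.2.1], ?_⟩
    have h : (fun x => L p q (y + z) x - E • (y + z) x) =
        (fun x => L p q y x - E • y x) + (fun x => L p q z x - E • z x) := by
      funext x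
      simp only [L_add p q hy.1 hz.1, Pi.add_apply, smul_add]
      abel
    rw [h]
    exact W.add_mem hy.2.2.2 hz.2.2.2
  smul_mem' := by
    intro c y hy
    refine ⟨hy.1.const_smul c, by simp [hy.2.1], by simp [hy.2.2.1], ?_⟩
    have h : (fun x => L p q (c • y) x - E • (c • y) x) =
        c • (fun x => L p q y x - E • y x) := by
      funext x
      simp only [L_smul p q c hy.1, Pi.smul_apply, smul_sub, smul_comm E c]
    rw [h]
    exact W.smul_mem c hy.2.2.2

/-- `ker (H_D - E)^k` for the Dirichlet problem `L y = E y`, `y₁(x₀) = y₁(x₀ + Ω) = 0` on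
`[x₀, x₀ + Ω]`. Elements of this space solve linear differential equations whose coefficients
are defined on all of `ℝ`, hence extend uniquely from `[x₀, x₀ + Ω]` to `ℝ`, and we identify
them with their extensions. -/
def dirichletKer (p q : ℝ → ℂ) (Ω : ℝ) (E : ℂ) (x₀ : ℝ) (k : ℕ) :
    Submodule ℂ (ℝ → Fin 2 → ℂ) :=
  (dirichletStep p q Ω E x₀)^[k] ⊥

/-- `δ(E, x₀)`: the algebraic multiplicity of `E` as a Dirichlet eigenvalue for the interval
`[x₀, x₀ + Ω]` (equal to `0` if `E` is not an eigenvalue). -/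
def dirichletMult (p q : ℝ → ℂ) (Ω : ℝ) (E : ℂ) (x₀ : ℝ) : ℕ∞ :=
  ⨆ k : ℕ, Cardinal.toENat (Module.rank ℂ (dirichletKer p q Ω E x₀ k))

/-- `δᵢ(E)`: the immovable part, i.e. the minimum over `x` of `δ(E, x)`. -/
def immovableMult (p q : ℝ → ℂ) (Ω : ℝ) (E : ℂ) : ℕ∞ :=
  ⨅ x : ℝ, dirichletMult p q Ω E x

/-- The factor `((1 - E/z) exp(E/z))^{δᵢ(z)}`, `z ≠ 0`, of the canonical product below. -/
def hadamardFactor (p q : ℝ → ℂ) (Ω : ℝ) (E : ℂ) (z : {z : ℂ // z ≠ 0}) : ℂ :=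
  ((1 - E / z.1) * exp (E / z.1)) ^ (immovableMult p q Ω z.1).toNat

/-- The Hadamard product over the immovable Dirichlet eigenvalues,
`D(E) = exp(d₀ E) E^{δᵢ(0)} ∏_{z ≠ 0} ((1 - E/z) exp(E/z))^{δᵢ(z)}`. -/
def D (p q : ℝ → ℂ) (Ω : ℝ) (d₀ E : ℂ) : ℂ :=
  exp (d₀ * E) * E ^ (immovableMult p q Ω 0).toNat * ∏' z, hadamardFactor p q Ω E z

/-- `U(E) = ((tr T(E))² - 4) / D(E)²`; only its values where `D(E) ≠ 0` are meaningful. -/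
def U {p q : ℝ → ℂ} {Ω : ℝ} (hp : Function.Periodic p Ω) (hq : Function.Periodic q Ω)
    (d₀ E : ℂ) : ℂ :=
  discr hp hq E / D p q Ω d₀ E ^ 2

/-- The AKNS recursion. The choice of each antiderivative `g (ℓ + 1)` is the choice of the
integration constant `c_{ℓ+1}`. -/
structure IsRecursion (p q : ℝ → ℂ) (f g h : ℕ → ℝ → ℂ) : Prop where
  f_zero : ∀ x, f 0 x = -I * q x
  g_zero : ∀ x, g 0 x = 1
  h_zero : ∀ x, h 0 x = I * p x
  f_succ : ∀ l x, f (l + 1) x = I / 2 * deriv (f l) x - I * q x * g (l + 1) x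
  g_succ : ∀ l x, HasDerivAt (g (l + 1)) (p x * f l x + q x * h l x) x
  h_succ : ∀ l x, h (l + 1) x = -(I / 2) * deriv (h l) x + I * p x * g (l + 1) x

/-- `(p, q)` (equivalently `Q`) is an algebro-geometric AKNS potential: it is smooth and solves
some equation `f_{n+1} = h_{n+1} = 0`, `n ≥ 0`, of the stationary AKNS hierarchy, for some
choice of the integration constants. -/
def IsAlgebroGeometric (p q : ℝ → ℂ) : Prop :=
  ContDiff ℝ ((⊤ : ℕ∞) : WithTop ℕ∞) p ∧ ContDiff ℝ ((⊤ : ℕ∞) : WithTop ℕ∞) q ∧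
    ∃ (f g h : ℕ → ℝ → ℂ) (n : ℕ), IsRecursion p q f g h ∧
      (∀ x, f (n + 1) x = 0) ∧ (∀ x, h (n + 1) x = 0)

end AKNS

end

/-! Let M(E,x) be the monodromy matrix with base point x, Δ(E) its trace and W = ((a, M₁₂), (M₂₁,
-a)) its trace-free part. Since det M = 1, one has Δ² - 4 = 4(a² + M₁₂M₂₁). In x, Δ is constant and
W satisfies the Lax equation of the system, so W(E,x) is conjugate to W(E,0). For large |E|, M
differs from diag(exp(-iΩE), exp(iΩE)) by O(exp(|Im E|Ω)/|E|).

Two independent Floquet solutions at a zero of Δ² - 4 force M to be scalar, so W(E,·) = 0 and Δ'(E)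
= 0 there. Comparison with 2cos(ΩE) gives the converse far out: beyond a large radius every critical
point of Δ is simple and is a zero of Δ² - 4 (`exists_far_region`).

For (b), write Δ' = P g, where the monic polynomial P collects the critical points in a disc. The
zeros of g are simple and W vanishes at each of them, so W/g is entire. On circles avoiding the
zeros of sin(ΩE), |Δ'| is at least a multiple of exp(|Im E|Ω), so W/g has polynomial growth and is a
polynomial in E with constant leading term (`exists_polynomial_monodromy`). Comparing coefficients
in the Lax equation turns such a polynomial into a terminating AKNS recursion
(`isAlgebroGeometric_of_polynomials`), and the recursion bootstraps smoothness.

For (a), the multiplicity δ(E,x₀) is at most the order of the zero of M₁₂(·,x₀) at E, and at least 1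
if there is a zero (`dirichletMult_le`, `one_le_dirichletMult`). If q is not identically zero, some
x makes M₁₂ vanish only to the common order of all entries of W, whence 2δᵢ ≤ ord(Δ² - 4). At the
far zeros of Δ² - 4 that order is 2 and δᵢ = 1. Hence (Δ² - 4)/D², with d₀ = 0, is entire with
finitely many zeros. A Hadamard argument with exponent 3/2 shows that it is a polynomial times the
exponential of an affine function, and the linear part is absorbed by d₀
(`ZeroData.exists_factorization`). -/

namespace AKNS

/-! ### Linear differential equations with an affine complex parameter. -/

section LinearODE

open MeasureTheory intervalIntegral Set

variable {F : Type*} [NormedAddCommGroup F] [NormedSpace ℂ F]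

/-- The Picard iterates of the linear equation `y' = (A x + E • B) y` with `y 0 = c`. -/
noncomputable def picard (A : ℝ → F →L[ℂ] F) (B : F →L[ℂ] F) (c : F) (E : ℂ) : ℕ → ℝ → F
  | 0 => fun _ => c
  | n + 1 => fun x => ∫ t in (0 : ℝ)..x, (A t + E • B) (picard A B c E n t)

/-- Integration in x keeps powers of E outside the integral. This single expansion yields both
continuity in x and holomorphy in E, so no integral has to be differentiated in the parameter. -/
theorem picard_polynomial {A : ℝ → F →L[ℂ] F} (hA : Continuous A) (B : F →L[ℂ] F) (c : F) (n : ℕ) :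
    ∃ (ι : Type) (_ : Fintype ι) (k : ι → ℕ) (C : ι → ℝ → F), (∀ i, Continuous (C i)) ∧
      ∀ E x, picard A B c E n x = ∑ i, E ^ k i • C i x := by
  induction n with
  | zero => exact ⟨Unit, inferInstance, fun _ => 0, fun _ _ => c, fun _ => continuous_const,
      fun E x => by simp [picard]⟩
  | succ n ih =>
    obtain ⟨ι, _, k, C, hC, h⟩ := ih
    have h1 : ∀ i, Continuous fun t => A t (C i t) := fun i => hA.clm_apply (hC i)
    have h2 : ∀ i, Continuous fun t => B (C i t) := fun i => B.continuous.comp (hC i)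
    refine ⟨ι ⊕ ι, inferInstance, Sum.elim k (fun i => k i + 1),
      Sum.elim (fun i x => ∫ t in (0 : ℝ)..x, A t (C i t))
        (fun i x => ∫ t in (0 : ℝ)..x, B (C i t)), ?_, fun E x => ?_⟩
    · rintro (i | i)
      · exact continuous_primitive (fun a b => (h1 i).intervalIntegrable a b) 0
      · exact continuous_primitive (fun a b => (h2 i).intervalIntegrable a b) 0
    · have h3 : ∀ t, (A t + E • B) (picard A B c E n t) =
          ∑ i, E ^ k i • A t (C i t) + ∑ i, E ^ (k i + 1) • B (C i t) := fun t => by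
        rw [h]
        simp only [add_apply, smul_apply, map_sum, map_smul, pow_succ, mul_smul,
          ← Finset.sum_add_distrib, smul_add]
      simp only [picard, h3, Fintype.sum_sum_type, Sum.elim_inl, Sum.elim_inr]
      rw [intervalIntegral.integral_add, intervalIntegral.integral_finsetSum,
        intervalIntegral.integral_finsetSum]
      · simp only [intervalIntegral.integral_smul]
      · exact fun i _ => ((h2 i).const_smul _).intervalIntegrable _ _
      · exact fun i _ => ((h1 i).const_smul _).intervalIntegrable _ _
      · exact (continuous_finsetSum _ fun i _ => (h1 i).const_smul _).intervalIntegrable _ _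
      · exact (continuous_finsetSum _ fun i _ => (h2 i).const_smul _).intervalIntegrable _ _

theorem continuous_picard {A : ℝ → F →L[ℂ] F} (hA : Continuous A) (B : F →L[ℂ] F) (c : F) (E : ℂ)
    (n : ℕ) : Continuous (picard A B c E n) := by
  obtain ⟨ι, _, k, C, hC, h⟩ := picard_polynomial hA B c n
  rw [show picard A B c E n = fun x => ∑ i, E ^ k i • C i x from funext (h E)]
  exact continuous_finsetSum _ fun i _ => (hC i).const_smul _

theorem differentiable_picard {A : ℝ → F →L[ℂ] F} (hA : Continuous A) (B : F →L[ℂ] F) (c : F)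
    (n : ℕ) (x : ℝ) : Differentiable ℂ fun E => picard A B c E n x := by
  obtain ⟨ι, _, k, C, hC, h⟩ := picard_polynomial hA B c n
  simp only [h]
  fun_prop

/-- Each step integrates |t|^n, which produces the next factor of the factorial. The bound K is only
required on |x| ≤ X, so that it can later be chosen uniformly for E in a disc. -/
theorem norm_picard_le {A : ℝ → F →L[ℂ] F} (B : F →L[ℂ] F) (c : F)
    {E : ℂ} {X K : ℝ} (hK : ∀ x, |x| ≤ X → ‖A x + E • B‖ ≤ K) (n : ℕ) {x : ℝ} (hx : |x| ≤ X) :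
    ‖picard A B c E n x‖ ≤ ‖c‖ * K ^ n / n.factorial * |x| ^ n := by
  induction n generalizing x with
  | zero => simp [picard]
  | succ n ih =>
    have hK0 : 0 ≤ K := (norm_nonneg _).trans (hK x hx)
    have hsub : ∀ t ∈ uIoc 0 x, |t| ≤ X := fun t ht => by
      have := abs_sub_left_of_mem_uIcc (uIoc_subset_uIcc ht)
      simp only [sub_zero] at this
      exact this.trans hx
    have hb : ∀ t ∈ uIoc 0 x, ‖(A t + E • B) (picard A B c E n t)‖ ≤
        ‖c‖ * K ^ (n + 1) / n.factorial * |t - 0| ^ n := fun t ht => by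
      have ht' := hsub t ht
      refine (ContinuousLinearMap.le_opNorm _ _).trans ?_
      calc _ ≤ K * (‖c‖ * K ^ n / n.factorial * |t| ^ n) :=
            mul_le_mul (hK t ht') (ih ht') (norm_nonneg _) hK0
        _ = _ := by rw [sub_zero]; ring
    have hi : IntegrableOn (fun t : ℝ => ‖c‖ * K ^ (n + 1) / n.factorial * |t - 0| ^ n)
        (uIoc 0 x) := by
      rw [← intervalIntegrable_iff]
      exact Continuous.intervalIntegrable (by fun_prop) _ _
    rw [picard, norm_integral_eq_norm_integral_uIoc]
    refine (MeasureTheory.norm_integral_le_of_norm_le hi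
      ((ae_restrict_iff' measurableSet_uIoc).2 (Filter.Eventually.of_forall hb))).trans ?_
    rw [MeasureTheory.integral_const_mul, integral_pow_abs_sub_uIoc, Nat.factorial_succ, sub_zero]
    push_cast
    apply le_of_eq
    field_simp

/-- Global solvability of a linear differential equation depending affinely on a complex parameter;
the solution is an entire function of the parameter. -/
theorem exists_linearODE_solution [CompleteSpace F] {A : ℝ → F →L[ℂ] F} (hA : Continuous A)
    (B : F →L[ℂ] F) (c : F) :
    ∃ Y : ℂ → ℝ → F, (∀ E, Y E 0 = c) ∧ (∀ E x, HasDerivAt (Y E) ((A x + E • B) (Y E x)) x) ∧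
      ∀ x, Differentiable ℂ fun E => Y E x := by
  have hbd : ∀ X ρ : ℝ, ∃ K : ℝ, 0 ≤ K ∧ ∀ E : ℂ, ‖E‖ ≤ ρ → ∀ x, |x| ≤ X → ‖A x + E • B‖ ≤ K := by
    intro X ρ
    obtain ⟨K, hK⟩ := (isCompact_Icc (a := -X) (b := X)).exists_bound_of_continuousOn
      hA.continuousOn
    refine ⟨|K| + |ρ| * ‖B‖, by positivity, fun E hE x hx => (norm_add_le _ _).trans ?_⟩
    rw [norm_smul]
    gcongr
    · exact (hK x (abs_le.1 hx)).trans (le_abs_self K)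
    · exact hE.trans (le_abs_self ρ)
  have hsum : ∀ X K : ℝ, Summable fun n : ℕ => ‖c‖ * K ^ n / n.factorial * X ^ n := by
    intro X K
    have := (Real.summable_pow_div_factorial (K * X)).mul_left ‖c‖
    refine this.congr fun n => ?_
    rw [mul_pow]; ring
  have hle : ∀ {X ρ K : ℝ}, 0 ≤ K → (∀ E : ℂ, ‖E‖ ≤ ρ → ∀ x, |x| ≤ X → ‖A x + E • B‖ ≤ K) →
      ∀ E : ℂ, ‖E‖ ≤ ρ → ∀ x, |x| ≤ X → ∀ n,
        ‖picard A B c E n x‖ ≤ ‖c‖ * K ^ n / n.factorial * X ^ n := by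
    intro X ρ K hK0 hK E hE x hx n
    refine (norm_picard_le B c (hK E hE) n hx).trans ?_
    gcongr
  refine ⟨fun E x => ∑' n, picard A B c E n x, fun E => ?_, fun E x => ?_, fun x E => ?_⟩
  · change ∑' n, picard A B c E n 0 = c
    rw [tsum_eq_single 0]
    · rfl
    · intro n hn
      obtain ⟨n, rfl⟩ := Nat.exists_eq_succ_of_ne_zero hn
      simp [picard]
  · obtain ⟨K, hK0, hK⟩ := hbd (|x| + 1) ‖E‖
    have hs := hsum (|x| + 1) K
    have hsx : ∀ y, |y| ≤ |x| + 1 → Summable fun n => picard A B c E n y := fun y hy =>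
      Summable.of_norm_bounded hs fun n => hle hK0 hK E le_rfl y hy n
    have hd : ∀ n y, HasDerivAt (picard A B c E (n + 1)) ((A y + E • B) (picard A B c E n y)) y :=
      fun n y => (Continuous.integral_hasStrictDerivAt
        ((hA.add continuous_const).clm_apply (continuous_picard hA B c E n)) 0 y).hasDerivAt
    have hx : x ∈ Ioo (-(|x| + 1)) (|x| + 1) := abs_lt.1 (by linarith)
    -- Termwise differentiation of the series with its constant zeroth term removed; the derived
    -- series is the coefficient operator applied to the full series. The interval is widened to |x|
    -- + 1 so that x is interior.
    have key := hasDerivAt_tsum_of_isPreconnected (hs.mul_left K) isOpen_Ioo isPreconnected_Ioo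
      (fun n y _ => hd n y) (fun n y hy => ?_) hx
      ((summable_nat_add_iff 1).2 (hsx x (by linarith))) hx
    · rw [← ContinuousLinearMap.map_tsum _ (hsx x (by linarith))] at key
      refine (key.const_add c).congr_of_eventuallyEq ?_
      filter_upwards [isOpen_Ioo.mem_nhds hx] with y hy
      rw [(hsx y (abs_lt.2 hy).le).tsum_eq_zero_add]
      rfl
    · refine (ContinuousLinearMap.le_opNorm _ _).trans ?_
      have hy' := (abs_lt.2 hy).le
      exact mul_le_mul (hK E le_rfl y hy') (hle hK0 hK E le_rfl y hy' n) (norm_nonneg _) hK0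
  · obtain ⟨K, hK0, hK⟩ := hbd |x| (‖E‖ + 1)
    have hE : E ∈ Metric.ball (0 : ℂ) (‖E‖ + 1) := by simp
    refine (Complex.differentiableOn_tsum_of_summable_norm (hsum |x| K)
      (fun n => (differentiable_picard hA B c n x).differentiableOn) Metric.isOpen_ball
      (fun n w hw => hle hK0 hK w ?_ x le_rfl n)).differentiableAt (Metric.isOpen_ball.mem_nhds hE)
    exact (mem_ball_zero_iff.1 hw).le

end LinearODE

/-! ### The first order system: energy bound and large parameter asymptotics. -/

open Complex

/-- The first order system equivalent to `L y = E y` for `y = (u, v)`. -/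
structure IsSol (p q : ℝ → ℂ) (E : ℂ) (u v : ℝ → ℂ) : Prop where
  du : ∀ x, HasDerivAt u (-I * E * u x + q x * v x) x
  dv : ∀ x, HasDerivAt v (p x * u x + I * E * v x) x

theorem exists_isSol {p q : ℝ → ℂ} (hp : Continuous p) (hq : Continuous q) (c d : ℂ) :
    ∃ u v : ℂ → ℝ → ℂ, (∀ E, u E 0 = c) ∧ (∀ E, v E 0 = d) ∧ (∀ E, IsSol p q E (u E) (v E)) ∧
      (∀ x, Differentiable ℂ fun E => u E x) ∧ ∀ x, Differentiable ℂ fun E => v E x := by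
  let A : ℝ → ℂ × ℂ →L[ℂ] ℂ × ℂ := fun x =>
    q x • (ContinuousLinearMap.inl ℂ ℂ ℂ ∘L ContinuousLinearMap.snd ℂ ℂ ℂ) +
    p x • (ContinuousLinearMap.inr ℂ ℂ ℂ ∘L ContinuousLinearMap.fst ℂ ℂ ℂ)
  let B : ℂ × ℂ →L[ℂ] ℂ × ℂ :=
    (-I) • (ContinuousLinearMap.inl ℂ ℂ ℂ ∘L ContinuousLinearMap.fst ℂ ℂ ℂ) +
    I • (ContinuousLinearMap.inr ℂ ℂ ℂ ∘L ContinuousLinearMap.snd ℂ ℂ ℂ)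
  have hA : Continuous A := (hq.smul continuous_const).add (hp.smul continuous_const)
  obtain ⟨Y, h0, hd, hh⟩ := exists_linearODE_solution hA B (c, d)
  refine ⟨fun E x => (Y E x).1, fun E x => (Y E x).2, fun E => congrArg Prod.fst (h0 E),
    fun E => congrArg Prod.snd (h0 E),
    fun E => ⟨fun x => ?_, fun x => ?_⟩, fun x => (hh x).fst, fun x => (hh x).snd⟩
  · have := (ContinuousLinearMap.fst ℝ ℂ ℂ).hasFDerivAt.comp_hasDerivAt x (hd E x)
    refine HasDerivAt.congr_deriv this ?_
    simp only [A, B, ContinuousLinearMap.coe_fst', ContinuousLinearMap.coe_snd', add_apply,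
      smul_apply, ContinuousLinearMap.comp_apply, ContinuousLinearMap.inl_apply,
      ContinuousLinearMap.inr_apply, Prod.fst_add, Prod.smul_fst,
      smul_eq_mul]
    ring
  · have := (ContinuousLinearMap.snd ℝ ℂ ℂ).hasFDerivAt.comp_hasDerivAt x (hd E x)
    refine HasDerivAt.congr_deriv this ?_
    simp only [A, B, ContinuousLinearMap.coe_fst', ContinuousLinearMap.coe_snd', add_apply,
      smul_apply, ContinuousLinearMap.comp_apply, ContinuousLinearMap.inl_apply,
      ContinuousLinearMap.inr_apply, Prod.snd_add, Prod.smul_snd,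
      smul_eq_mul]
    ring

theorem inner_mul_self (w u : ℂ) : inner ℝ u (w * u) = w.re * ‖u‖ ^ 2 := by
  rw [Complex.inner, ← Complex.normSq_eq_norm_sq, Complex.normSq_apply]
  simp
  ring

/-- Energy bound for the first order system. -/
theorem IsSol.norm_sq_le {p q : ℝ → ℂ} {E : ℂ} {u v : ℝ → ℂ} (h : IsSol p q E u v) {x₀ x₁ K : ℝ}
    (hp : ∀ t ∈ Set.Icc x₀ x₁, ‖p t‖ ≤ K) (hq : ∀ t ∈ Set.Icc x₀ x₁, ‖q t‖ ≤ K) {t : ℝ}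
    (ht : t ∈ Set.Icc x₀ x₁) :
    ‖u t‖ ^ 2 + ‖v t‖ ^ 2 ≤
      (‖u x₀‖ ^ 2 + ‖v x₀‖ ^ 2) * Real.exp (2 * (|E.im| + K) * (t - x₀)) := by
  set κ := 2 * (|E.im| + K)
  -- Gronwall by an integrating factor: the energy times exp(-κ(t - x₀)) decreases. In the real
  -- inner product the diagonal terms contribute only through Im E, so the rate contains |Im E|
  -- rather than ‖E‖.
  let e : ℝ → ℝ := fun t => (‖u t‖ ^ 2 + ‖v t‖ ^ 2) * Real.exp (-κ * (t - x₀))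
  have hd : ∀ t, HasDerivAt e
      ((2 * inner ℝ (u t) (-I * E * u t + q t * v t) + 2 * inner ℝ (v t) (p t * u t + I * E * v t)
        - κ * (‖u t‖ ^ 2 + ‖v t‖ ^ 2)) * Real.exp (-κ * (t - x₀))) t := by
    intro t
    have h1 := ((h.du t).norm_sq.add (h.dv t).norm_sq).mul
      ((((hasDerivAt_id t).sub_const x₀).const_mul (-κ)).exp)
    refine h1.congr_deriv ?_
    simp only [Pi.add_apply, id]
    ring
  have hanti : AntitoneOn e (Set.Icc x₀ x₁) := by
    refine antitoneOn_of_deriv_nonpos (convex_Icc _ _)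
      (fun t _ => (hd t).continuousAt.continuousWithinAt)
      (fun t _ => (hd t).differentiableAt.differentiableWithinAt) fun t ht => ?_
    rw [(hd t).deriv]
    refine mul_nonpos_of_nonpos_of_nonneg ?_ (Real.exp_pos _).le
    have ht' := interior_subset ht
    have e1 : inner ℝ (u t) (-I * E * u t) = E.im * ‖u t‖ ^ 2 := by
      rw [inner_mul_self]; simp
    have e2 : inner ℝ (v t) (I * E * v t) = -E.im * ‖v t‖ ^ 2 := by
      rw [inner_mul_self]; simp
    have e3 : inner ℝ (u t) (q t * v t) ≤ K * (‖u t‖ * ‖v t‖) := by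
      refine (real_inner_le_norm _ _).trans ?_
      rw [norm_mul]
      nlinarith [mul_le_mul_of_nonneg_right (hq t ht')
        (mul_nonneg (norm_nonneg (u t)) (norm_nonneg (v t)))]
    have e4 : inner ℝ (v t) (p t * u t) ≤ K * (‖u t‖ * ‖v t‖) := by
      refine (real_inner_le_norm _ _).trans ?_
      rw [norm_mul]
      nlinarith [mul_le_mul_of_nonneg_right (hp t ht')
        (mul_nonneg (norm_nonneg (u t)) (norm_nonneg (v t)))]
    have hK : 0 ≤ K := (norm_nonneg _).trans (hp t ht')
    rw [inner_add_right, inner_add_right, e1, e2]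
    have e5 : K * (‖u t‖ * ‖v t‖) * 2 ≤ K * (‖u t‖ ^ 2 + ‖v t‖ ^ 2) := by
      nlinarith [mul_nonneg hK (sq_nonneg (‖u t‖ - ‖v t‖))]
    have e6 : E.im * ‖u t‖ ^ 2 ≤ |E.im| * ‖u t‖ ^ 2 := by gcongr; exact le_abs_self _
    have e7 : -E.im * ‖v t‖ ^ 2 ≤ |E.im| * ‖v t‖ ^ 2 := by gcongr; exact neg_le_abs _
    simp only [κ]
    nlinarith
  have h2 := hanti (Set.left_mem_Icc.2 (ht.1.trans ht.2)) ht ht.1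
  simp only [e, sub_self, mul_zero, Real.exp_zero, mul_one] at h2
  calc _ = (‖u t‖ ^ 2 + ‖v t‖ ^ 2) * Real.exp (-κ * (t - x₀)) * Real.exp (κ * (t - x₀)) := by
        rw [mul_assoc, ← Real.exp_add]; simp
    _ ≤ _ := by gcongr

/-- Square root of the energy bound. The potential's contribution is frozen over the whole interval,
while the factor exp(|Im E|(t - x₀)) keeps its exact rate; the asymptotics depend on this sharpness.
-/
theorem IsSol.norm_le {p q : ℝ → ℂ} {E : ℂ} {u v : ℝ → ℂ} (h : IsSol p q E u v) {x₀ x₁ K : ℝ}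
    (hp : ∀ t ∈ Set.Icc x₀ x₁, ‖p t‖ ≤ K) (hq : ∀ t ∈ Set.Icc x₀ x₁, ‖q t‖ ≤ K)
    (hu : ‖u x₀‖ ≤ 1) (hv : ‖v x₀‖ ≤ 1) {t : ℝ} (ht : t ∈ Set.Icc x₀ x₁) :
    ‖u t‖ ≤ 2 * Real.exp (K * (x₁ - x₀)) * Real.exp (|E.im| * (t - x₀)) ∧
    ‖v t‖ ≤ 2 * Real.exp (K * (x₁ - x₀)) * Real.exp (|E.im| * (t - x₀)) := by
  have hK : 0 ≤ K := (norm_nonneg _).trans (hp t ht)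
  have h1 := h.norm_sq_le hp hq ht
  have h2 : ‖u t‖ ^ 2 + ‖v t‖ ^ 2 ≤
      (2 * Real.exp (K * (x₁ - x₀)) * Real.exp (|E.im| * (t - x₀))) ^ 2 := by
    refine h1.trans ?_
    have : (2 * Real.exp (K * (x₁ - x₀)) * Real.exp (|E.im| * (t - x₀))) ^ 2 =
        4 * Real.exp (2 * (K * (x₁ - x₀) + |E.im| * (t - x₀))) := by
      rw [mul_pow, mul_pow, ← Real.exp_nat_mul, ← Real.exp_nat_mul, mul_assoc, ← Real.exp_add]
      push_cast
      ring_nf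
    rw [this]
    gcongr ?_ * Real.exp ?_
    · nlinarith [norm_nonneg (u x₀), norm_nonneg (v x₀)]
    · nlinarith [mul_nonneg hK (sub_nonneg.2 ht.2)]
  have h3 : 0 ≤ 2 * Real.exp (K * (x₁ - x₀)) * Real.exp (|E.im| * (t - x₀)) := by positivity
  constructor
  · exact abs_le_of_sq_le_sq' (by nlinarith [sq_nonneg ‖v t‖]) h3 |>.2
  · exact abs_le_of_sq_le_sq' (by nlinarith [sq_nonneg ‖u t‖]) h3 |>.2

theorem norm_exp_I_mul (w : ℂ) (t : ℝ) : ‖exp (I * w * t)‖ = Real.exp (-w.im * t) := by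
  rw [Complex.norm_exp]
  simp

/-- If `w' = i E w + r` and `r` is small then `w` is close to the free solution. -/
theorem norm_sub_exp_mul_le {E : ℂ} {w r : ℝ → ℂ} {x₀ x₁ C : ℝ} (hx : x₀ ≤ x₁)
    (hw : ∀ t, HasDerivAt w (I * E * w t + r t) t)
    (hr : ∀ t ∈ Set.Icc x₀ x₁, ‖r t‖ ≤ C * Real.exp (|E.im| * (t - x₀))) :
    ‖w x₁ - exp (I * E * (x₁ - x₀ : ℝ)) * w x₀‖ ≤
      C * (x₁ - x₀) * Real.exp (|E.im| * (x₁ - x₀)) := by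
  have hC : 0 ≤ C := by
    have := (norm_nonneg _).trans (hr x₀ (Set.left_mem_Icc.2 hx))
    simpa using this
  -- Variation of constants, with the integrating factor normalized to 1 at the right end point.
  have hd : ∀ t, HasDerivAt (fun t : ℝ => exp (I * (-E) * (t - x₁ : ℝ)) * w t)
      (exp (I * (-E) * (t - x₁ : ℝ)) * r t) t := by
    intro t
    have h1 : HasDerivAt (fun t : ℝ => ((t - x₁ : ℝ) : ℂ)) 1 t := by
      simpa using ((hasDerivAt_id t).sub_const x₁).ofReal_comp
    have h2 := ((h1.const_mul (I * (-E))).cexp).mul (hw t)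
    refine h2.congr_deriv ?_
    ring
  have key := (convex_Icc x₀ x₁).norm_image_sub_le_of_norm_hasDerivWithin_le
    (C := C * Real.exp (|E.im| * (x₁ - x₀)))
    (fun t _ => (hd t).hasDerivWithinAt) (fun t ht => ?_) (Set.left_mem_Icc.2 hx)
    (Set.right_mem_Icc.2 hx)
  · simp only [sub_self, ofReal_zero, mul_zero, exp_zero, one_mul] at key
    have h3 : I * -E * (x₀ - x₁ : ℝ) = I * E * (x₁ - x₀ : ℝ) := by push_cast; ring
    rw [h3, Real.norm_of_nonneg (sub_nonneg.2 hx)] at key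
    calc _ ≤ _ := key
      _ = _ := by ring
  · rw [norm_mul, norm_exp_I_mul]
    calc _ ≤ Real.exp (-(-E).im * (t - x₁)) * (C * Real.exp (|E.im| * (t - x₀))) := by
          gcongr; exact hr t ht
      _ = C * Real.exp (E.im * (t - x₁) + |E.im| * (t - x₀)) := by
          rw [Real.exp_add]; simp; ring
      _ ≤ _ := by
          gcongr
          nlinarith [neg_abs_le E.im, mul_nonneg (sub_nonneg.2 (neg_abs_le E.im))
            (sub_nonneg.2 ht.2), mul_nonneg (sub_nonneg.2 (neg_le_abs E.im))
            (sub_nonneg.2 ht.2)]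

/-- Large spectral parameter asymptotics of solutions over a fixed interval. -/
theorem exists_isSol_asymptotics {p q : ℝ → ℂ} (hp : ContDiff ℝ 2 p) (hq : ContDiff ℝ 2 q)
    {x₀ x₁ : ℝ} (hx : x₀ ≤ x₁) :
    ∃ C : ℝ, 0 ≤ C ∧ ∀ (E : ℂ) (u v : ℝ → ℂ), 1 ≤ ‖E‖ → IsSol p q E u v →
      ‖u x₀‖ ≤ 1 → ‖v x₀‖ ≤ 1 →
      ‖u x₁ - exp (-(I * E * (x₁ - x₀ : ℝ))) * u x₀‖ ≤
        C / ‖E‖ * Real.exp (|E.im| * (x₁ - x₀)) ∧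
      ‖v x₁ - exp (I * E * (x₁ - x₀ : ℝ)) * v x₀‖ ≤
        C / ‖E‖ * Real.exp (|E.im| * (x₁ - x₀)) := by
  have hbd : ∀ f : ℝ → ℂ, Continuous f → ∃ K, 0 ≤ K ∧ ∀ t ∈ Set.Icc x₀ x₁, ‖f t‖ ≤ K := by
    intro f hf
    obtain ⟨K, hK⟩ := (isCompact_Icc (a := x₀) (b := x₁)).exists_bound_of_continuousOn
      hf.continuousOn
    exact ⟨K, (norm_nonneg _).trans (hK x₀ (Set.left_mem_Icc.2 hx)), hK⟩
  obtain ⟨Kp, hKp0, hKp⟩ := hbd p hp.continuous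
  obtain ⟨Kq, hKq0, hKq⟩ := hbd q hq.continuous
  obtain ⟨Kp', hKp'0, hKp'⟩ := hbd (deriv p) (hp.continuous_deriv (by norm_num))
  obtain ⟨Kq', hKq'0, hKq'⟩ := hbd (deriv q) (hq.continuous_deriv (by norm_num))
  set K := Kp + Kq + Kp' + Kq' with hKdef
  have hK0 : 0 ≤ K := by positivity
  have hpK : ∀ t ∈ Set.Icc x₀ x₁, ‖p t‖ ≤ K := fun t ht => (hKp t ht).trans (by linarith)
  have hqK : ∀ t ∈ Set.Icc x₀ x₁, ‖q t‖ ≤ K := fun t ht => (hKq t ht).trans (by linarith)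
  have hpK' : ∀ t ∈ Set.Icc x₀ x₁, ‖deriv p t‖ ≤ K := fun t ht =>
    (hKp' t ht).trans (by linarith)
  have hqK' : ∀ t ∈ Set.Icc x₀ x₁, ‖deriv q t‖ ≤ K := fun t ht =>
    (hKq' t ht).trans (by linarith)
  have hpd : ∀ t, HasDerivAt p (deriv p t) t := fun t =>
    (hp.differentiable (by norm_num) t).hasDerivAt
  have hqd : ∀ t, HasDerivAt q (deriv q t) t := fun t =>
    (hq.differentiable (by norm_num) t).hasDerivAt
  set M := 2 * Real.exp (K * (x₁ - x₀)) with hM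
  have hM0 : 0 ≤ M := by positivity
  set X := x₁ - x₀ with hX
  have hX0 : 0 ≤ X := sub_nonneg.2 hx
  -- The first summand is the remainder integrated over the interval; the second pays for undoing
  -- the change of unknown at the two end points.
  refine ⟨(K * M + K * K * M) * X + 2 * (K * M), by positivity, fun E u v hE h hu hv => ?_⟩
  have hEp : 0 < ‖E‖ := by linarith
  have hE0 : E ≠ 0 := norm_pos_iff.1 hEp
  have hb := fun t ht => h.norm_le hpK hqK hu hv (t := t) ht
  rw [← hM] at hb
  have hnE : ‖2 * I * E‖ = 2 * ‖E‖ := by simp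
  have haux : ∀ {f g : ℝ → ℂ} {s t : ℝ}, t ∈ Set.Icc x₀ x₁ → ‖f t‖ ≤ K →
      ‖g t‖ ≤ M * Real.exp (|E.im| * (t - x₀)) →
      ‖f t * g t / (2 * I * E)‖ ≤ K * M / ‖E‖ * Real.exp (|E.im| * X) := by
    intro f g s t ht hf hg
    rw [norm_div, norm_mul, hnE, div_le_iff₀ (by positivity)]
    calc _ ≤ K * (M * Real.exp (|E.im| * X)) := by
          gcongr
          refine hg.trans ?_
          gcongr
          simp only [hX]; linarith [ht.2]
      _ ≤ 2 * (K * (M * Real.exp (|E.im| * X))) := by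
          linarith [show 0 ≤ K * (M * Real.exp (|E.im| * X)) by positivity]
      _ = _ := by field_simp
  have hrem : ∀ {f g k l : ℝ → ℂ} {t : ℝ}, t ∈ Set.Icc x₀ x₁ → ‖f t‖ ≤ K → ‖k t‖ ≤ K →
      ‖l t‖ ≤ K → ∀ {y z : ℂ}, ‖y‖ ≤ M * Real.exp (|E.im| * (t - x₀)) →
      ‖z‖ ≤ M * Real.exp (|E.im| * (t - x₀)) →
      ‖(f t * y + k t * (l t * z)) / (2 * I * E)‖ ≤
        (K * M + K * K * M) / ‖E‖ * Real.exp (|E.im| * (t - x₀)) := by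
    intro f g k l t ht hf hk hl y z hy hz
    rw [norm_div, hnE, div_le_iff₀ (by positivity)]
    calc _ ≤ K * (M * Real.exp (|E.im| * (t - x₀))) +
          K * (K * (M * Real.exp (|E.im| * (t - x₀)))) := by
          refine (norm_add_le _ _).trans ?_
          rw [norm_mul, norm_mul, norm_mul]
          gcongr
      _ = 1 * ((K * M + K * K * M) * Real.exp (|E.im| * (t - x₀))) := by ring
      _ ≤ 2 * ((K * M + K * K * M) * Real.exp (|E.im| * (t - x₀))) := by
          gcongr; norm_num
      _ = _ := by field_simp
  have hx0 := Set.left_mem_Icc.2 hx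
  have hx1 := Set.right_mem_Icc.2 hx
  have hfin : ∀ {e w₁ w₀ d₁ d₀ : ℂ}, ‖(w₁ + d₁) - e * (w₀ + d₀)‖ ≤
      (K * M + K * K * M) / ‖E‖ * X * Real.exp (|E.im| * X) → ‖e‖ ≤ Real.exp (|E.im| * X) →
      ‖d₁‖ ≤ K * M / ‖E‖ * Real.exp (|E.im| * X) → ‖d₀‖ ≤ K * M / ‖E‖ →
      ‖w₁ - e * w₀‖ ≤ ((K * M + K * K * M) * X + 2 * (K * M)) / ‖E‖ *
        Real.exp (|E.im| * X) := by
    intro e w₁ w₀ d₁ d₀ h1 h2 h3 h4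
    have : w₁ - e * w₀ = ((w₁ + d₁) - e * (w₀ + d₀)) - d₁ + e * d₀ := by ring
    rw [this]
    calc _ ≤ (K * M + K * K * M) / ‖E‖ * X * Real.exp (|E.im| * X) +
          K * M / ‖E‖ * Real.exp (|E.im| * X) + Real.exp (|E.im| * X) * (K * M / ‖E‖) := by
          refine (norm_add_le _ _).trans (add_le_add ((norm_sub_le _ _).trans
            (add_le_add h1 h3)) ?_)
          rw [norm_mul]
          gcongr
      _ = _ := by field_simp; ring
  have hinit : ∀ {f g : ℝ → ℂ}, ‖f x₀‖ ≤ K → ‖g x₀‖ ≤ 1 →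
      ‖f x₀ * g x₀ / (2 * I * E)‖ ≤ K * M / ‖E‖ := by
    intro f g hf hg
    have hM1 : 1 ≤ M := by
      have : 1 ≤ Real.exp (K * X) := Real.one_le_exp (by positivity)
      linarith
    rw [norm_div, norm_mul, hnE, div_le_iff₀ (by positivity)]
    calc _ ≤ K * M := by
          gcongr; linarith
      _ ≤ 2 * (K * M) := by linarith [mul_nonneg hK0 hM0]
      _ = _ := by field_simp
  constructor
  -- This change of unknown is an integration by parts in disguise: it cancels the bounded coupling
  -- term q v and leaves a remainder of order 1/E, at the cost of one derivative of q.
  · have hw : ∀ t, HasDerivAt (fun t => u t - q t * v t / (2 * I * E))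
        (I * (-E) * (u t - q t * v t / (2 * I * E)) +
          -((deriv q t * v t + q t * (p t * u t)) / (2 * I * E))) t := by
      intro t
      refine ((h.du t).sub (((hqd t).mul (h.dv t)).div_const _)).congr_deriv ?_
      field_simp
      ring_nf
    have h1 := norm_sub_exp_mul_le hx hw (C := (K * M + K * K * M) / ‖E‖) (fun t ht => by
      rw [norm_neg, neg_im, abs_neg]
      exact hrem (g := 0) ht (hqK' t ht) (hqK t ht) (hpK t ht) (hb t ht).2 (hb t ht).1)
    rw [neg_im, abs_neg, sub_eq_add_neg (u x₁), sub_eq_add_neg (u x₀)] at h1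
    rw [show -(I * E * (X : ℂ)) = I * (-E) * (X : ℂ) by ring]
    refine hfin h1 ?_ ?_ ?_
    · rw [norm_exp_I_mul]
      gcongr
      simpa using le_abs_self _
    · rw [norm_neg]
      exact haux (s := 0) hx1 (hqK _ hx1) (hb _ hx1).2
    · rw [norm_neg]
      exact hinit (hqK _ hx0) hv
  · have hw : ∀ t, HasDerivAt (fun t => v t + p t * u t / (2 * I * E))
        (I * E * (v t + p t * u t / (2 * I * E)) +
          (deriv p t * u t + p t * (q t * v t)) / (2 * I * E)) t := by
      intro t
      refine ((h.dv t).add (((hpd t).mul (h.du t)).div_const _)).congr_deriv ?_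
      field_simp
      ring_nf
    have h1 := norm_sub_exp_mul_le hx hw (C := (K * M + K * K * M) / ‖E‖) (fun t ht =>
      hrem (g := 0) ht (hpK' t ht) (hpK t ht) (hqK t ht) (hb t ht).1 (hb t ht).2)
    refine hfin h1 ?_ ?_ ?_
    · rw [norm_exp_I_mul]
      gcongr
      exact neg_le_abs _
    · exact haux (s := 0) hx1 (hpK _ hx1) (hb _ hx1).1
    · exact hinit (hpK _ hx0) hu

end AKNS

/-! ### Fundamental system and monodromy matrix. -/

namespace AKNS

open Complex

/-- A fundamental system of solutions of `L y = E y`, normalized at `0` and entire in `E`. -/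
structure Fundamental (p q : ℝ → ℂ) where
  (u₁ v₁ u₂ v₂ : ℂ → ℝ → ℂ)
  sol₁ : ∀ E, IsSol p q E (u₁ E) (v₁ E)
  sol₂ : ∀ E, IsSol p q E (u₂ E) (v₂ E)
  u₁_zero : ∀ E, u₁ E 0 = 1
  v₁_zero : ∀ E, v₁ E 0 = 0
  u₂_zero : ∀ E, u₂ E 0 = 0
  v₂_zero : ∀ E, v₂ E 0 = 1
  hol_u₁ : ∀ x, Differentiable ℂ fun E => u₁ E x
  hol_v₁ : ∀ x, Differentiable ℂ fun E => v₁ E x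
  hol_u₂ : ∀ x, Differentiable ℂ fun E => u₂ E x
  hol_v₂ : ∀ x, Differentiable ℂ fun E => v₂ E x

theorem nonempty_fundamental {p q : ℝ → ℂ} (hp : Continuous p) (hq : Continuous q) :
    Nonempty (Fundamental p q) := by
  obtain ⟨u₁, v₁, h1, h2, h3, h4, h5⟩ := exists_isSol hp hq 1 0
  obtain ⟨u₂, v₂, k1, k2, k3, k4, k5⟩ := exists_isSol hp hq 0 1
  exact ⟨⟨u₁, v₁, u₂, v₂, h3, k3, h1, h2, k1, k2, h4, h5, k4, k5⟩⟩

theorem IsSol.combine {p q : ℝ → ℂ} {E : ℂ} {u v u' v' : ℝ → ℂ} (h : IsSol p q E u v)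
    (h' : IsSol p q E u' v') (c d : ℂ) :
    IsSol p q E (fun x => u x * c + u' x * d) (fun x => v x * c + v' x * d) :=
  ⟨fun x => (((h.du x).mul_const c).add ((h'.du x).mul_const d)).congr_deriv (by ring),
    fun x => (((h.dv x).mul_const c).add ((h'.dv x).mul_const d)).congr_deriv (by ring)⟩

theorem IsSol.shift {p q : ℝ → ℂ} {E : ℂ} {u v : ℝ → ℂ} (h : IsSol p q E u v) {T : ℝ}
    (hp : Function.Periodic p T) (hq : Function.Periodic q T) :
    IsSol p q E (fun x => u (x + T)) (fun x => v (x + T)) :=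
  ⟨fun x => by simpa only [hq x] using (h.du (x + T)).comp_add_const x T,
    fun x => by simpa only [hp x] using (h.dv (x + T)).comp_add_const x T⟩

theorem eq_of_hasDerivAt_zero {f : ℝ → ℂ} (h : ∀ x, HasDerivAt f 0 x) (x y : ℝ) : f x = f y :=
  is_const_of_deriv_eq_zero (fun x => (h x).differentiableAt) (fun x => (h x).deriv) x y

/-- The coefficient matrix of the system has trace zero. -/
theorem IsSol.wronskian {p q : ℝ → ℂ} {E : ℂ} {u v u' v' : ℝ → ℂ} (h : IsSol p q E u v)
    (h' : IsSol p q E u' v') (x y : ℝ) : u x * v' x - u' x * v x = u y * v' y - u' y * v y :=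
  eq_of_hasDerivAt_zero (f := fun x => u x * v' x - u' x * v x) (fun x =>
    (((h.du x).mul (h'.dv x)).sub ((h'.du x).mul (h.dv x))).congr_deriv (by ring)) x y

namespace Fundamental

variable {p q : ℝ → ℂ} (φ : Fundamental p q)

theorem det_eq_one (E : ℂ) (x : ℝ) : φ.u₁ E x * φ.v₂ E x - φ.u₂ E x * φ.v₁ E x = 1 := by
  rw [(φ.sol₁ E).wronskian (φ.sol₂ E) x 0]
  simp [φ.u₁_zero, φ.v₁_zero, φ.u₂_zero, φ.v₂_zero]

/-- Cramer's rule with constant Wronskians; uniqueness for the initial value problem comes for free,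
without a Lipschitz argument. -/
theorem sol_eq {E : ℂ} {u v : ℝ → ℂ} (h : IsSol p q E u v) (x : ℝ) :
    u x = φ.u₁ E x * u 0 + φ.u₂ E x * v 0 ∧ v x = φ.v₁ E x * u 0 + φ.v₂ E x * v 0 := by
  have h1 := h.wronskian (φ.sol₁ E) x 0
  have h2 := h.wronskian (φ.sol₂ E) x 0
  have h3 := φ.det_eq_one E x
  simp only [φ.u₁_zero, φ.v₁_zero, φ.u₂_zero, φ.v₂_zero] at h1 h2
  constructor
  · linear_combination (-u x) * h3 + φ.u₁ E x * h2 - φ.u₂ E x * h1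
  · linear_combination (-v x) * h3 + φ.v₁ E x * h2 - φ.v₂ E x * h1

theorem sol_eq_zero (φ : Fundamental p q) {E : ℂ} {u v : ℝ → ℂ} (h : IsSol p q E u v) {x₀ : ℝ} (hu : u x₀ = 0)
    (hv : v x₀ = 0) (x : ℝ) : u x = 0 ∧ v x = 0 := by
  have h1 := h.wronskian (φ.sol₁ E) x x₀
  have h2 := h.wronskian (φ.sol₂ E) x x₀
  have h3 := φ.det_eq_one E x
  rw [hu, hv] at h1 h2
  constructor
  · linear_combination (-u x) * h3 + φ.u₁ E x * h2 - φ.u₂ E x * h1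
  · linear_combination (-v x) * h3 + φ.v₁ E x * h2 - φ.v₂ E x * h1

variable (Ω : ℝ)

/-- The entries of the monodromy matrix with base point `x`. -/
noncomputable def M₁₁ (E : ℂ) (x : ℝ) : ℂ := φ.u₁ E (x + Ω) * φ.v₂ E x + φ.u₂ E (x + Ω) * (-φ.v₁ E x)

/-- An entry of the monodromy matrix based at `x`. -/
noncomputable def M₁₂ (E : ℂ) (x : ℝ) : ℂ := φ.u₁ E (x + Ω) * (-φ.u₂ E x) + φ.u₂ E (x + Ω) * φ.u₁ E x

/-- An entry of the monodromy matrix based at `x`. -/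
noncomputable def M₂₁ (E : ℂ) (x : ℝ) : ℂ := φ.v₁ E (x + Ω) * φ.v₂ E x + φ.v₂ E (x + Ω) * (-φ.v₁ E x)

/-- An entry of the monodromy matrix based at `x`. -/
noncomputable def M₂₂ (E : ℂ) (x : ℝ) : ℂ := φ.v₁ E (x + Ω) * (-φ.u₂ E x) + φ.v₂ E (x + Ω) * φ.u₁ E x

/-- The diagonal entry of the trace-free part of the monodromy matrix. -/
noncomputable def a (E : ℂ) (x : ℝ) : ℂ := (φ.M₁₁ Ω E x - φ.M₂₂ Ω E x) / 2

/-- The trace of the monodromy matrix. -/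
noncomputable def tr (E : ℂ) : ℂ := φ.M₁₁ Ω E 0 + φ.M₂₂ Ω E 0

/-- The discriminant `(tr T(E))² - 4`. -/
noncomputable def s (E : ℂ) : ℂ := φ.tr Ω E ^ 2 - 4

theorem hol_M₁₁ (x : ℝ) : Differentiable ℂ fun E => φ.M₁₁ Ω E x :=
  ((φ.hol_u₁ _).mul (φ.hol_v₂ _)).add ((φ.hol_u₂ _).mul (φ.hol_v₁ _).neg)

theorem hol_M₁₂ (x : ℝ) : Differentiable ℂ fun E => φ.M₁₂ Ω E x :=
  ((φ.hol_u₁ _).mul (φ.hol_u₂ _).neg).add ((φ.hol_u₂ _).mul (φ.hol_u₁ _))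

theorem hol_M₂₁ (x : ℝ) : Differentiable ℂ fun E => φ.M₂₁ Ω E x :=
  ((φ.hol_v₁ _).mul (φ.hol_v₂ _)).add ((φ.hol_v₂ _).mul (φ.hol_v₁ _).neg)

theorem hol_M₂₂ (x : ℝ) : Differentiable ℂ fun E => φ.M₂₂ Ω E x :=
  ((φ.hol_v₁ _).mul (φ.hol_u₂ _).neg).add ((φ.hol_v₂ _).mul (φ.hol_u₁ _))

theorem hol_a (x : ℝ) : Differentiable ℂ fun E => φ.a Ω E x :=
  ((φ.hol_M₁₁ Ω x).sub (φ.hol_M₂₂ Ω x)).div_const 2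

theorem hol_tr : Differentiable ℂ (φ.tr Ω) := (φ.hol_M₁₁ Ω 0).add (φ.hol_M₂₂ Ω 0)

theorem hol_s : Differentiable ℂ (φ.s Ω) := ((φ.hol_tr Ω).pow 2).sub_const 4

variable {Ω}

theorem hasDerivAt_M₁₁ (hp : Function.Periodic p Ω) (hq : Function.Periodic q Ω)
    (E : ℂ) (x : ℝ) :
    HasDerivAt (φ.M₁₁ Ω E) (q x * φ.M₂₁ Ω E x - p x * φ.M₁₂ Ω E x) x := by
  have h1 := (φ.sol₁ E).shift hp hq
  have h2 := (φ.sol₂ E).shift hp hq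
  refine (((h1.du x).mul ((φ.sol₂ E).dv x)).add
    ((h2.du x).mul ((φ.sol₁ E).dv x).neg)).congr_deriv ?_
  simp only [M₂₁, M₁₂, Pi.neg_apply]
  ring

theorem hasDerivAt_M₂₂ (hp : Function.Periodic p Ω) (hq : Function.Periodic q Ω)
    (E : ℂ) (x : ℝ) :
    HasDerivAt (φ.M₂₂ Ω E) (p x * φ.M₁₂ Ω E x - q x * φ.M₂₁ Ω E x) x := by
  have h1 := (φ.sol₁ E).shift hp hq
  have h2 := (φ.sol₂ E).shift hp hq
  refine (((h1.dv x).mul ((φ.sol₂ E).du x).neg).add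
    ((h2.dv x).mul ((φ.sol₁ E).du x))).congr_deriv ?_
  simp only [M₂₁, M₁₂, Pi.neg_apply]
  ring

theorem hasDerivAt_M₁₂ (hp : Function.Periodic p Ω) (hq : Function.Periodic q Ω)
    (E : ℂ) (x : ℝ) :
    HasDerivAt (φ.M₁₂ Ω E) (-2 * I * E * φ.M₁₂ Ω E x - 2 * q x * φ.a Ω E x) x := by
  have h1 := (φ.sol₁ E).shift hp hq
  have h2 := (φ.sol₂ E).shift hp hq
  refine (((h1.du x).mul ((φ.sol₂ E).du x).neg).add
    ((h2.du x).mul ((φ.sol₁ E).du x))).congr_deriv ?_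
  simp only [a, M₁₁, M₂₂, M₁₂, Pi.neg_apply]
  ring

theorem hasDerivAt_M₂₁ (hp : Function.Periodic p Ω) (hq : Function.Periodic q Ω)
    (E : ℂ) (x : ℝ) :
    HasDerivAt (φ.M₂₁ Ω E) (2 * I * E * φ.M₂₁ Ω E x + 2 * p x * φ.a Ω E x) x := by
  have h1 := (φ.sol₁ E).shift hp hq
  have h2 := (φ.sol₂ E).shift hp hq
  refine (((h1.dv x).mul ((φ.sol₂ E).dv x)).add
    ((h2.dv x).mul ((φ.sol₁ E).dv x).neg)).congr_deriv ?_
  simp only [a, M₁₁, M₂₂, M₂₁, Pi.neg_apply]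
  ring

theorem hasDerivAt_a (hp : Function.Periodic p Ω) (hq : Function.Periodic q Ω)
    (E : ℂ) (x : ℝ) :
    HasDerivAt (φ.a Ω E) (q x * φ.M₂₁ Ω E x - p x * φ.M₁₂ Ω E x) x :=
  (((φ.hasDerivAt_M₁₁ hp hq E x).sub (φ.hasDerivAt_M₂₂ hp hq E x)).div_const 2).congr_deriv
    (by ring)

theorem tr_eq (hp : Function.Periodic p Ω) (hq : Function.Periodic q Ω)
    (E : ℂ) (x : ℝ) :
    φ.M₁₁ Ω E x + φ.M₂₂ Ω E x = φ.tr Ω E :=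
  eq_of_hasDerivAt_zero (f := fun x => φ.M₁₁ Ω E x + φ.M₂₂ Ω E x) (fun x =>
    ((φ.hasDerivAt_M₁₁ hp hq E x).add (φ.hasDerivAt_M₂₂ hp hq E x)).congr_deriv (by ring)) x 0

theorem M₁₁_eq (hp : Function.Periodic p Ω) (hq : Function.Periodic q Ω)
    (E : ℂ) (x : ℝ) :
    φ.M₁₁ Ω E x = φ.tr Ω E / 2 + φ.a Ω E x := by
  rw [← φ.tr_eq hp hq E x, a]; ring

theorem M₂₂_eq (hp : Function.Periodic p Ω) (hq : Function.Periodic q Ω)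
    (E : ℂ) (x : ℝ) :
    φ.M₂₂ Ω E x = φ.tr Ω E / 2 - φ.a Ω E x := by
  rw [← φ.tr_eq hp hq E x, a]; ring

theorem det_M (E : ℂ) (x : ℝ) :
    φ.M₁₁ Ω E x * φ.M₂₂ Ω E x - φ.M₁₂ Ω E x * φ.M₂₁ Ω E x = 1 := by
  have h1 := φ.det_eq_one E x
  have h2 := φ.det_eq_one E (x + Ω)
  simp only [M₁₁, M₁₂, M₂₁, M₂₂]
  linear_combination h1 + (φ.u₁ E x * φ.v₂ E x - φ.u₂ E x * φ.v₁ E x) * h2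

/-- With M = Δ/2 + W, the condition det M = 1 reads Δ²/4 + det W = 1. -/
theorem s_eq (hp : Function.Periodic p Ω) (hq : Function.Periodic q Ω)
    (E : ℂ) (x : ℝ) :
    φ.s Ω E = 4 * (φ.a Ω E x ^ 2 + φ.M₁₂ Ω E x * φ.M₂₁ Ω E x) := by
  have h := φ.det_M (Ω := Ω) E x
  rw [φ.M₁₁_eq hp hq, φ.M₂₂_eq hp hq] at h
  rw [s]
  linear_combination 4 * h

/-- Translation by a period is multiplication by the monodromy matrix. -/
theorem sol_shift {E : ℂ} {u v : ℝ → ℂ} (h : IsSol p q E u v) (x : ℝ) :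
    u (x + Ω) = φ.M₁₁ Ω E x * u x + φ.M₁₂ Ω E x * v x ∧
    v (x + Ω) = φ.M₂₁ Ω E x * u x + φ.M₂₂ Ω E x * v x := by
  have h3 := φ.det_eq_one E x
  rw [(φ.sol_eq h (x + Ω)).1, (φ.sol_eq h (x + Ω)).2, (φ.sol_eq h x).1, (φ.sol_eq h x).2]
  simp only [M₁₁, M₁₂, M₂₁, M₂₂]
  constructor
  · linear_combination -(φ.u₁ E (x + Ω) * u 0 + φ.u₂ E (x + Ω) * v 0) * h3
  · linear_combination -(φ.v₁ E (x + Ω) * u 0 + φ.v₂ E (x + Ω) * v 0) * h3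

/-- The monodromy matrices with base points `0` and `x` are conjugate. -/
theorem conj_M₁₂ (hp : Function.Periodic p Ω) (hq : Function.Periodic q Ω)
    (E : ℂ) (x : ℝ) :
    φ.M₁₂ Ω E x = φ.u₁ E x ^ 2 * φ.M₁₂ Ω E 0 - 2 * φ.u₁ E x * φ.u₂ E x * φ.a Ω E 0
      - φ.u₂ E x ^ 2 * φ.M₂₁ Ω E 0 ∧
    φ.M₂₁ Ω E x = φ.v₂ E x ^ 2 * φ.M₂₁ Ω E 0 + 2 * φ.v₁ E x * φ.v₂ E x * φ.a Ω E 0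
      - φ.v₁ E x ^ 2 * φ.M₁₂ Ω E 0 ∧
    φ.a Ω E x = (φ.u₁ E x * φ.v₂ E x + φ.u₂ E x * φ.v₁ E x) * φ.a Ω E 0
      - φ.u₁ E x * φ.v₁ E x * φ.M₁₂ Ω E 0 + φ.u₂ E x * φ.v₂ E x * φ.M₂₁ Ω E 0 := by
  have h1 := (φ.sol_eq ((φ.sol₁ E).shift hp hq) x)
  have h2 := (φ.sol_eq ((φ.sol₂ E).shift hp hq) x)
  have k1 := φ.sol_shift (Ω := Ω) (φ.sol₁ E) 0
  have k2 := φ.sol_shift (Ω := Ω) (φ.sol₂ E) 0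
  simp only [φ.u₁_zero, φ.v₁_zero, φ.u₂_zero, φ.v₂_zero, mul_one, mul_zero, add_zero,
    zero_add] at k1 k2 h1 h2
  rw [k1.1, k1.2] at h1
  rw [k2.1, k2.2] at h2
  refine ⟨?_, ?_, ?_⟩
  · rw [M₁₂, h1.1, h2.1, a]; ring
  · rw [M₂₁, h1.2, h2.2, a]; ring
  · rw [a, M₁₁, M₂₂, h1.1, h1.2, h2.1, h2.2, a]; ring

/-- The solution with data `(1, 0)` at `x`. -/
theorem isSol_col₁ (E : ℂ) (x : ℝ) : IsSol p q E
    (fun t => φ.u₁ E t * φ.v₂ E x + φ.u₂ E t * (-φ.v₁ E x))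
    (fun t => φ.v₁ E t * φ.v₂ E x + φ.v₂ E t * (-φ.v₁ E x)) :=
  (φ.sol₁ E).combine (φ.sol₂ E) _ _

/-- The solution with data `(0, 1)` at `x`. -/
theorem isSol_col₂ (E : ℂ) (x : ℝ) : IsSol p q E
    (fun t => φ.u₁ E t * (-φ.u₂ E x) + φ.u₂ E t * φ.u₁ E x)
    (fun t => φ.v₁ E t * (-φ.u₂ E x) + φ.v₂ E t * φ.u₁ E x) :=
  (φ.sol₁ E).combine (φ.sol₂ E) _ _

/-- The columns of the monodromy matrix at x are the values at x + Ω of the solutions with data (1,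
0) and (0, 1) at x. The general asymptotics apply to them directly. -/
theorem exists_asymptotics (hΩ : 0 < Ω) (hp2 : ContDiff ℝ 2 p) (hq2 : ContDiff ℝ 2 q) (x : ℝ) :
    ∃ C : ℝ, 0 ≤ C ∧ ∀ E : ℂ, 1 ≤ ‖E‖ →
      ‖φ.M₁₁ Ω E x - exp (-(I * E * Ω))‖ ≤ C / ‖E‖ * Real.exp (|E.im| * Ω) ∧
      ‖φ.M₂₁ Ω E x‖ ≤ C / ‖E‖ * Real.exp (|E.im| * Ω) ∧
      ‖φ.M₁₂ Ω E x‖ ≤ C / ‖E‖ * Real.exp (|E.im| * Ω) ∧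
      ‖φ.M₂₂ Ω E x - exp (I * E * Ω)‖ ≤ C / ‖E‖ * Real.exp (|E.im| * Ω) := by
  obtain ⟨C, hC, h⟩ := exists_isSol_asymptotics hp2 hq2 (x₀ := x) (x₁ := x + Ω) (by linarith)
  refine ⟨C, hC, fun E hE => ?_⟩
  have h3 := φ.det_eq_one E x
  have e1 : φ.u₁ E x * φ.v₂ E x + φ.u₂ E x * (-φ.v₁ E x) = 1 := by linear_combination h3
  have e2 : φ.v₁ E x * φ.v₂ E x + φ.v₂ E x * (-φ.v₁ E x) = 0 := by ring
  have e3 : φ.u₁ E x * (-φ.u₂ E x) + φ.u₂ E x * φ.u₁ E x = 0 := by ring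
  have e4 : φ.v₁ E x * (-φ.u₂ E x) + φ.v₂ E x * φ.u₁ E x = 1 := by linear_combination h3
  have h1 := h E _ _ hE (φ.isSol_col₁ E x) (by rw [e1]; simp) (by rw [e2]; simp)
  have h2 := h E _ _ hE (φ.isSol_col₂ E x) (by rw [e3]; simp) (by rw [e4]; simp)
  rw [add_sub_cancel_left, e1, e2] at h1
  rw [add_sub_cancel_left, e3, e4] at h2
  simp only [mul_one, mul_zero, sub_zero] at h1 h2
  exact ⟨h1.1, h1.2, h2.1, h2.2⟩

end Fundamental

/-! ### The solution space, the trace of translation and degenerate monodromy. -/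

section SolutionSpace

variable {p q : ℝ → ℂ}

theorem isSol_of_mem {E : ℂ} {y : ℝ → Fin 2 → ℂ} (hy : y ∈ solutionSpace p q E) :
    IsSol p q E (fun x => y x 0) (fun x => y x 1) := by
  have hd : ∀ x, HasDerivAt y (deriv y x) x := fun x => (hy.1 x).hasDerivAt
  have h : ∀ x, I * deriv y x 0 + -I * q x * y x 1 = E * y x 0 ∧
      -I * deriv y x 1 + I * p x * y x 0 = E * y x 1 := fun x => by
    have h0 := congrFun (hy.2 x) 0
    have h1 := congrFun (hy.2 x) 1
    simp [L, J, Q, dotProduct, Fin.sum_univ_two] at h0 h1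
    constructor
    · linear_combination h0
    · linear_combination h1
  constructor
  · intro x
    refine (hasDerivAt_pi.1 (hd x) 0).congr_deriv ?_
    linear_combination (-I) * (h x).1 + (deriv y x 0 - q x * y x 1) * I_sq
  · intro x
    refine (hasDerivAt_pi.1 (hd x) 1).congr_deriv ?_
    linear_combination I * (h x).2 + (deriv y x 1 - p x * y x 0) * I_sq

theorem IsSol.mem {E : ℂ} {u v : ℝ → ℂ} (h : IsSol p q E u v) :
    (fun x => ![u x, v x]) ∈ solutionSpace p q E := by
  have hd : ∀ x, HasDerivAt (fun x => ![u x, v x])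
      ![-I * E * u x + q x * v x, p x * u x + I * E * v x] x := fun x => by
    rw [hasDerivAt_pi]
    intro i
    fin_cases i
    · exact h.du x
    · exact h.dv x
  refine ⟨fun x => (hd x).differentiableAt, fun x => ?_⟩
  rw [L, (hd x).deriv]
  ext i
  fin_cases i
  · simp [J, Q]
    linear_combination (-E * u x) * I_sq
  · simp [J, Q]
    linear_combination (-E * v x) * I_sq

variable (φ : Fundamental p q)

/-- Evaluation at `0` identifies the solution space with `ℂ²`. -/
noncomputable def Fundamental.evalEquiv (E : ℂ) : solutionSpace p q E ≃ₗ[ℂ] (Fin 2 → ℂ) where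
  toFun y := y.1 0
  map_add' _ _ := rfl
  map_smul' _ _ := rfl
  invFun c := ⟨_, ((φ.sol₁ E).combine (φ.sol₂ E) (c 0) (c 1)).mem⟩
  left_inv y := by
    ext x i
    have := φ.sol_eq (isSol_of_mem y.2) x
    fin_cases i
    · exact this.1.symm
    · exact this.2.symm
  right_inv c := by
    ext i
    fin_cases i <;> simp [φ.u₁_zero, φ.v₁_zero, φ.u₂_zero, φ.v₂_zero]

theorem Fundamental.discr_eq {Ω : ℝ} (hp : Function.Periodic p Ω) (hq : Function.Periodic q Ω)
    (E : ℂ) : discr hp hq E = φ.s Ω E := by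
  rw [discr, Fundamental.s]
  congr 2
  rw [LinearMap.trace_eq_matrix_trace ℂ (Module.Basis.ofEquivFun (φ.evalEquiv E)),
    Matrix.trace_fin_two]
  have key : ∀ y : solutionSpace p q E, φ.evalEquiv E (monodromy hp hq E y) =
      ![φ.M₁₁ Ω E 0 * y.1 0 0 + φ.M₁₂ Ω E 0 * y.1 0 1,
        φ.M₂₁ Ω E 0 * y.1 0 0 + φ.M₂₂ Ω E 0 * y.1 0 1] := by
    intro y
    have := φ.sol_shift (Ω := Ω) (isSol_of_mem y.2) 0
    ext i
    fin_cases i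
    · exact this.1
    · exact this.2
  have h2 : ∀ c : Fin 2 → ℂ, ((φ.evalEquiv E).symm c).1 0 = c :=
    (φ.evalEquiv E).apply_symm_apply
  simp [LinearMap.toMatrix_apply, Module.Basis.ofEquivFun, key, h2, Fundamental.tr]

/-- If the discriminant vanishes and there are two independent Floquet solutions then the
monodromy matrix is scalar. -/
theorem Fundamental.eq_zero_of_twoFloquet {Ω : ℝ} (hp : Function.Periodic p Ω)
    (hq : Function.Periodic q Ω) {E : ℂ} (hs : φ.s Ω E = 0) (hE : HasTwoFloquetSolutions p q Ω E)
    (x : ℝ) : φ.a Ω E x = 0 ∧ φ.M₁₂ Ω E x = 0 ∧ φ.M₂₁ Ω E x = 0 := by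
  obtain ⟨y, z, hy, hz, hyz⟩ := hE
  have hs' : φ.tr Ω E ^ 2 - 4 = 0 := hs
  have hdet := φ.det_M (Ω := Ω) E 0
  have hflo : ∀ y, IsFloquetSolution p q Ω E y →
      φ.a Ω E 0 * y 0 0 + φ.M₁₂ Ω E 0 * y 0 1 = 0 ∧
      φ.M₂₁ Ω E 0 * y 0 0 - φ.a Ω E 0 * y 0 1 = 0 := by
    rintro y ⟨hy, hy0, ρ, hρ⟩
    have h1 := φ.sol_shift (Ω := Ω) (isSol_of_mem hy) 0
    rw [hρ, φ.M₁₁_eq hp hq, φ.M₂₂_eq hp hq] at h1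
    simp only [Pi.smul_apply, smul_eq_mul] at h1
    rw [φ.M₁₁_eq hp hq, φ.M₂₂_eq hp hq] at hdet
    have hy1 : y 0 0 ≠ 0 ∨ y 0 1 ≠ 0 := by
      by_contra! hcon
      apply hy0
      ext x i
      have := φ.sol_eq_zero (isSol_of_mem hy) hcon.1 hcon.2 x
      fin_cases i
      · exact this.1
      · exact this.2
    -- The multiplier is a root of the characteristic polynomial, which is a perfect square because
    -- the discriminant vanishes.
    have hρ2 : (ρ - φ.tr Ω E / 2) ^ 2 = 0 := by
      rcases hy1 with h | h
      · refine (mul_eq_zero.1 ?_).resolve_right h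
        linear_combination (ρ - φ.tr Ω E / 2 + φ.a Ω E 0) * h1.1 + φ.M₁₂ Ω E 0 * h1.2
          - y 0 0 * hdet + (y 0 0 / 4) * hs'
      · refine (mul_eq_zero.1 ?_).resolve_right h
        linear_combination (ρ - φ.tr Ω E / 2 - φ.a Ω E 0) * h1.2 + φ.M₂₁ Ω E 0 * h1.1
          - y 0 1 * hdet + (y 0 1 / 4) * hs'
    have hρ3 : ρ = φ.tr Ω E / 2 := sub_eq_zero.1 (pow_eq_zero_iff (two_ne_zero)|>.1 hρ2)
    rw [hρ3] at h1
    constructor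
    · linear_combination -h1.1
    · linear_combination -h1.2
  -- Solutions are determined by their values at 0, so these values are independent. The trace-free
  -- part annihilates both of them and therefore vanishes at 0, hence by conjugation at every base
  -- point.
  have hW : y 0 0 * z 0 1 - z 0 0 * y 0 1 ≠ 0 := by
    intro h0
    rw [LinearIndependent.pair_iff] at hyz
    have hlin : ∀ c d : ℂ, c * y 0 0 + d * z 0 0 = 0 → c * y 0 1 + d * z 0 1 = 0 →
        c = 0 ∧ d = 0 := by
      intro c d h1 h2
      apply hyz
      have hm : c • y + d • z ∈ solutionSpace p q E :=
        add_mem (Submodule.smul_mem _ _ hy.1) (Submodule.smul_mem _ _ hz.1)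
      ext x i
      have := φ.sol_eq_zero (isSol_of_mem hm) (x₀ := 0) (by simpa using h1) (by simpa using h2) x
      fin_cases i
      · exact this.1
      · exact this.2
    have h1 := hlin (z 0 0) (-y 0 0) (by ring) (by linear_combination -h0)
    have h2 := hlin (z 0 1) (-y 0 1) (by linear_combination h0) (by ring)
    have h3 := hlin 1 0 (by simp [neg_eq_zero.1 h1.2, h1.1]) (by simp [neg_eq_zero.1 h2.2])
    exact one_ne_zero h3.1
  have hy' := hflo y hy
  have hz' := hflo z hz
  have ha : φ.a Ω E 0 = 0 := by
    refine (mul_eq_zero.1 ?_).resolve_right hW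
    linear_combination (z 0 1) * hy'.1 - (y 0 1) * hz'.1
  have hb : φ.M₁₂ Ω E 0 = 0 := by
    refine (mul_eq_zero.1 ?_).resolve_right hW
    linear_combination (y 0 0) * hz'.1 - (z 0 0) * hy'.1
  have hc : φ.M₂₁ Ω E 0 = 0 := by
    refine (mul_eq_zero.1 ?_).resolve_right hW
    linear_combination (z 0 1) * hy'.2 - (y 0 1) * hz'.2
  have := φ.conj_M₁₂ hp hq E x
  rw [ha, hb, hc] at this
  simpa [and_assoc, and_comm, and_left_comm] using this

end SolutionSpace

end AKNS

/-! ### Sine estimates and the critical points of the trace. -/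

namespace AKNS

open Complex

section SineBounds

theorem negOnePow_cases (k : ℤ) : ((k.negOnePow : ℤ) : ℂ) = 1 ∨ ((k.negOnePow : ℤ) : ℂ) = -1 := by
  rcases Int.even_or_odd k with h | h
  · left; simp [Int.negOnePow_even k h]
  · right; simp [Int.negOnePow_odd k h]

theorem norm_sin_sub_int_mul_pi (z : ℂ) (k : ℤ) : ‖sin (z - k * Real.pi)‖ = ‖sin z‖ := by
  rw [sin_antiperiodic.sub_int_mul_eq]
  rcases negOnePow_cases k with h | h <;> simp [h]

/-- Away from its zeros, the sine function is as large as `exp |Im z|`. -/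
theorem exists_le_norm_sin {δ : ℝ} (hδ : 0 < δ) :
    ∃ c > 0, ∀ z : ℂ, (∀ k : ℤ, δ ≤ ‖z - k * Real.pi‖) → c * Real.exp |z.im| ≤ ‖sin z‖ := by
  -- Shifting by multiples of π changes the sine only by a sign, so for |Im z| ≤ 1 a minimum over
  -- one compact cell without a disc at 0 suffices. For |Im z| > 1 one of the two exponentials
  -- dominates.
  let K : Set ℂ := (Set.Icc (-(Real.pi / 2)) (Real.pi / 2) ×ℂ Set.Icc (-1) 1) ∩ {w | δ ≤ ‖w‖}
  have hK : IsCompact K := (isCompact_Icc.reProdIm isCompact_Icc).inter_right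
    (isClosed_le continuous_const continuous_norm)
  have hpos : ∀ w ∈ K, 0 < ‖sin w‖ := by
    rintro w ⟨⟨hw1, -⟩, hw2⟩
    rw [norm_pos_iff]
    intro h0
    obtain ⟨k, hk⟩ := sin_eq_zero_iff.1 h0
    have hre : w.re = k * Real.pi := by rw [hk]; simp
    simp only [Set.mem_preimage, Set.mem_Icc, hre] at hw1
    have hk1 : (k : ℝ) < 1 := by nlinarith [Real.pi_pos]
    have hk2 : (-1 : ℝ) < k := by nlinarith [Real.pi_pos]
    have hk0 : k = 0 := by
      have h1 : k < 1 := by exact_mod_cast hk1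
      have h2 : -1 < k := by exact_mod_cast hk2
      omega
    rw [hk, hk0] at hw2
    simp at hw2
    linarith
  obtain ⟨m, hm, hmK⟩ := hK.exists_forall_le' continuous_sin.norm.continuousOn hpos
  refine ⟨min (m / 3) (1 / 3), by positivity, fun z hz => ?_⟩
  by_cases hy : |z.im| ≤ 1
  · set k := round (z.re / Real.pi)
    have h1 := abs_sub_round (z.re / Real.pi)
    have hw : z - k * Real.pi ∈ K := by
      refine ⟨⟨?_, ?_⟩, hz k⟩
      · simp only [Set.mem_preimage, Set.mem_Icc, ← abs_le]
        have h2 : (z - k * Real.pi).re = (z.re / Real.pi - k) * Real.pi := by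
          have := Real.pi_ne_zero
          simp
          field_simp
        rw [h2, abs_mul, abs_of_pos Real.pi_pos]
        nlinarith [Real.pi_pos]
      · simp only [Set.mem_preimage, Set.mem_Icc, ← abs_le]
        simpa using hy
    rw [← norm_sin_sub_int_mul_pi z k]
    have he : Real.exp |z.im| ≤ 3 :=
      (Real.exp_le_exp.2 hy).trans (by linarith [Real.exp_one_lt_d9])
    calc _ ≤ m / 3 * 3 := mul_le_mul (min_le_left _ _) he (Real.exp_pos _).le (by positivity)
      _ = m := by ring
      _ ≤ _ := hmK _ hw
  · push Not at hy
    have h1 : ‖2 * sin z‖ = ‖cexp (-z * I) - cexp (z * I)‖ := by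
      rw [two_sin, norm_mul, norm_I, mul_one]
    have h2 : ‖cexp (-z * I)‖ = Real.exp z.im := by rw [norm_exp]; simp
    have h3 : ‖cexp (z * I)‖ = Real.exp (-z.im) := by rw [norm_exp]; simp
    have h4 : Real.exp |z.im| - Real.exp (-|z.im|) ≤ ‖2 * sin z‖ := by
      rw [h1]
      rcases abs_cases z.im with ⟨h, _⟩ | ⟨h, _⟩
      · rw [h, ← h2, ← h3]; exact norm_sub_norm_le _ _
      · rw [h, neg_neg, ← h2, ← h3, norm_sub_rev]; exact norm_sub_norm_le _ _
    have h5 : Real.exp (-|z.im|) ≤ 1 / 3 * Real.exp |z.im| := by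
      have e1 : Real.exp 1 ≤ Real.exp |z.im| := Real.exp_le_exp.2 hy.le
      have e2 := Real.exp_one_gt_d9
      have e3 : Real.exp (-|z.im|) * Real.exp |z.im| = 1 := by rw [← Real.exp_add]; simp
      nlinarith [Real.exp_pos (-|z.im|)]
    rw [norm_mul, norm_ofNat] at h4
    calc _ ≤ 1 / 3 * Real.exp |z.im| := by gcongr; exact min_le_right _ _
      _ ≤ _ := by linarith

theorem norm_cos_le (z : ℂ) : ‖cos z‖ ≤ Real.exp |z.im| := by
  have h1 : ‖2 * cos z‖ = ‖cexp (z * I) + cexp (-z * I)‖ := by rw [two_cos]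
  have h2 : ‖cexp (-z * I)‖ ≤ Real.exp |z.im| := by rw [norm_exp]; simp [le_abs_self]
  have h3 : ‖cexp (z * I)‖ ≤ Real.exp |z.im| := by rw [norm_exp]; simp [neg_le_abs]
  rw [norm_mul, norm_ofNat] at h1
  linarith [norm_add_le (cexp (z * I)) (cexp (-z * I))]

theorem norm_cos_sub_le {z : ℂ} {k : ℤ} (h : ‖z - k * Real.pi‖ ≤ 1 / 2) :
    ‖cos z - (k.negOnePow : ℤ)‖ ≤ 1 / 4 := by
  set w := z - k * Real.pi with hw
  have hc : cos w = (k.negOnePow : ℤ) * cos z := cos_antiperiodic.sub_int_mul_eq k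
  have h1 : ‖cos w - 1‖ ≤ 1 / 4 := by
    have h2 := cos_bound (x := w) (by linarith)
    have h3 : cos w - 1 = (cos w - (1 - w ^ 2 / 2)) - w ^ 2 / 2 := by ring
    have h4 : ‖w‖ ^ 2 ≤ 1 / 4 := by nlinarith [norm_nonneg w]
    have h5 : ‖w‖ ^ 4 ≤ 1 / 16 := by
      rw [show ‖w‖ ^ 4 = (‖w‖ ^ 2) ^ 2 by ring]; nlinarith [sq_nonneg ‖w‖]
    rw [h3]
    refine (norm_sub_le _ _).trans ?_
    rw [norm_div, norm_pow, norm_ofNat]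
    linarith
  rcases negOnePow_cases k with h | h <;> rw [h] at hc ⊢
  · rwa [hc, one_mul] at h1
  · rw [hc] at h1
    rw [← norm_neg]
    rwa [show -(cos z - -1) = -1 * cos z - 1 by ring]

/-- Distinct discs around the integer multiples of `π` do not meet. -/
theorem le_norm_sub_int_mul_pi {z : ℂ} {k : ℤ} (h : ‖z - k * Real.pi‖ = 1 / 2) (m : ℤ) :
    1 / 2 ≤ ‖z - m * Real.pi‖ := by
  by_cases hkm : m = k
  · rw [hkm, h]
  · have h1 : (1 : ℝ) ≤ |(m - k : ℝ)| := by
      have : 1 ≤ |m - k| := Int.one_le_abs (sub_ne_zero.2 hkm)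
      exact_mod_cast this
    have h2 : ‖((m : ℂ) - k) * Real.pi‖ = |(m - k : ℝ)| * Real.pi := by
      rw [norm_mul, norm_real, Real.norm_of_nonneg Real.pi_pos.le, ← Real.norm_eq_abs,
        ← norm_real]
      push_cast
      rfl
    have h3 : ((m : ℂ) - k) * Real.pi = (z - k * Real.pi) - (z - m * Real.pi) := by ring
    have h4 := norm_sub_le (z - k * Real.pi) (z - m * Real.pi)
    rw [← h3, h2, h] at h4
    nlinarith [Real.pi_gt_three]

/-- The radius lies halfway between consecutive values of |mπ|, so the distance is at least π/2. -/
theorem le_norm_sub_of_norm_eq {z : ℂ} {n : ℕ} (h : ‖z‖ = (n + 1 / 2) * Real.pi) (m : ℤ) :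
    1 / 2 ≤ ‖z - m * Real.pi‖ := by
  have h1 : ‖(m : ℂ) * Real.pi‖ = (m.natAbs : ℝ) * Real.pi := by
    rw [norm_mul, norm_real, Real.norm_of_nonneg Real.pi_pos.le, Nat.cast_natAbs, norm_intCast]
    simp
  have h2 := abs_norm_sub_norm_le z (m * Real.pi)
  rw [h, h1, ← sub_mul, abs_mul, abs_of_pos Real.pi_pos] at h2
  have h3 : 1 / 2 ≤ |(n : ℝ) + 1 / 2 - m.natAbs| := by
    rcases le_or_gt m.natAbs n with h | h
    · have : (m.natAbs : ℝ) ≤ n := by exact_mod_cast h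
      rw [abs_of_nonneg] <;> linarith
    · have : (n : ℝ) + 1 ≤ m.natAbs := by exact_mod_cast h
      rw [abs_of_nonpos] <;> linarith
  nlinarith [Real.pi_gt_three]

end SineBounds

/-- Cauchy estimate for exponentially bounded entire functions. -/
theorem norm_deriv_le_of_expBound {g : ℂ → ℂ} (hg : Differentiable ℂ g) {Ω C r : ℝ} (hΩ : 0 < Ω)
    (hC : 0 ≤ C) (hr : 1 ≤ r)
    (h : ∀ E : ℂ, r ≤ ‖E‖ → ‖g E‖ ≤ C / ‖E‖ * Real.exp (|E.im| * Ω)) (E : ℂ) (hE : r + 1 ≤ ‖E‖) :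
    ‖deriv g E‖ ≤ (2 * C * Real.exp Ω) / ‖E‖ * Real.exp (|E.im| * Ω) := by
  have key := norm_deriv_le_of_forall_mem_sphere_norm_le (c := E) (R := 1)
    (C := (2 * C * Real.exp Ω) / ‖E‖ * Real.exp (|E.im| * Ω)) one_pos hg.diffContOnCl
    (fun z hz => ?_)
  · simpa using key
  · rw [mem_sphere_iff_norm] at hz
    have h1 : ‖E‖ - 1 ≤ ‖z‖ := by
      have := norm_sub_norm_le E z
      rw [norm_sub_rev, hz] at this
      linarith
    have h2 : |z.im| ≤ |E.im| + 1 := by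
      have := (abs_im_le_norm (z - E)).trans hz.le
      rw [sub_im] at this
      have h3 := abs_sub_abs_le_abs_sub z.im E.im
      linarith
    have hz0 : ‖E‖ / 2 ≤ ‖z‖ := by linarith
    have hE0 : 0 < ‖E‖ := by linarith
    refine (h z (by linarith)).trans ?_
    calc _ ≤ C / (‖E‖ / 2) * Real.exp ((|E.im| + 1) * Ω) := by gcongr
      _ = _ := by rw [add_mul, one_mul, Real.exp_add]; field_simp

/-- Outside a compact set, the critical points of the trace of the monodromy matrix are
asymptotically equally spaced, simple and zeros of the discriminant. -/
theorem exists_far_region {Δ : ℂ → ℂ} (hΔ : Differentiable ℂ Δ) {Ω C : ℝ} (hΩ : 0 < Ω)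
    (hC : 0 ≤ C)
    (hasym : ∀ E : ℂ, 1 ≤ ‖E‖ →
      ‖Δ E - 2 * cos (Ω * E)‖ ≤ C / ‖E‖ * Real.exp (|E.im| * Ω)) {S : Set ℂ} (hS : S.Finite)
    (hdeg : ∀ E, Δ E ^ 2 - 4 = 0 → E ∉ S → deriv Δ E = 0) :
    ∃ R > 0, ∃ c > 0,
      (∀ E, R ≤ ‖E‖ → deriv Δ E = 0 → Δ E ^ 2 - 4 = 0 ∧ deriv (deriv Δ) E ≠ 0 ∧
        ∃ k : ℤ, ‖Ω * E - k * Real.pi‖ ≤ 1 / 2) ∧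
      (∀ E E' : ℂ, R ≤ ‖E‖ → R ≤ ‖E'‖ → deriv Δ E = 0 → deriv Δ E' = 0 → ∀ k : ℤ,
        ‖Ω * E - k * Real.pi‖ ≤ 1 / 2 → ‖Ω * E' - k * Real.pi‖ ≤ 1 / 2 → E = E') ∧
      (∀ E : ℂ, R ≤ ‖E‖ → (∀ k : ℤ, 1 / 2 ≤ ‖Ω * E - k * Real.pi‖) →
        c * Real.exp (|E.im| * Ω) ≤ ‖deriv Δ E‖ ∧ c ≤ ‖Δ E ^ 2 - 4‖) := by
  have him : ∀ E : ℂ, |((Ω : ℂ) * E).im| = |E.im| * Ω := fun E => by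
    rw [im_ofReal_mul, abs_mul, abs_of_pos hΩ, mul_comm]
  obtain ⟨c, hc, hsin⟩ := exists_le_norm_sin (show (0 : ℝ) < 1 / 2 by norm_num)
  let g : ℂ → ℂ := fun E => Δ E - 2 * cos (Ω * E)
  have hg : Differentiable ℂ g := hΔ.sub (((differentiable_id.const_mul (Ω : ℂ)).ccos).const_mul 2)
  have hΔ' : Differentiable ℂ (deriv Δ) := hΔ.deriv
  have hcos : ∀ E : ℂ, HasDerivAt (fun E : ℂ => cos (Ω * E)) (-sin (Ω * E) * Ω) E := fun E => by
    simpa using ((hasDerivAt_id E).const_mul (Ω : ℂ)).ccos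
  have hsind : ∀ E : ℂ, HasDerivAt (fun E : ℂ => sin (Ω * E)) (cos (Ω * E) * Ω) E := fun E => by
    simpa using ((hasDerivAt_id E).const_mul (Ω : ℂ)).csin
  have hg1 : deriv g = fun E => deriv Δ E + 2 * Ω * sin (Ω * E) := by
    ext E
    refine (((hΔ E).hasDerivAt.sub ((hcos E).const_mul 2)).congr_deriv ?_).deriv
    ring
  have hg2 : deriv (deriv g) = fun E => deriv (deriv Δ) E + 2 * Ω ^ 2 * cos (Ω * E) := by
    rw [hg1]
    ext E
    refine (((hΔ' E).hasDerivAt.add ((hsind E).const_mul (2 * (Ω : ℂ)))).congr_deriv ?_).deriv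
    ring
  set C₁ := 2 * C * Real.exp Ω
  set C₂ := 2 * C₁ * Real.exp Ω
  have hC₁ : 0 ≤ C₁ := by positivity
  have hC₂ : 0 ≤ C₂ := by positivity
  have hd1 := norm_deriv_le_of_expBound hg hΩ hC le_rfl hasym
  have hd2 := norm_deriv_le_of_expBound hg.deriv hΩ hC₁ (by norm_num) hd1
  have hd1' : ∀ E : ℂ, 1 + 1 ≤ ‖E‖ → ‖deriv Δ E + 2 * Ω * sin (Ω * E)‖ ≤
      C₁ / ‖E‖ * Real.exp (|E.im| * Ω) := fun E hE => by
    have := hd1 E hE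
    rwa [hg1] at this
  have hd2' : ∀ E : ℂ, 1 + 1 + 1 ≤ ‖E‖ → ‖deriv (deriv Δ) E + 2 * Ω ^ 2 * cos (Ω * E)‖ ≤
      C₂ / ‖E‖ * Real.exp (|E.im| * Ω) := fun E hE => by
    have := hd2 E hE
    rwa [hg2] at this
  -- The left side is (Δ - 2cos)(Δ + 2cos) at ΩE; the first factor supplies the decay 1/‖E‖.
  have hs : ∀ E : ℂ, 1 ≤ ‖E‖ → ‖(Δ E ^ 2 - 4) + 4 * sin (Ω * E) ^ 2‖ ≤
      C * (C + 4) / ‖E‖ * Real.exp (|E.im| * Ω) ^ 2 := by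
    intro E hE
    have e1 : (Δ E ^ 2 - 4) + 4 * sin (Ω * E) ^ 2 =
        (Δ E - 2 * cos (Ω * E)) * ((Δ E - 2 * cos (Ω * E)) + 4 * cos (Ω * E)) := by
      linear_combination 4 * sin_sq_add_cos_sq (Ω * E)
    have e2 := hasym E hE
    have e3 : ‖4 * cos (Ω * E)‖ ≤ 4 * Real.exp (|E.im| * Ω) := by
      rw [norm_mul, norm_ofNat, ← him]
      gcongr
      exact norm_cos_le _
    have e4 : C / ‖E‖ ≤ C := div_le_self hC hE
    rw [e1, norm_mul]
    calc _ ≤ (C / ‖E‖ * Real.exp (|E.im| * Ω)) * (C * Real.exp (|E.im| * Ω) +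
          4 * Real.exp (|E.im| * Ω)) := by
          refine mul_le_mul e2 ((norm_add_le _ _).trans (add_le_add (e2.trans ?_) e3))
            (norm_nonneg _) (by positivity)
          gcongr
      _ = _ := by ring
  obtain ⟨B, hB⟩ := hS.isBounded.exists_norm_le
  -- The threshold beyond which all error terms are negligible.
  set R₁ := |B| + 3 + 2 * C₁ / (Ω * c) + 6 * C₂ / Ω ^ 2 + 9 * (C * (C + 4)) / c ^ 2 with hR₁
  have t1 : 0 ≤ 2 * C₁ / (Ω * c) := by positivity
  have t2 : 0 ≤ 6 * C₂ / Ω ^ 2 := by positivity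
  have t3 : 0 ≤ 9 * (C * (C + 4)) / c ^ 2 := by positivity
  have t4 := abs_nonneg B
  have hlarge : ∀ E : ℂ, R₁ ≤ ‖E‖ → E ∉ S ∧ 3 ≤ ‖E‖ ∧ C₁ / ‖E‖ ≤ Ω * c ∧
      3 * (C₂ / ‖E‖) ≤ Ω ^ 2 / 2 ∧ 9 * (C * (C + 4) / ‖E‖) ≤ c ^ 2 := by
    intro E hE
    have hE0 : 0 < ‖E‖ := by linarith
    refine ⟨fun h => ?_, by linarith, ?_, ?_, ?_⟩
    · have := (hB E h).trans (le_abs_self B)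
      linarith
    · rw [div_le_iff₀ hE0]
      have h2 : 2 * C₁ / (Ω * c) ≤ ‖E‖ := by linarith
      rw [div_le_iff₀ (by positivity)] at h2
      nlinarith
    · have h2 : 6 * C₂ / Ω ^ 2 ≤ ‖E‖ := by linarith
      rw [div_le_iff₀ (by positivity)] at h2
      rw [← mul_div_assoc, div_le_iff₀ hE0]
      nlinarith
    · have h2 : 9 * (C * (C + 4)) / c ^ 2 ≤ ‖E‖ := by linarith
      rw [div_le_iff₀ (by positivity)] at h2
      rw [← mul_div_assoc, div_le_iff₀ hE0]
      nlinarith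
  -- Behaviour outside the discs.
  have hout : ∀ E : ℂ, R₁ ≤ ‖E‖ → (∀ k : ℤ, 1 / 2 ≤ ‖Ω * E - k * Real.pi‖) →
      Ω * c * Real.exp (|E.im| * Ω) ≤ ‖deriv Δ E‖ ∧ 3 * c ^ 2 ≤ ‖Δ E ^ 2 - 4‖ := by
    intro E hE hk
    obtain ⟨-, h3, h4, -, h5⟩ := hlarge E hE
    have h1 := hsin _ hk
    rw [him] at h1
    constructor
    · have h2 := hd1' E (by linarith)
      have h6 : ‖2 * Ω * sin (Ω * E)‖ = 2 * Ω * ‖sin (Ω * E)‖ := by simp [abs_of_pos hΩ]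
      have h7 := norm_sub_norm_le (2 * Ω * sin (Ω * E)) (-deriv Δ E)
      rw [sub_neg_eq_add, add_comm _ (deriv Δ E), norm_neg, h6] at h7
      have h8 := h2.trans (mul_le_mul_of_nonneg_right h4 (Real.exp_pos _).le)
      nlinarith [mul_le_mul_of_nonneg_left h1 hΩ.le]
    · have h2 := hs E (by linarith)
      have h6 : ‖4 * sin (Ω * E) ^ 2‖ = 4 * ‖sin (Ω * E)‖ ^ 2 := by simp
      have h7 := norm_sub_norm_le (4 * sin (Ω * E) ^ 2) (-(Δ E ^ 2 - 4))
      rw [sub_neg_eq_add, add_comm _ (Δ E ^ 2 - 4), norm_neg, h6] at h7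
      have h8 : (c * Real.exp (|E.im| * Ω)) ^ 2 ≤ ‖sin (Ω * E)‖ ^ 2 := by gcongr
      have h9 : 1 ≤ Real.exp (|E.im| * Ω) ^ 2 := one_le_pow₀ (Real.one_le_exp (by positivity))
      have h10 : C * (C + 4) / ‖E‖ * Real.exp (|E.im| * Ω) ^ 2 ≤
          c ^ 2 / 9 * Real.exp (|E.im| * Ω) ^ 2 :=
        mul_le_mul_of_nonneg_right (by linarith) (by positivity)
      nlinarith [mul_le_mul_of_nonneg_left h9 (sq_nonneg c)]
  -- Behaviour inside the discs.
  have hexp : ∀ (E : ℂ) (k : ℤ), ‖Ω * E - k * Real.pi‖ ≤ 1 / 2 → Real.exp (|E.im| * Ω) ≤ 3 := by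
    intro E k hk
    have h1 := (abs_im_le_norm _).trans hk
    rw [sub_im] at h1
    have h2 : ((k : ℂ) * Real.pi).im = 0 := by simp
    rw [h2, sub_zero, him] at h1
    refine (Real.exp_le_exp.2 (h1.trans (by norm_num : (1 : ℝ) / 2 ≤ 1))).trans ?_
    linarith [Real.exp_one_lt_d9]
  have hΩn : ‖(Ω : ℂ)‖ = Ω := by rw [norm_real, Real.norm_of_nonneg hΩ.le]
  -- Half of the allowance Ω² is used for replacing the cosine by ±1 on the disc, half for the
  -- asymptotic error.
  have hdd : ∀ (E : ℂ) (k : ℤ), R₁ ≤ ‖E‖ → ‖Ω * E - k * Real.pi‖ ≤ 1 / 2 →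
      ‖deriv (deriv Δ) E + 2 * Ω ^ 2 * (k.negOnePow : ℤ)‖ ≤ Ω ^ 2 := by
    intro E k hE hk
    obtain ⟨-, h3, -, h4, -⟩ := hlarge E hE
    have h2 := hd2' E (by linarith)
    have h5 := norm_cos_sub_le hk
    have h6 : deriv (deriv Δ) E + 2 * Ω ^ 2 * (k.negOnePow : ℤ) =
        (deriv (deriv Δ) E + 2 * Ω ^ 2 * cos (Ω * E)) -
          2 * Ω ^ 2 * (cos (Ω * E) - (k.negOnePow : ℤ)) := by ring
    have h7 : ‖2 * (Ω : ℂ) ^ 2 * (cos (Ω * E) - (k.negOnePow : ℤ))‖ ≤ Ω ^ 2 / 2 := by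
      rw [norm_mul, norm_mul, norm_pow, norm_ofNat, hΩn]
      nlinarith [sq_nonneg Ω]
    have h8 : C₂ / ‖E‖ * Real.exp (|E.im| * Ω) ≤ Ω ^ 2 / 2 := by
      have h9 : 0 ≤ C₂ / ‖E‖ := by positivity
      nlinarith [mul_le_mul_of_nonneg_left (hexp E k hk) h9]
    rw [h6]
    refine (norm_sub_le _ _).trans ?_
    linarith
  have hnop : ∀ k : ℤ, ‖((k.negOnePow : ℤ) : ℂ)‖ = 1 := fun k => by
    rcases negOnePow_cases k with h | h <;> simp [h]
  have hdd0 : ∀ (E : ℂ) (k : ℤ), R₁ ≤ ‖E‖ → ‖Ω * E - k * Real.pi‖ ≤ 1 / 2 →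
      deriv (deriv Δ) E ≠ 0 := by
    intro E k hE hk h0
    have h1 := hdd E k hE hk
    rw [h0, zero_add, norm_mul, norm_mul, norm_pow, norm_ofNat, hΩn, hnop] at h1
    nlinarith [sq_pos_of_pos hΩ]
  let U : ℤ → Set ℂ := fun k => {E | ‖Ω * E - k * Real.pi‖ ≤ 1 / 2}
  have hΩ0 : (Ω : ℂ) ≠ 0 := ofReal_ne_zero.2 hΩ.ne'
  have hU : ∀ k, U k = Metric.closedBall (k * Real.pi / Ω : ℂ) (1 / 2 / Ω) := by
    intro k
    ext E
    rw [mem_closedBall_iff_norm, Set.mem_ofPred_eq, le_div_iff₀ hΩ]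
    have : (Ω : ℂ) * E - k * Real.pi = (E - k * Real.pi / Ω) * Ω := by field_simp
    rw [this, norm_mul, hΩn]
  -- Adding ±2Ω²z to Δ' gives a function that is Ω²-Lipschitz on the disc. Two zeros of Δ' would
  -- have images at 2Ω² times their distance.
  have hinj : ∀ (k : ℤ), (∀ E ∈ U k, R₁ ≤ ‖E‖) → ∀ E ∈ U k, ∀ E' ∈ U k,
      deriv Δ E = 0 → deriv Δ E' = 0 → E = E' := by
    intro k hk E hE E' hE' h0 h0'
    have hconv : Convex ℝ (U k) := by rw [hU]; exact convex_closedBall _ _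
    have hd : ∀ z ∈ U k, HasDerivWithinAt
        (fun z => deriv Δ z + 2 * Ω ^ 2 * (k.negOnePow : ℤ) * z)
        (deriv (deriv Δ) z + 2 * Ω ^ 2 * (k.negOnePow : ℤ)) (U k) z := fun z _ => by
      have h1 := (hasDerivAt_id z).const_mul (2 * (Ω : ℂ) ^ 2 * (k.negOnePow : ℤ))
      rw [mul_one] at h1
      exact ((hΔ' z).hasDerivAt.add h1).hasDerivWithinAt
    have key := hconv.norm_image_sub_le_of_norm_hasDerivWithin_le (C := Ω ^ 2) hd
      (fun z hz => hdd z k (hk z hz) hz) hE hE'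
    rw [h0, h0', zero_add, zero_add, ← mul_sub, norm_mul, norm_mul, norm_mul, norm_pow, norm_ofNat,
      hΩn, hnop] at key
    have h2 : ‖E' - E‖ = 0 := by
      nlinarith [norm_nonneg (E' - E), sq_pos_of_pos hΩ,
        mul_nonneg (sq_pos_of_pos hΩ).le (norm_nonneg (E' - E))]
    exact (sub_eq_zero.1 (norm_eq_zero.1 h2)).symm
  -- Minimum modulus principle: without a zero in the disc, the bound 3c² on the boundary would hold
  -- at the centre, where sin(ΩE) = 0 makes |Δ² - 4| at most c².
  have hzero : ∀ k : ℤ, (∀ E ∈ U k, R₁ ≤ ‖E‖) → ∃ E ∈ U k, Δ E ^ 2 - 4 = 0 := by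
    intro k hk
    by_contra! hne
    have hρ : (1 / 2 / Ω) ≠ 0 := by positivity
    set z₀ : ℂ := k * Real.pi / Ω with hz₀
    have hs' : Differentiable ℂ fun E => Δ E ^ 2 - 4 := (hΔ.pow 2).sub_const 4
    have hdc : DiffContOnCl ℂ (fun E => (Δ E ^ 2 - 4)⁻¹) (Metric.ball z₀ (1 / 2 / Ω)) := by
      refine hs'.diffContOnCl.inv fun z hz => hne z ?_
      rw [hU]
      rwa [closure_ball _ hρ] at hz
    have hcen : z₀ ∈ U k := by rw [hU]; exact Metric.mem_closedBall_self (by positivity)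
    have hfr : ∀ z ∈ frontier (Metric.ball z₀ (1 / 2 / Ω)), ‖(Δ z ^ 2 - 4)⁻¹‖ ≤ (3 * c ^ 2)⁻¹ := by
      intro z hz
      rw [frontier_ball _ hρ, mem_sphere_iff_norm] at hz
      have hzU : z ∈ U k := by rw [hU, mem_closedBall_iff_norm]; exact hz.le
      have h1 : ‖Ω * z - k * Real.pi‖ = 1 / 2 := by
        have : (Ω : ℂ) * z - k * Real.pi = (z - z₀) * Ω := by rw [hz₀]; field_simp
        rw [this, norm_mul, hΩn, hz]
        field_simp
      rw [norm_inv]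
      gcongr
      exact (hout z (hk z hzU) (le_norm_sub_int_mul_pi h1)).2
    have h2 := norm_le_of_forall_mem_frontier_norm_le Metric.isBounded_ball hdc hfr
      (subset_closure (Metric.mem_ball_self (by positivity)))
    have h3 : ‖Δ z₀ ^ 2 - 4‖ ≤ c ^ 2 := by
      obtain ⟨-, h3, -, -, h5⟩ := hlarge z₀ (hk _ hcen)
      have h4 := hs z₀ (by linarith)
      have h6 : sin (Ω * z₀) = 0 := by
        rw [sin_eq_zero_iff]
        exact ⟨k, by rw [hz₀]; field_simp⟩
      rw [h6] at h4
      have h7 : Real.exp (|z₀.im| * Ω) ^ 2 ≤ 9 := by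
        nlinarith [hexp z₀ k hcen, Real.exp_pos (|z₀.im| * Ω)]
      have h8 : 0 ≤ C * (C + 4) / ‖z₀‖ := by positivity
      have h9 := mul_le_mul_of_nonneg_left h7 h8
      simp only [ne_eq, OfNat.ofNat_ne_zero, not_false_eq_true, zero_pow, mul_zero, add_zero] at h4
      linarith
    rw [norm_inv, inv_le_inv₀ (norm_pos_iff.2 (hne z₀ hcen)) (by positivity)] at h2
    nlinarith [sq_pos_of_pos hc]
  have hR₁pos : 0 < R₁ := by linarith
  -- The discs have diameter 1/Ω, so enlarging the radius by this amount keeps a whole disc in the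
  -- asymptotic region.
  have hsub : ∀ (E : ℂ) (k : ℤ), R₁ + 1 / Ω ≤ ‖E‖ → E ∈ U k → ∀ E' ∈ U k, R₁ ≤ ‖E'‖ := by
    intro E k hE hEk E' hE'
    rw [hU] at hEk hE'
    have h1 := dist_triangle_right E E' (k * Real.pi / Ω)
    rw [Metric.mem_closedBall] at hEk hE'
    rw [dist_eq_norm] at h1
    have h2 := norm_sub_norm_le E E'
    have h3 : 1 / 2 / Ω + 1 / 2 / Ω = 1 / Ω := by ring
    linarith
  have hΩi : 0 < 1 / Ω := by positivity
  refine ⟨R₁ + 1 / Ω, by positivity, min (Ω * c) (3 * c ^ 2), by positivity, ?_, ?_, ?_⟩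
  · intro E hE h0
    have hE1 : R₁ ≤ ‖E‖ := by linarith
    have hk : ∃ k : ℤ, ‖Ω * E - k * Real.pi‖ ≤ 1 / 2 := by
      by_contra! hcon
      have h1 := (hout E hE1 fun k => (hcon k).le).1
      rw [h0, norm_zero] at h1
      have : 0 < Ω * c * Real.exp (|E.im| * Ω) := by positivity
      linarith
    obtain ⟨k, hk⟩ := hk
    -- The disc contains a zero of Δ² - 4, which is critical by `hdeg`; uniqueness of the critical
    -- point identifies it with E.
    obtain ⟨z, hz, hz0⟩ := hzero k (hsub E k hE hk)
    have hz1 := hsub E k hE hk z hz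
    have hz2 := hdeg z hz0 (hlarge z hz1).1
    have hEz := hinj k (hsub E k hE hk) E hk z hz h0 hz2
    exact ⟨hEz ▸ hz0, hdd0 E k hE1 hk, k, hk⟩
  · intro E E' hE _ h0 h0' k hk hk'
    exact hinj k (hsub E k hE hk) E hk E' hk' h0 h0'
  · intro E hE hk
    have := hout E (by linarith) hk
    constructor
    · refine le_trans ?_ this.1
      gcongr
      exact min_le_left _ _
    · exact (min_le_right _ _).trans this.2

end AKNS

/-! ### Division and polynomial growth of entire functions. -/

namespace AKNS

open Complex Polynomial

section EntireDivision

theorem analyticOrderAt_ne_top_of_entire {g : ℂ → ℂ} (hg : Differentiable ℂ g)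
    (h0 : ∃ z, g z ≠ 0) (z : ℂ) : analyticOrderAt g z ≠ ⊤ := by
  obtain ⟨w, hw⟩ := h0
  intro h
  exact hw (congrFun ((AnalyticOnNhd.analyticOrderAt_eq_top_iff_eq_zero z
    hg.analyticAt).1 h) w)

/-- An entire function is divisible by another one as soon as the orders of vanishing permit. -/
theorem exists_entire_quotient {f g : ℂ → ℂ} (hf : Differentiable ℂ f) (hg : Differentiable ℂ g)
    (h0 : ∃ z, g z ≠ 0) (hord : ∀ z, g z = 0 → analyticOrderAt g z ≤ analyticOrderAt f z) :
    ∃ h : ℂ → ℂ, Differentiable ℂ h ∧ ∀ z, f z = g z * h z := by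
  have hm : MeromorphicOn (f / g) Set.univ := fun z _ =>
    (hf.analyticAt z).meromorphicAt.div (hg.analyticAt z).meromorphicAt
  -- The normal form of the meromorphic quotient fills in the removable singularities; it is
  -- analytic wherever its order is nonnegative.
  have han : ∀ z, AnalyticAt ℂ (toMeromorphicNFOn (f / g) Set.univ) z := by
    intro z
    rw [← (meromorphicNFOn_toMeromorphicNFOn (f / g) Set.univ
      (Set.mem_univ z)).meromorphicOrderAt_nonneg_iff_analyticAt,
      meromorphicOrderAt_toMeromorphicNFOn hm (Set.mem_univ z),
      meromorphicOrderAt_div (hf.analyticAt z).meromorphicAt (hg.analyticAt z).meromorphicAt,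
      (hf.analyticAt z).meromorphicOrderAt_eq, (hg.analyticAt z).meromorphicOrderAt_eq]
    have hle : analyticOrderAt g z ≤ analyticOrderAt f z := by
      by_cases hz : g z = 0
      · exact hord z hz
      · rw [(hg.analyticAt z).analyticOrderAt_eq_zero.2 hz]; exact zero_le
    have htop := analyticOrderAt_ne_top_of_entire hg h0 z
    obtain ⟨n, hn⟩ := ENat.ne_top_iff_exists.1 htop
    rw [← hn] at hle ⊢
    by_cases hft : analyticOrderAt f z = ⊤
    · rw [hft]
      exact le_top
    · obtain ⟨m, hm⟩ := ENat.ne_top_iff_exists.1 hft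
      rw [← hm] at hle ⊢
      have : n ≤ m := by exact_mod_cast hle
      simp only [ENat.map_natCast]
      rw [← WithTop.LinearOrderedAddCommGroup.coe_sub]
      exact_mod_cast sub_nonneg.2 (by exact_mod_cast this : (n : ℤ) ≤ m)
  refine ⟨toMeromorphicNFOn (f / g) Set.univ, fun z => (han z).differentiableAt, fun z => ?_⟩
  have h1 := hm.toMeromorphicNFOn_eq_self_on_nhdsNE (Set.mem_univ z)
  have h2 : ∀ᶠ w in nhdsWithin z {z}ᶜ, g w ≠ 0 := by
    rcases (hg.analyticAt z).eventually_eq_zero_or_eventually_ne_zero with h | h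
    · exact absurd (analyticOrderAt_eq_top.2 h) (analyticOrderAt_ne_top_of_entire hg h0 z)
    · exact h
  have h3 : f =ᶠ[nhdsWithin z {z}ᶜ] fun w => g w * toMeromorphicNFOn (f / g) Set.univ w := by
    filter_upwards [h1, h2] with w hw1 hw2
    rw [hw1, Pi.div_apply]
    field_simp
  exact ((hf z).continuousAt.eventuallyEq_nhds_iff_eventuallyEq_nhdsNE
    ((hg z).continuousAt.mul (han z).continuousAt) |>.1 h3).eq_of_nhds

/-- Extraction of a zero from an entire function. -/
theorem exists_eq_pow_mul_of_entire {f : ℂ → ℂ} (hf : Differentiable ℂ f) (h0 : ∃ z, f z ≠ 0)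
    (w : ℂ) : ∃ (n : ℕ) (g : ℂ → ℂ), analyticOrderAt f w = n ∧ Differentiable ℂ g ∧ g w ≠ 0 ∧
      ∀ z, f z = (z - w) ^ n * g z := by
  obtain ⟨n, hn⟩ := ENat.ne_top_iff_exists.1 (analyticOrderAt_ne_top_of_entire hf h0 w)
  have hd : Differentiable ℂ fun z : ℂ => (z - w) ^ n := by fun_prop
  have hdo : analyticOrderAt (fun z : ℂ => (z - w) ^ n) w = n := analyticOrderAt_centeredMonomial
  obtain ⟨g, hg, hfg⟩ := exists_entire_quotient hf hd ⟨w + 1, by simp⟩ (fun z hz => by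
    have : z = w := by
      rw [pow_eq_zero_iff'] at hz
      exact sub_eq_zero.1 hz.1
    rw [this, hdo, hn])
  refine ⟨n, g, hn.symm, hg, fun hgw => ?_, hfg⟩
  have h1 : analyticOrderAt f w = n + analyticOrderAt g w := by
    rw [show f = (fun z : ℂ => (z - w) ^ n) * g from funext hfg,
      analyticOrderAt_mul (hd.analyticAt w) (hg.analyticAt w), hdo]
  have h2 : 1 ≤ analyticOrderAt g w :=
    Order.one_le_iff_ne_zero.2 ((hg.analyticAt w).analyticOrderAt_ne_zero.2 hgw)
  rw [← hn] at h1
  have h3 : (n : ℕ∞) + 1 ≤ n := by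
    conv_rhs => rw [h1]
    gcongr
  exact absurd h3 (by exact_mod_cast Nat.not_succ_le_self n)

/-- Extraction of finitely many zeros from an entire function. -/
theorem exists_monic_mul_of_entire {f : ℂ → ℂ} (hf : Differentiable ℂ f) (h0 : ∃ z, f z ≠ 0)
    (Z : Finset ℂ) : ∃ (R : ℂ[X]) (g : ℂ → ℂ), R.Monic ∧ Differentiable ℂ g ∧
      (∀ z ∈ Z, g z ≠ 0) ∧ ∀ z, f z = R.eval z * g z := by
  induction Z using Finset.induction_on with
  | empty => exact ⟨1, f, monic_one, hf, by simp, by simp⟩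
  | insert w Z _ ih =>
    obtain ⟨R, g, hR, hg, hgZ, hfg⟩ := ih
    have hg0 : ∃ z, g z ≠ 0 := by
      obtain ⟨z, hz⟩ := h0
      exact ⟨z, fun h => hz (by rw [hfg, h, mul_zero])⟩
    obtain ⟨n, k, -, hk, hkw, hgk⟩ := exists_eq_pow_mul_of_entire hg hg0 w
    refine ⟨R * (X - C w) ^ n, k, hR.mul ((monic_X_sub_C w).pow n), hk, fun z hz => ?_,
      fun z => by rw [hfg, hgk]; simp; ring⟩
    rcases Finset.mem_insert.1 hz with rfl | hz
    · exact hkw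
    · intro h
      exact hgZ z hz (by rw [hgk, h, mul_zero])

theorem finite_zeros_inter_closedBall {f : ℂ → ℂ} (hf : Differentiable ℂ f) (h0 : ∃ z, f z ≠ 0)
    (R : ℝ) : {z | f z = 0 ∧ ‖z‖ ≤ R}.Finite := by
  by_contra hinf
  obtain ⟨x, -, hx⟩ := Set.Infinite.exists_accPt_of_subset_isCompact hinf
    (isCompact_closedBall (0 : ℂ) R) fun z hz => by simpa using hz.2
  rw [accPt_iff_frequently_nhdsNE] at hx
  rcases (hf.analyticAt x).eventually_eq_zero_or_eventually_ne_zero with h | h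
  · exact analyticOrderAt_ne_top_of_entire hf h0 x (analyticOrderAt_eq_top.2 h)
  · exact (hx.and_eventually h).exists.elim fun z hz => hz.2 hz.1.1

/-- An entire function of polynomial growth on a sequence of circles is a polynomial. -/
theorem exists_polynomial_of_growth {h : ℂ → ℂ} (hh : Differentiable ℂ h) {r : ℕ → ℝ}
    (hr : Filter.Tendsto r Filter.atTop Filter.atTop) {K s : ℝ}
    (hb : ∀ᶠ n in Filter.atTop, ∀ z : ℂ, ‖z‖ = r n → ‖h z‖ ≤ K * r n ^ s) :
    ∃ P : ℂ[X], (∀ z, h z = P.eval z) ∧ ∀ n : ℕ, s < n → P.coeff n = 0 := by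
  -- Cauchy's estimates on the circles. The exponent is real because both a possibly negative
  -- integer and 3/2 are needed later.
  have hz : ∀ n : ℕ, s < n → iteratedDeriv n h 0 = 0 := by
    intro n hn
    have hlim : Filter.Tendsto (fun k => n.factorial * K * r k ^ (-((n : ℝ) - s))) Filter.atTop
        (nhds (n.factorial * K * 0)) :=
      ((tendsto_rpow_neg_atTop (by linarith)).comp hr).const_mul _
    rw [mul_zero] at hlim
    rw [← norm_le_zero_iff]
    refine ge_of_tendsto hlim ?_
    filter_upwards [hb, hr.eventually_gt_atTop 0] with k hk hk0
    refine (norm_iteratedDeriv_le_of_forall_mem_sphere_norm_le n hk0 hh.diffContOnCl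
      fun z hz => hk z (by simpa using hz)).trans (le_of_eq ?_)
    rw [neg_sub, Real.rpow_sub hk0, Real.rpow_natCast]
    ring
  set N := ⌊s⌋₊ + 1
  have hN : ∀ n : ℕ, N ≤ n → s < n := fun n hn =>
    (Nat.lt_floor_add_one s).trans_le (by exact_mod_cast hn)
  refine ⟨∑ n ∈ Finset.range N, C ((n.factorial : ℂ)⁻¹ * iteratedDeriv n h 0) * X ^ n,
    fun z => ?_, fun n hn => ?_⟩
  · rw [← taylorSeries_eq_of_entire' 0 z hh, tsum_eq_sum (s := Finset.range N)]
    · simp [eval_finsetSum]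
    · intro n hn
      rw [hz n (hN n (by simpa using hn))]
      simp
  · rw [finsetSum_coeff]
    refine Finset.sum_eq_zero fun m _ => ?_
    rw [coeff_C_mul, coeff_X_pow]
    split_ifs with hmn
    · subst hmn; rw [hz _ hn]; simp
    · simp

theorem exists_norm_eval_le (P : ℂ[X]) :
    ∃ K : ℝ, 0 ≤ K ∧ ∀ z : ℂ, 1 ≤ ‖z‖ → ‖P.eval z‖ ≤ K * ‖z‖ ^ P.natDegree := by
  refine ⟨∑ i ∈ Finset.range (P.natDegree + 1), ‖P.coeff i‖,
    Finset.sum_nonneg fun _ _ => norm_nonneg _, fun z hz => ?_⟩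
  rw [eval_eq_sum_range, Finset.sum_mul]
  refine (norm_sum_le _ _).trans (Finset.sum_le_sum fun i hi => ?_)
  rw [norm_mul, norm_pow]
  gcongr
  exact Nat.lt_succ_iff.1 (Finset.mem_range.1 hi)

end EntireDivision

/-- The coefficients of a polynomial depending differentiably on a parameter are differentiable. -/
theorem hasDerivAt_coeff {P P' : ℝ → ℂ[X]} {N : ℕ} (hP : ∀ x, (P x).degree < N)
    (hP' : ∀ x, (P' x).degree < N) {T : Set ℂ} (hT : T.Infinite)
    (h : ∀ E ∈ T, ∀ x, HasDerivAt (fun x => (P x).eval E) ((P' x).eval E) x) (j : ℕ) (x : ℝ) :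
    HasDerivAt (fun x => (P x).coeff j) ((P' x).coeff j) x := by
  obtain ⟨t, ht, hcard⟩ := hT.exists_subset_card_eq N
  -- Lagrange interpolation at N fixed nodes makes a coefficient a linear combination of values with
  -- weights independent of x.
  have key : ∀ R : ℂ[X], R.degree < N →
      R.coeff j = ∑ i ∈ t, R.eval i * (Lagrange.basis t id i).coeff j := by
    intro R hR
    rw [← hcard] at hR
    have h1 := Lagrange.eq_interpolate (v := id) Function.injective_id.injOn hR
    conv_lhs => rw [h1, Lagrange.interpolate_apply, finsetSum_coeff]
    simp
  rw [key _ (hP' x)]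
  simp only [fun x => key _ (hP x)]
  exact HasDerivAt.fun_sum fun i hi => (h i (ht hi) x).mul_const _

end AKNS

/-! ### The monodromy matrix is polynomial up to a scalar entire factor. -/

namespace AKNS

open Complex Polynomial

namespace Fundamental

variable {p q : ℝ → ℂ} (φ : Fundamental p q) {Ω : ℝ}

theorem exists_tr_asymptotics (hΩ : 0 < Ω) (hp2 : ContDiff ℝ 2 p) (hq2 : ContDiff ℝ 2 q) :
    ∃ C : ℝ, 0 ≤ C ∧ ∀ E : ℂ, 1 ≤ ‖E‖ →
      ‖φ.tr Ω E - 2 * cos (Ω * E)‖ ≤ C / ‖E‖ * Real.exp (|E.im| * Ω) := by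
  obtain ⟨C, hC, h⟩ := φ.exists_asymptotics hΩ hp2 hq2 0
  refine ⟨2 * C, by positivity, fun E hE => ?_⟩
  obtain ⟨h1, -, -, h4⟩ := h E hE
  have : φ.tr Ω E - 2 * cos (Ω * E) = (φ.M₁₁ Ω E 0 - exp (-(I * E * Ω))) +
      (φ.M₂₂ Ω E 0 - exp (I * E * Ω)) := by
    rw [two_cos, tr, show (Ω : ℂ) * E * I = I * E * Ω by ring,
      show -((Ω : ℂ) * E) * I = -(I * E * Ω) by ring]
    ring
  rw [this]
  refine (norm_add_le _ _).trans ((add_le_add h1 h4).trans (le_of_eq ?_))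
  ring

theorem exists_tr_deriv_asymptotics (hΩ : 0 < Ω) (hp2 : ContDiff ℝ 2 p) (hq2 : ContDiff ℝ 2 q) :
    ∃ C : ℝ, 0 ≤ C ∧ ∀ E : ℂ, 2 ≤ ‖E‖ →
      ‖deriv (φ.tr Ω) E + 2 * Ω * sin (Ω * E)‖ ≤ C / ‖E‖ * Real.exp (|E.im| * Ω) := by
  obtain ⟨C, hC, h⟩ := φ.exists_tr_asymptotics hΩ hp2 hq2
  refine ⟨2 * C * Real.exp Ω, by positivity, fun E hE => ?_⟩
  have hg : Differentiable ℂ fun E => φ.tr Ω E - 2 * cos (Ω * E) :=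
    (φ.hol_tr Ω).sub (((differentiable_id.const_mul (Ω : ℂ)).ccos).const_mul 2)
  have h1 := norm_deriv_le_of_expBound hg hΩ hC le_rfl h E (by linarith)
  have h2 : HasDerivAt (fun E : ℂ => cos (Ω * E)) (-sin (Ω * E) * Ω) E := by
    simpa using ((hasDerivAt_id E).const_mul (Ω : ℂ)).ccos
  have h3 : HasDerivAt (fun E => φ.tr Ω E - 2 * cos (Ω * E)) _ E :=
    (φ.hol_tr Ω E).hasDerivAt.sub (h2.const_mul 2)
  rw [h3.deriv] at h1
  convert h1 using 2
  ring

/-- The discriminant is quadratic in the entries of W, so its derivative vanishes where they all do.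
That derivative is 2ΔΔ', and Δ² = 4 excludes Δ = 0. -/
theorem deriv_tr_eq_zero (hp : Function.Periodic p Ω) (hq : Function.Periodic q Ω) {E : ℂ}
    (hs : φ.s Ω E = 0) (h : φ.a Ω E 0 = 0 ∧ φ.M₁₂ Ω E 0 = 0 ∧ φ.M₂₁ Ω E 0 = 0) :
    deriv (φ.tr Ω) E = 0 := by
  obtain ⟨h1, h2, h3⟩ := h
  have hd1 : HasDerivAt (φ.s Ω) (2 * φ.tr Ω E * deriv (φ.tr Ω) E) E :=
    ((((φ.hol_tr Ω E).hasDerivAt).pow 2).sub_const 4).congr_deriv (by simp)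
  have hd2 : HasDerivAt (φ.s Ω) 0 E := by
    rw [show φ.s Ω = fun E => 4 * (φ.a Ω E 0 ^ 2 + φ.M₁₂ Ω E 0 * φ.M₂₁ Ω E 0) from
      funext fun E => φ.s_eq hp hq E 0]
    refine ((((φ.hol_a Ω 0 E).hasDerivAt.pow 2).add ((φ.hol_M₁₂ Ω 0 E).hasDerivAt.mul
      (φ.hol_M₂₁ Ω 0 E).hasDerivAt)).const_mul 4).congr_deriv ?_
    rw [h1, h2, h3]
    simp
  have h4 := hd1.unique hd2
  rw [s] at hs
  have h5 : φ.tr Ω E ≠ 0 := fun h => by rw [h] at hs; norm_num at hs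
  simpa [h5] using h4

/-- The structure of the spectral data outside a large disc. -/
structure FarRegion (φ : Fundamental p q) (Ω R c : ℝ) : Prop where
  R_pos : 0 < R
  c_pos : 0 < c
  crit : ∀ E, R ≤ ‖E‖ → deriv (φ.tr Ω) E = 0 → φ.s Ω E = 0 ∧ deriv (deriv (φ.tr Ω)) E ≠ 0 ∧
    ∃ k : ℤ, ‖Ω * E - k * Real.pi‖ ≤ 1 / 2
  inj : ∀ E E' : ℂ, R ≤ ‖E‖ → R ≤ ‖E'‖ → deriv (φ.tr Ω) E = 0 → deriv (φ.tr Ω) E' = 0 →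
    ∀ k : ℤ, ‖Ω * E - k * Real.pi‖ ≤ 1 / 2 → ‖Ω * E' - k * Real.pi‖ ≤ 1 / 2 → E = E'
  lower : ∀ E : ℂ, R ≤ ‖E‖ → (∀ k : ℤ, 1 / 2 ≤ ‖Ω * E - k * Real.pi‖) →
    c * Real.exp (|E.im| * Ω) ≤ ‖deriv (φ.tr Ω) E‖ ∧ c ≤ ‖φ.s Ω E‖
  degen : ∀ E, R ≤ ‖E‖ → φ.s Ω E = 0 → ∀ x, φ.a Ω E x = 0 ∧ φ.M₁₂ Ω E x = 0 ∧ φ.M₂₁ Ω E x = 0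

theorem exists_farRegion (hΩ : 0 < Ω) (hp2 : ContDiff ℝ 2 p) (hq2 : ContDiff ℝ 2 q)
    (hp : Function.Periodic p Ω) (hq : Function.Periodic q Ω)
    (hF : {E : ℂ | ¬ HasTwoFloquetSolutions p q Ω E}.Finite) :
    ∃ R c : ℝ, φ.FarRegion Ω R c := by
  obtain ⟨C, hC, h⟩ := φ.exists_tr_asymptotics hΩ hp2 hq2
  have hz : ∀ E, φ.s Ω E = 0 → E ∉ {E : ℂ | ¬ HasTwoFloquetSolutions p q Ω E} → ∀ x,
      φ.a Ω E x = 0 ∧ φ.M₁₂ Ω E x = 0 ∧ φ.M₂₁ Ω E x = 0 := fun E h1 h2 =>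
    φ.eq_zero_of_twoFloquet hp hq h1 (not_not.1 h2)
  obtain ⟨R, hR, c, hc, h1, h2, h3⟩ := exists_far_region (φ.hol_tr Ω) hΩ hC h hF
    fun E h1 h2 => φ.deriv_tr_eq_zero hp hq h1 (hz E h1 h2 0)
  obtain ⟨B, hB⟩ := hF.isBounded.exists_norm_le
  have hm : ∀ {E : ℂ}, max R (B + 1) ≤ ‖E‖ → R ≤ ‖E‖ := fun h => (le_max_left _ _).trans h
  refine ⟨max R (B + 1), c, lt_max_of_lt_left hR, hc, fun E hE => h1 E (hm hE),
    fun E E' hE hE' => h2 E E' (hm hE) (hm hE'), fun E hE => h3 E (hm hE), fun E hE hs =>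
      hz E hs fun hmem => ?_⟩
  have h4 := hB E hmem
  have h5 := (le_max_right R (B + 1)).trans hE
  linarith

/-- The radii of circles avoiding the zeros of `sin (Ω E)`. -/
noncomputable def radius (Ω : ℝ) (n : ℕ) : ℝ := (n + 1 / 2) * Real.pi / Ω

theorem tendsto_radius (hΩ : 0 < Ω) : Filter.Tendsto (radius Ω) Filter.atTop Filter.atTop :=
  ((Filter.tendsto_atTop_add_const_right _ _ tendsto_natCast_atTop_atTop).atTop_mul_const
    Real.pi_pos).atTop_div_const hΩ

theorem half_le_of_norm_eq_radius (hΩ : 0 < Ω) {n : ℕ} {E : ℂ} (hE : ‖E‖ = radius Ω n) (k : ℤ) :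
    1 / 2 ≤ ‖Ω * E - k * Real.pi‖ := by
  refine le_norm_sub_of_norm_eq (n := n) ?_ k
  rw [norm_mul, norm_real, Real.norm_of_nonneg hΩ.le, hE, radius]
  field_simp

namespace FarRegion

variable {φ} {R c : ℝ}

theorem exists_deriv_tr_ne_zero (h : φ.FarRegion Ω R c) (hΩ : 0 < Ω) :
    ∃ E, deriv (φ.tr Ω) E ≠ 0 ∧ φ.s Ω E ≠ 0 := by
  obtain ⟨n, hn⟩ := ((tendsto_radius hΩ).eventually_ge_atTop R).exists
  have hr : 0 ≤ radius Ω n := by rw [radius]; positivity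
  have hE : ‖(radius Ω n : ℂ)‖ = radius Ω n := by
    rw [norm_real, Real.norm_of_nonneg hr]
  have h1 := h.lower _ (by rw [hE]; exact hn) (half_le_of_norm_eq_radius hΩ hE)
  have hc := h.c_pos
  refine ⟨(radius Ω n : ℂ), fun h0 => ?_, fun h0 => ?_⟩
  · rw [h0, norm_zero] at h1
    have : 0 < c * Real.exp (|((radius Ω n : ℝ) : ℂ).im| * Ω) := by positivity
    linarith
  · rw [h0, norm_zero] at h1
    linarith

/-- Factorization of the derivative of the trace: all zeros of `g` are simple zeros located outside
the disc. -/
theorem exists_factorization (h : φ.FarRegion Ω R c) (hΩ : 0 < Ω) :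
    ∃ (P : ℂ[X]) (g : ℂ → ℂ), P.Monic ∧ Differentiable ℂ g ∧
      (∀ E, deriv (φ.tr Ω) E = P.eval E * g E) ∧ (∀ E, ‖E‖ ≤ R → g E ≠ 0) ∧
      ∀ E, g E = 0 → φ.s Ω E = 0 ∧ analyticOrderAt g E = 1 := by
  have hd : Differentiable ℂ (deriv (φ.tr Ω)) := (φ.hol_tr Ω).deriv
  obtain ⟨E₀, hE₀, -⟩ := h.exists_deriv_tr_ne_zero hΩ
  have hfin := finite_zeros_inter_closedBall hd ⟨E₀, hE₀⟩ R
  obtain ⟨P, g, hP, hg, hgZ, hfac⟩ := exists_monic_mul_of_entire hd ⟨E₀, hE₀⟩ hfin.toFinset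
  have hin : ∀ E, ‖E‖ ≤ R → g E ≠ 0 := fun E hE h0 =>
    hgZ E (hfin.mem_toFinset.2 ⟨by rw [hfac, h0, mul_zero], hE⟩) h0
  refine ⟨P, g, hP, hg, hfac, hin, fun E h0 => ?_⟩
  have hER : R ≤ ‖E‖ := not_lt.1 fun hlt => hin E hlt.le h0
  obtain ⟨h1, h2, -⟩ := h.crit E hER (by rw [hfac, h0, mul_zero])
  refine ⟨h1, (hg.analyticAt E).analyticOrderAt_eq_one_of_zero_deriv_ne_zero h0 fun h3 => h2 ?_⟩
  have h4 : HasDerivAt (fun E => P.eval E * g E) _ E := (P.hasDerivAt E).mul (hg E).hasDerivAt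
  rw [show deriv (φ.tr Ω) = fun E => P.eval E * g E from funext hfac, h4.deriv, h0, h3]
  simp

/-- Simple zeros make F/g entire. Since F/g = P F/Δ', the lower bound for Δ' on the circles cancels
the exponential in the bound for F and leaves growth of order deg P - 1. -/
theorem exists_polynomial_quotient (h : φ.FarRegion Ω R c) (hΩ : 0 < Ω) {P : ℂ[X]} {g : ℂ → ℂ}
    (hg : Differentiable ℂ g) (hfac : ∀ E, deriv (φ.tr Ω) E = P.eval E * g E)
    (hg0 : ∀ E, g E = 0 → φ.s Ω E = 0 ∧ analyticOrderAt g E = 1) {F : ℂ → ℂ}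
    (hF : Differentiable ℂ F) (hF0 : ∀ E, g E = 0 → F E = 0) {K : ℝ}
    (hFb : ∀ E : ℂ, 2 ≤ ‖E‖ → ‖F E‖ ≤ K / ‖E‖ * Real.exp (|E.im| * Ω)) :
    ∃ A : ℂ[X], (∀ E, F E = g E * A.eval E) ∧ ∀ n : ℕ, P.natDegree ≤ n → A.coeff n = 0 := by
  have hgne : ∃ z, g z ≠ 0 := by
    obtain ⟨E₀, hE₀, -⟩ := h.exists_deriv_tr_ne_zero hΩ
    exact ⟨E₀, fun h0 => hE₀ (by rw [hfac, h0, mul_zero])⟩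
  obtain ⟨k, hk, hFk⟩ := exists_entire_quotient hF hg hgne fun z hz => by
    rw [(hg0 z hz).2]
    exact Order.one_le_iff_ne_zero.2 ((hF.analyticAt z).analyticOrderAt_ne_zero.2 (hF0 z hz))
  obtain ⟨K', hK', hPb⟩ := exists_norm_eval_le P
  have hc := h.c_pos
  obtain ⟨A, hA, hAc⟩ := exists_polynomial_of_growth hk (tendsto_radius hΩ)
    (K := K * K' / c) (s := P.natDegree - 1) (by
      filter_upwards [(tendsto_radius hΩ).eventually_ge_atTop R,
        (tendsto_radius hΩ).eventually_ge_atTop 2] with n hnR hn2 z hz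
      rw [← hz] at hnR hn2 ⊢
      have hz0 : 0 < ‖z‖ := by linarith
      have h1 := (h.lower z hnR (half_le_of_norm_eq_radius hΩ hz)).1
      have h2 := hFb z hn2
      have h3 := hPb z (by linarith)
      have h4 : ‖k z‖ * ‖deriv (φ.tr Ω) z‖ = ‖P.eval z‖ * ‖F z‖ := by
        rw [← norm_mul, ← norm_mul, hfac, hFk]
        congr 1
        ring
      have h5 : ‖k z‖ * (c * Real.exp (|z.im| * Ω)) ≤
          (K' * ‖z‖ ^ P.natDegree) * (K / ‖z‖ * Real.exp (|z.im| * Ω)) := by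
        calc _ ≤ ‖k z‖ * ‖deriv (φ.tr Ω) z‖ := by gcongr
          _ ≤ _ := by rw [h4]; gcongr
      rw [Real.rpow_sub hz0, Real.rpow_natCast, Real.rpow_one]
      have he := Real.exp_pos (|z.im| * Ω)
      have h6 : ‖k z‖ ≤ (K' * ‖z‖ ^ P.natDegree) * (K / ‖z‖ * Real.exp (|z.im| * Ω)) /
          (c * Real.exp (|z.im| * Ω)) := by rwa [le_div_iff₀ (by positivity)]
      refine h6.trans (le_of_eq ?_)
      field_simp)
  refine ⟨A, fun E => by rw [hFk, hA], fun n hn => hAc n ?_⟩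
  have : (P.natDegree : ℝ) ≤ n := by exact_mod_cast hn
  linarith

end FarRegion

/-- The trace-free part of the monodromy matrix is, up to an entire factor, a polynomial in `E`. -/
theorem exists_polynomial_monodromy (hΩ : 0 < Ω) (hp2 : ContDiff ℝ 2 p) (hq2 : ContDiff ℝ 2 q)
    (hp : Function.Periodic p Ω) (hq : Function.Periodic q Ω)
    (hF : {E : ℂ | ¬ HasTwoFloquetSolutions p q Ω E}.Finite) :
    ∃ (d : ℕ) (A B D : ℝ → ℂ[X]) (g : ℂ → ℂ) (T : Set ℂ), T.Infinite ∧
      (∀ E ∈ T, g E ≠ 0) ∧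
      (∀ x E, φ.a Ω E x = g E * (A x).eval E ∧ φ.M₁₂ Ω E x = g E * (B x).eval E ∧
        φ.M₂₁ Ω E x = g E * (D x).eval E) ∧
      (∀ x n, d ≤ n → (B x).coeff n = 0 ∧ (D x).coeff n = 0) ∧
      (∀ x n, d < n → (A x).coeff n = 0) ∧ ∀ x, (A x).coeff d = I / (2 * Ω) := by
  obtain ⟨R, c, h⟩ := φ.exists_farRegion hΩ hp2 hq2 hp hq hF
  obtain ⟨P, g, hP, hg, hfac, hin, hg0⟩ := h.exists_factorization hΩ
  have hgR : ∀ E, g E = 0 → R ≤ ‖E‖ := fun E h0 => not_lt.1 fun hlt => hin E hlt.le h0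
  have hvan : ∀ E, g E = 0 → ∀ x, φ.a Ω E x = 0 ∧ φ.M₁₂ Ω E x = 0 ∧ φ.M₂₁ Ω E x = 0 :=
    fun E h0 => h.degen E (hgR E h0) (hg0 E h0).1
  obtain ⟨C', hC', htr⟩ := φ.exists_tr_deriv_asymptotics hΩ hp2 hq2
  have hΩ0 : (Ω : ℂ) ≠ 0 := ofReal_ne_zero.2 hΩ.ne'
  have key : ∀ x, ∃ A B D : ℂ[X], (∀ E, φ.a Ω E x = g E * A.eval E ∧
      φ.M₁₂ Ω E x = g E * B.eval E ∧ φ.M₂₁ Ω E x = g E * D.eval E) ∧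
      (∀ n, P.natDegree ≤ n → B.coeff n = 0 ∧ D.coeff n = 0) ∧
      (∀ n, P.natDegree < n → A.coeff n = 0) ∧ A.coeff P.natDegree = I / (2 * Ω) := by
    intro x
    obtain ⟨K, hK, hM⟩ := φ.exists_asymptotics hΩ hp2 hq2 x
    obtain ⟨B, hB, hBc⟩ := h.exists_polynomial_quotient hΩ hg hfac hg0 (φ.hol_M₁₂ Ω x)
      (fun E h0 => (hvan E h0 x).2.1) fun E hE => (hM E (by linarith)).2.2.1
    obtain ⟨D, hD, hDc⟩ := h.exists_polynomial_quotient hΩ hg hfac hg0 (φ.hol_M₂₁ Ω x)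
      (fun E h0 => (hvan E h0 x).2.2) fun E hE => (hM E (by linarith)).2.1
    -- The entry a itself lacks the decay 1/‖E‖. It is asymptotic to -i sin(ΩE) and Δ' to -2Ω
    -- sin(ΩE), so subtracting iΔ'/(2Ω) restores it. Adding i/(2Ω) P back after division by g fixes
    -- the leading coefficient, because P is monic and the remainder has smaller degree.
    obtain ⟨A, hA, hAc⟩ := h.exists_polynomial_quotient hΩ hg hfac hg0
      (F := fun E => φ.a Ω E x - I / (2 * Ω) * deriv (φ.tr Ω) E)
      ((φ.hol_a Ω x).sub ((φ.hol_tr Ω).deriv.const_mul _))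
      (fun E h0 => by rw [(hvan E h0 x).1, hfac, h0]; simp)
      (K := K + C' / (2 * Ω)) fun E hE => by
        obtain ⟨h1, -, -, h4⟩ := hM E (by linarith)
        have h5 := htr E hE
        have e1 : φ.a Ω E x - I / (2 * Ω) * deriv (φ.tr Ω) E =
            ((φ.M₁₁ Ω E x - exp (-(I * E * Ω))) - (φ.M₂₂ Ω E x - exp (I * E * Ω))) / 2 -
              I / (2 * Ω) * (deriv (φ.tr Ω) E + 2 * Ω * sin (Ω * E)) := by
          have e2 := two_sin (Ω * E)
          rw [show (Ω : ℂ) * E * I = I * E * Ω by ring,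
            show -((Ω : ℂ) * E) * I = -(I * E * Ω) by ring] at e2
          have e3 : I / (2 * Ω) * (2 * Ω * sin (Ω * E)) = I * sin (Ω * E) := by field_simp
          rw [a]
          linear_combination (I / 2) * e2 + e3 +
            (exp (-(I * E * Ω)) - exp (I * E * Ω)) / 2 * I_sq
        have e3 : ‖I / (2 * Ω)‖ = 1 / (2 * Ω) := by
          simp [abs_of_pos hΩ]
        rw [e1]
        calc _ ≤ (K / ‖E‖ * Real.exp (|E.im| * Ω) + K / ‖E‖ * Real.exp (|E.im| * Ω)) / 2 +
              1 / (2 * Ω) * (C' / ‖E‖ * Real.exp (|E.im| * Ω)) := by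
              refine (norm_sub_le _ _).trans ?_
              rw [norm_div, norm_mul, e3, norm_ofNat]
              gcongr
              exact (norm_sub_le _ _).trans (add_le_add h1 h4)
          _ = _ := by
              have : 0 < ‖E‖ := by linarith
              field_simp
              ring
    refine ⟨A + C (I / (2 * Ω)) * P, B, D, fun E => ⟨?_, hB E, hD E⟩, fun n hn =>
      ⟨hBc n hn, hDc n hn⟩, fun n hn => ?_, ?_⟩
    · have := hA E
      rw [eval_add, eval_mul, eval_C]
      linear_combination this + I / (2 * Ω) * hfac E
    · rw [coeff_add, hAc n hn.le, coeff_C_mul, coeff_eq_zero_of_natDegree_lt hn]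
      simp
    · rw [coeff_add, hAc _ le_rfl, coeff_C_mul, hP.coeff_natDegree]
      simp
  choose A B D h1 h2 h3 h4 using key
  refine ⟨P.natDegree, A, B, D, g, Metric.closedBall 0 R, ?_, fun E hE => hin E (by simpa using hE),
    h1, h2, h3, h4⟩
  exact infinite_of_mem_nhds (0 : ℂ) (Metric.closedBall_mem_nhds _ h.R_pos)

end Fundamental

end AKNS

/-! ### From polynomial monodromy to the stationary AKNS hierarchy. -/

namespace AKNS

open Complex Polynomial

/-- Solved for the derivatives, the recursion expresses each of them polynomially through members of
the family; p and q are themselves multiples of h₀ and f₀. Regularity therefore rises by one for all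
indices at once. -/
theorem IsRecursion.contDiff {p q : ℝ → ℂ} {f g h : ℕ → ℝ → ℂ} (H : IsRecursion p q f g h)
    (hf : ∀ l, Differentiable ℝ (f l)) (hh : ∀ l, Differentiable ℝ (h l)) (k : ℕ) :
    ∀ l, ContDiff ℝ k (f l) ∧ ContDiff ℝ k (g l) ∧ ContDiff ℝ k (h l) := by
  have hq : q = fun x => I * f 0 x := funext fun x => by
    rw [H.f_zero]; linear_combination q x * I_sq
  have hp : p = fun x => -I * h 0 x := funext fun x => by
    rw [H.h_zero]; linear_combination p x * I_sq
  have hg : ∀ l, Differentiable ℝ (g l) := fun l => by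
    cases l with
    | zero => rw [show g 0 = fun _ => 1 from funext H.g_zero]; exact differentiable_const _
    | succ l => exact fun x => (H.g_succ l x).differentiableAt
  have df : ∀ l, deriv (f l) = fun x => -2 * I * (f (l + 1) x + I * q x * g (l + 1) x) :=
    fun l => funext fun x => by
      rw [H.f_succ]; linear_combination deriv (f l) x * I_sq
  have dh : ∀ l, deriv (h l) = fun x => 2 * I * (h (l + 1) x - I * p x * g (l + 1) x) :=
    fun l => funext fun x => by
      rw [H.h_succ]; linear_combination deriv (h l) x * I_sq
  have dg : ∀ l, deriv (g (l + 1)) = fun x => p x * f l x + q x * h l x := fun l =>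
    funext fun x => (H.g_succ l x).deriv
  induction k with
  | zero => exact fun l => ⟨contDiff_zero.2 (hf l).continuous, contDiff_zero.2 (hg l).continuous,
      contDiff_zero.2 (hh l).continuous⟩
  | succ k ih =>
    have hqk : ContDiff ℝ k q := by rw [hq]; exact contDiff_const.mul (ih 0).1
    have hpk : ContDiff ℝ k p := by rw [hp]; exact contDiff_const.mul (ih 0).2.2
    have step : ∀ {F : ℝ → ℂ}, Differentiable ℝ F → ContDiff ℝ k (deriv F) →
        ContDiff ℝ (k + 1 : ℕ) F := fun h1 h2 => by
      push_cast
      exact contDiff_succ_iff_deriv.2 ⟨h1, fun h => absurd h (by simp), h2⟩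
    refine fun l => ⟨step (hf l) ?_, step (hg l) ?_, step (hh l) ?_⟩
    · rw [df]
      exact contDiff_const.mul ((ih _).1.add ((contDiff_const.mul hqk).mul (ih _).2.1))
    · cases l with
      | zero =>
        rw [show g 0 = fun _ => 1 from funext H.g_zero, deriv_const']
        exact contDiff_const
      | succ l =>
        rw [dg]
        exact (hpk.mul (ih _).1).add (hqk.mul (ih _).2.2)
    · rw [dh]
      exact contDiff_const.mul ((ih _).2.2.sub ((contDiff_const.mul hpk).mul (ih _).2.1))

theorem IsRecursion.contDiff_potential {p q : ℝ → ℂ} {f g h : ℕ → ℝ → ℂ}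
    (H : IsRecursion p q f g h) (hf : ∀ l, Differentiable ℝ (f l))
    (hh : ∀ l, Differentiable ℝ (h l)) :
    ContDiff ℝ ((⊤ : ℕ∞) : WithTop ℕ∞) p ∧ ContDiff ℝ ((⊤ : ℕ∞) : WithTop ℕ∞) q := by
  have hq : q = fun x => I * f 0 x := funext fun x => by
    rw [H.f_zero]; linear_combination q x * I_sq
  have hp : p = fun x => -I * h 0 x := funext fun x => by
    rw [H.h_zero]; linear_combination p x * I_sq
  constructor
  · refine contDiff_infty.2 fun k => ?_
    rw [hp]
    exact contDiff_const.mul (H.contDiff hf hh k 0).2.2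
  · refine contDiff_infty.2 fun k => ?_
    rw [hq]
    exact contDiff_const.mul (H.contDiff hf hh k 0).1

/-- A polynomial solution of the zero curvature equation `W' = [A, W]` with constant leading
coefficient makes the potential algebro-geometric. -/
theorem isAlgebroGeometric_of_polynomials {p q : ℝ → ℂ} {d : ℕ} {A B D : ℝ → ℂ[X]} {α : ℂ}
    (hα : α ≠ 0)
    (hA : ∀ j x, HasDerivAt (fun x => (A x).coeff j)
      (q x * (D x).coeff j - p x * (B x).coeff j) x)
    (hB : ∀ j x, HasDerivAt (fun x => (B x).coeff j)
      (-2 * I * (X * B x).coeff j - 2 * q x * (A x).coeff j) x)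
    (hD : ∀ j x, HasDerivAt (fun x => (D x).coeff j)
      (2 * I * (X * D x).coeff j + 2 * p x * (A x).coeff j) x)
    (hB0 : ∀ x, (B x).coeff (d + 1) = 0) (hD0 : ∀ x, (D x).coeff (d + 1) = 0)
    (hA0 : ∀ x, (A x).coeff (d + 1) = α) : IsAlgebroGeometric p q := by
  -- The coefficients are read from the top and normalized by α. The sequence g runs one step
  -- longer, down to the constant coefficient of A; everything beyond is set to zero, which
  -- continues the recursion.
  let f : ℕ → ℝ → ℂ := fun l x => if l ≤ d then -(B x).coeff (d - l) / α else 0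
  let g : ℕ → ℝ → ℂ := fun l x => if l ≤ d + 1 then (A x).coeff (d + 1 - l) / α else 0
  let h : ℕ → ℝ → ℂ := fun l x => if l ≤ d then (D x).coeff (d - l) / α else 0
  have df : ∀ l x, HasDerivAt (f l) (if l ≤ d then
      -(-2 * I * (X * B x).coeff (d - l) - 2 * q x * (A x).coeff (d - l)) / α else 0) x := by
    intro l x
    by_cases hl : l ≤ d
    · simp only [f, hl, if_true]
      exact (hB (d - l) x).fun_neg.div_const α
    · simp only [f, hl, if_false]
      exact hasDerivAt_const x 0
  have dh : ∀ l x, HasDerivAt (h l) (if l ≤ d then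
      (2 * I * (X * D x).coeff (d - l) + 2 * p x * (A x).coeff (d - l)) / α else 0) x := by
    intro l x
    by_cases hl : l ≤ d
    · simp only [h, hl, if_true]
      exact (hD (d - l) x).div_const α
    · simp only [h, hl, if_false]
      exact hasDerivAt_const x 0
  have H : IsRecursion p q f g h := by
    constructor
    · intro x
      -- The coefficient of index d + 1 vanishes identically, and so does its derivative; this
      -- determines the coefficient of index d in terms of q and α.
      have h1 := (hB (d + 1) x).unique (by simpa only [hB0] using hasDerivAt_const x (0 : ℂ))
      rw [coeff_X_mul, hA0] at h1
      simp only [f, zero_le, if_true, Nat.sub_zero]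
      rw [div_eq_iff hα]
      linear_combination (-I / 2) * h1 + (-(B x).coeff d) * I_sq
    · intro x
      simp [g, hA0, hα]
    · intro x
      have h1 := (hD (d + 1) x).unique (by simpa only [hD0] using hasDerivAt_const x (0 : ℂ))
      rw [coeff_X_mul, hA0] at h1
      simp only [h, zero_le, if_true, Nat.sub_zero]
      rw [div_eq_iff hα]
      linear_combination (-I / 2) * h1 + (D x).coeff d * I_sq
    · intro l x
      rw [(df l x).deriv]
      rcases lt_trichotomy l d with hl | rfl | hl
      · have e1 : d - l = (d - (l + 1)) + 1 := by omega
        simp only [f, g, hl.le, Nat.succ_le_of_lt hl, if_true, Nat.add_sub_add_right,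
          Nat.add_le_add_iff_right]
        rw [e1, coeff_X_mul]
        field_simp
        linear_combination -(B x).coeff (d - (l + 1)) * I_sq
      · simp [f, g]
        field_simp
        ring
      · simp [f, g, hl.not_ge, show ¬ l + 1 ≤ d by omega]
    · intro l x
      by_cases hl : l ≤ d
      · simp only [f, g, h, hl, if_true, Nat.add_sub_add_right, Nat.add_le_add_iff_right]
        refine ((hA (d - l) x).div_const α).congr_deriv ?_
        ring
      · simp only [f, g, h, hl, if_false, Nat.add_le_add_iff_right]
        simpa using hasDerivAt_const x (0 : ℂ)
    · intro l x
      rw [(dh l x).deriv]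
      rcases lt_trichotomy l d with hl | rfl | hl
      · have e1 : d - l = (d - (l + 1)) + 1 := by omega
        simp only [h, g, hl.le, Nat.succ_le_of_lt hl, if_true, Nat.add_sub_add_right,
          Nat.add_le_add_iff_right]
        rw [e1, coeff_X_mul]
        field_simp
        linear_combination (D x).coeff (d - (l + 1)) * I_sq
      · simp [h, g]
        field_simp
        ring
      · simp [h, g, hl.not_ge, show ¬ l + 1 ≤ d by omega]
  have hsm := H.contDiff_potential (fun l x => (df l x).differentiableAt)
    fun l x => (dh l x).differentiableAt
  exact ⟨hsm.1, hsm.2, f, g, h, d, H, fun x => by simp [f], fun x => by simp [h]⟩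

/-- The scalar factor g(E) does not depend on x, so W/g inherits the Lax equation. It is used only
for E in T, where g is nonzero, and interpolation passes to coefficients. -/
theorem isAlgebroGeometric_of_floquet {p q : ℝ → ℂ} {Ω : ℝ} (hΩ : 0 < Ω)
    (hp2 : ContDiff ℝ 2 p) (hq2 : ContDiff ℝ 2 q)
    (hp : Function.Periodic p Ω) (hq : Function.Periodic q Ω)
    (hF : {E : ℂ | ¬ HasTwoFloquetSolutions p q Ω E}.Finite) : IsAlgebroGeometric p q := by
  obtain ⟨φ⟩ := nonempty_fundamental hp2.continuous hq2.continuous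
  obtain ⟨d, A, B, D, g, T, hT, hgT, hM, hBD, hA, hAd⟩ :=
    φ.exists_polynomial_monodromy hΩ hp2 hq2 hp hq hF
  have hdA : ∀ x, (A x).degree ≤ d := fun x => degree_le_iff_coeff_zero _ _ |>.2 fun n hn =>
    hA x n (by exact_mod_cast hn)
  have hdB : ∀ x, (B x).degree ≤ d := fun x => degree_le_iff_coeff_zero _ _ |>.2 fun n hn =>
    (hBD x n (by exact_mod_cast hn.le)).1
  have hdD : ∀ x, (D x).degree ≤ d := fun x => degree_le_iff_coeff_zero _ _ |>.2 fun n hn =>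
    (hBD x n (by exact_mod_cast hn.le)).2
  have hdX : ∀ {P : ℂ[X]}, P.degree ≤ d → (X * P).degree ≤ ((d + 1 : ℕ) : WithBot ℕ) := fun {P} h => by
    refine (degree_mul_le _ _).trans ?_
    rw [degree_X]
    push_cast
    rw [add_comm]
    gcongr
  have hdC : ∀ {P : ℂ[X]} {n : ℕ} (c : ℂ), P.degree ≤ n → (C c * P).degree ≤ n :=
    fun c h => degree_le_iff_coeff_zero _ _ |>.2 fun n hn => by
      rw [coeff_C_mul, degree_le_iff_coeff_zero _ _ |>.1 h n hn, mul_zero]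
  have hup : ∀ {P : ℂ[X]} {n : ℕ}, n ≤ d + 2 → P.degree ≤ n → P.degree < ((d + 3 : ℕ) : WithBot ℕ) :=
    fun hn h => h.trans_lt (by exact_mod_cast Nat.lt_succ_of_le hn)
  have hdX2 : ∀ {P : ℂ[X]}, P.degree ≤ d → (X * (X * P)).degree ≤ ((d + 2 : ℕ) : WithBot ℕ) := fun {P} h => by
    refine (degree_mul_le _ _).trans ?_
    rw [degree_X]
    calc _ ≤ 1 + ((d + 1 : ℕ) : WithBot ℕ) := by gcongr; exact hdX h
      _ = _ := by push_cast; ring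
  have hΩ0 : (Ω : ℂ) ≠ 0 := ofReal_ne_zero.2 hΩ.ne'
  -- Multiplication by X preserves the linear equations and raises the leading index to d + 1, as
  -- required there. It also covers d = 0, where the unmultiplied polynomials would terminate too
  -- early for n ≥ 0.
  refine isAlgebroGeometric_of_polynomials (d := d) (A := fun x => X * A x)
    (B := fun x => X * B x) (D := fun x => X * D x) (α := I / (2 * Ω)) (by simp [hΩ0])
    ?_ ?_ ?_ (fun x => by rw [coeff_X_mul]; exact (hBD x d le_rfl).1)
    (fun x => by rw [coeff_X_mul]; exact (hBD x d le_rfl).2)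
    (fun x => by rw [coeff_X_mul]; exact hAd x)
  · intro j x
    have key := hasDerivAt_coeff (N := d + 3) (P := fun x => X * A x)
      (P' := fun x => C (q x) * (X * D x) - C (p x) * (X * B x)) (T := T)
      (fun x => hup (n := d + 1) (by omega) (hdX (hdA x)))
      (fun x => hup (n := d + 1) (by omega) ((degree_sub_le _ _).trans
        (max_le (hdC _ (hdX (hdD x))) (hdC _ (hdX (hdB x)))))) hT
      (fun E hE x => ?_) j x
    · refine key.congr_deriv ?_
      rw [coeff_sub, coeff_C_mul, coeff_C_mul]
    · have hg := hgT E hE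
      have h1 : (fun x => (X * A x).eval E) = fun x => E / g E * φ.a Ω E x := funext fun x => by
        rw [(hM x E).1, eval_mul, eval_X]; field_simp
      rw [h1]
      refine ((φ.hasDerivAt_a hp hq E x).const_mul _).congr_deriv ?_
      rw [(hM x E).2.1, (hM x E).2.2]
      simp only [eval_sub, eval_mul, eval_X, eval_C]
      field_simp
  · intro j x
    have key := hasDerivAt_coeff (N := d + 3) (P := fun x => X * B x)
      (P' := fun x => C (-2 * I) * (X * (X * B x)) - C (2 * q x) * (X * A x)) (T := T)
      (fun x => hup (n := d + 1) (by omega) (hdX (hdB x)))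
      (fun x => hup (n := d + 2) (by omega) ((degree_sub_le _ _).trans
        (max_le (hdC _ (hdX2 (hdB x))) ((hdC _ (hdX (hdA x))).trans
          (by exact_mod_cast Nat.le_succ _))))) hT
      (fun E hE x => ?_) j x
    · refine key.congr_deriv ?_
      rw [coeff_sub, coeff_C_mul, coeff_C_mul]
    · have hg := hgT E hE
      have h1 : (fun x => (X * B x).eval E) = fun x => E / g E * φ.M₁₂ Ω E x :=
        funext fun x => by rw [(hM x E).2.1, eval_mul, eval_X]; field_simp
      rw [h1]
      refine ((φ.hasDerivAt_M₁₂ hp hq E x).const_mul _).congr_deriv ?_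
      rw [(hM x E).2.1, (hM x E).1]
      simp only [eval_sub, eval_mul, eval_X, eval_C]
      field_simp
  · intro j x
    have key := hasDerivAt_coeff (N := d + 3) (P := fun x => X * D x)
      (P' := fun x => C (2 * I) * (X * (X * D x)) + C (2 * p x) * (X * A x)) (T := T)
      (fun x => hup (n := d + 1) (by omega) (hdX (hdD x)))
      (fun x => hup (n := d + 2) (by omega) ((degree_add_le _ _).trans
        (max_le (hdC _ (hdX2 (hdD x))) ((hdC _ (hdX (hdA x))).trans
          (by exact_mod_cast Nat.le_succ _))))) hT
      (fun E hE x => ?_) j x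
    · refine key.congr_deriv ?_
      rw [coeff_add, coeff_C_mul, coeff_C_mul]
    · have hg := hgT E hE
      have h1 : (fun x => (X * D x).eval E) = fun x => E / g E * φ.M₂₁ Ω E x :=
        funext fun x => by rw [(hM x E).2.2, eval_mul, eval_X]; field_simp
      rw [h1]
      refine ((φ.hasDerivAt_M₂₁ hp hq E x).const_mul _).congr_deriv ?_
      rw [(hM x E).2.2, (hM x E).1]
      simp only [eval_add, eval_mul, eval_X, eval_C]
      field_simp

end AKNS

/-! ### Dirichlet multiplicities and the zeros of M₁₂. -/

namespace AKNS

open Complex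

section Dirichlet

variable {p q : ℝ → ℂ}

/-- `(L - E) y` as a linear expression in `y`. -/
noncomputable def residual (p q : ℝ → ℂ) (E : ℂ) (y : ℝ → Fin 2 → ℂ) : ℝ → Fin 2 → ℂ :=
  fun x => L p q y x - E • y x

theorem mem_dirichletStep {Ω : ℝ} {E : ℂ} {x₀ : ℝ} {W : Submodule ℂ (ℝ → Fin 2 → ℂ)}
    {y : ℝ → Fin 2 → ℂ} : y ∈ dirichletStep p q Ω E x₀ W ↔ Differentiable ℝ y ∧ y x₀ 0 = 0 ∧
      y (x₀ + Ω) 0 = 0 ∧ residual p q E y ∈ W := Iff.rfl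

theorem dirichletKer_succ (Ω : ℝ) (E : ℂ) (x₀ : ℝ) (k : ℕ) :
    dirichletKer p q Ω E x₀ (k + 1) = dirichletStep p q Ω E x₀ (dirichletKer p q Ω E x₀ k) :=
  Function.iterate_succ_apply' _ _ _

theorem dirichletStep_mono (Ω : ℝ) (E : ℂ) (x₀ : ℝ) : Monotone (dirichletStep p q Ω E x₀) :=
  fun _ _ h _ hy => ⟨hy.1, hy.2.1, hy.2.2.1, h hy.2.2.2⟩

theorem dirichletKer_mono (Ω : ℝ) (E : ℂ) (x₀ : ℝ) : Monotone (dirichletKer p q Ω E x₀) := by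
  refine monotone_nat_of_le_succ fun k => ?_
  induction k with
  | zero => exact bot_le
  | succ k ih =>
    rw [dirichletKer_succ, dirichletKer_succ Ω E x₀ (k + 1)]
    exact dirichletStep_mono Ω E x₀ ih

theorem hasDerivAt_of_residual {E : ℂ} {y : ℝ → Fin 2 → ℂ} (hy : Differentiable ℝ y) (x : ℝ) :
    HasDerivAt (fun x => y x 0) (-I * E * y x 0 + q x * y x 1 - I * residual p q E y x 0) x ∧
    HasDerivAt (fun x => y x 1) (p x * y x 0 + I * E * y x 1 + I * residual p q E y x 1) x := by
  have hd : HasDerivAt y (deriv y x) x := (hy x).hasDerivAt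
  have h0 : residual p q E y x 0 = I * deriv y x 0 + -I * q x * y x 1 - E * y x 0 := by
    simp [residual, L, J, Q, dotProduct, Fin.sum_univ_two]
  have h1 : residual p q E y x 1 = -I * deriv y x 1 + I * p x * y x 0 - E * y x 1 := by
    simp [residual, L, J, Q, dotProduct, Fin.sum_univ_two]
  constructor
  · refine (hasDerivAt_pi.1 hd 0).congr_deriv ?_
    rw [h0]
    linear_combination (deriv y x 0 - q x * y x 1) * I_sq
  · refine (hasDerivAt_pi.1 hd 1).congr_deriv ?_
    rw [h1]
    linear_combination (deriv y x 1 - p x * y x 0) * I_sq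

theorem isSol_of_residual {E : ℂ} {y : ℝ → Fin 2 → ℂ} (hy : Differentiable ℝ y)
    (hr : residual p q E y = 0) : IsSol p q E (fun x => y x 0) (fun x => y x 1) := by
  constructor
  · intro x
    simpa [hr] using (hasDerivAt_of_residual (p := p) (q := q) (E := E) hy x).1
  · intro x
    simpa [hr] using (hasDerivAt_of_residual (p := p) (q := q) (E := E) hy x).2

theorem residual_add {E : ℂ} {y z : ℝ → Fin 2 → ℂ} (hy : Differentiable ℝ y)
    (hz : Differentiable ℝ z) :
    residual p q E (y + z) = residual p q E y + residual p q E z := by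
  funext x
  simp only [residual, L_add p q hy hz, Pi.add_apply, smul_add]
  abel

theorem residual_smul {E : ℂ} (c : ℂ) {y : ℝ → Fin 2 → ℂ} (hy : Differentiable ℝ y) :
    residual p q E (c • y) = c • residual p q E y := by
  funext x
  simp only [residual, L_smul p q c hy, Pi.smul_apply, smul_sub, smul_comm E c]

/-- An element is determined by its image under L - E and its second component at x₀, the first
being zero. Each step thus adds at most one dimension. -/
theorem rank_dirichletKer_le (φ : Fundamental p q) (Ω : ℝ) (E : ℂ) (x₀ : ℝ) (k : ℕ) :
    Module.rank ℂ (dirichletKer p q Ω E x₀ k) ≤ k := by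
  induction k with
  | zero => exact (Submodule.rank_eq_zero.2 rfl).le
  | succ k ih =>
    rw [dirichletKer_succ]
    let f : dirichletStep p q Ω E x₀ (dirichletKer p q Ω E x₀ k) →ₗ[ℂ]
        dirichletKer p q Ω E x₀ k × ℂ :=
      { toFun := fun y => (⟨residual p q E y.1, y.2.2.2.2⟩, y.1 x₀ 1)
        map_add' := fun y z => by
          ext1
          · exact Subtype.ext (residual_add y.2.1 z.2.1)
          · rfl
        map_smul' := fun c y => by
          ext1
          · exact Subtype.ext (residual_smul c y.2.1)
          · rfl }
    have hf : Function.Injective f := by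
      rw [← LinearMap.ker_eq_bot, LinearMap.ker_eq_bot']
      intro y hy
      have h1 : residual p q E y.1 = 0 := congrArg (fun w => w.1.1) hy
      have h2 : y.1 x₀ 1 = 0 := congrArg Prod.snd hy
      ext x i
      have := φ.sol_eq_zero (isSol_of_residual y.2.1 h1) y.2.2.1 h2 x
      fin_cases i
      · exact this.1
      · exact this.2
    refine (LinearMap.rank_le_of_injective f hf).trans ?_
    rw [rank_prod', Module.rank_self]
    push_cast
    gcongr

/-- A Jordan chain for the Dirichlet problem. -/
theorem exists_jordan_chain {Ω : ℝ} {E : ℂ} {x₀ : ℝ} {k : ℕ} {y : ℝ → Fin 2 → ℂ}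
    (hy : y ∈ dirichletKer p q Ω E x₀ (k + 1)) (hy' : y ∉ dirichletKer p q Ω E x₀ k) :
    ∃ w : ℕ → ℝ → Fin 2 → ℂ, w k = y ∧ w 0 ≠ 0 ∧ residual p q E (w 0) = 0 ∧
      (∀ j < k, residual p q E (w (j + 1)) = w j) ∧
      ∀ j ≤ k, Differentiable ℝ (w j) ∧ w j x₀ 0 = 0 ∧ w j (x₀ + Ω) 0 = 0 := by
  induction k generalizing y with
  | zero =>
    rw [dirichletKer_succ, mem_dirichletStep] at hy
    refine ⟨fun _ => y, rfl, fun h => hy' (by rw [show y = 0 from h]; exact zero_mem _), hy.2.2.2, by simp,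
      fun _ _ => ⟨hy.1, hy.2.1, hy.2.2.1⟩⟩
  | succ k ih =>
    rw [dirichletKer_succ, mem_dirichletStep] at hy
    obtain ⟨w, h1, h2, h3, h4, h5⟩ := ih hy.2.2.2 fun h => hy' (by
      rw [dirichletKer_succ, mem_dirichletStep]
      exact ⟨hy.1, hy.2.1, hy.2.2.1, h⟩)
    refine ⟨fun j => if j ≤ k then w j else y, by simp, by simpa using h2, by simpa using h3,
      fun j hj => ?_, fun j hj => ?_⟩
    · have hjk : j ≤ k := Nat.lt_succ_iff.1 hj
      rcases hjk.lt_or_eq with hlt | rfl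
      · simp only [hjk, Nat.succ_le_of_lt hlt, if_true]
        exact h4 j hlt
      · simp [h1]
    · by_cases hjk : j ≤ k
      · simp only [hjk, if_true]
        exact h5 j hjk
      · simp only [hjk, if_false]
        exact ⟨hy.1, hy.2.1, hy.2.2.1⟩

variable (φ : Fundamental p q)

/-- A Jordan chain of length `m + 1` forces `M₁₂` to vanish to order `m + 1`. -/
theorem no_long_jordan_chain {Ω : ℝ} (hΩ : 0 < Ω) (hp : Continuous p) (hq : Continuous q) {E : ℂ}
    {x₀ : ℝ} {m : ℕ} {β : ℂ → ℂ} (hβ : ContinuousAt β E) (hβ0 : β E ≠ 0)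
    (hM : ∀ z, φ.M₁₂ Ω z x₀ = (z - E) ^ m * β z) {w : ℕ → ℝ → Fin 2 → ℂ} (hw0 : w 0 ≠ 0)
    (hr0 : residual p q E (w 0) = 0) (hr : ∀ j < m, residual p q E (w (j + 1)) = w j)
    (hw : ∀ j ≤ m, Differentiable ℝ (w j) ∧ w j x₀ 0 = 0 ∧ w j (x₀ + Ω) 0 = 0) : False := by
  -- The solution at parameter z with data (0, 1) at x₀; its first component at x₀ + Ω is M₁₂(z,
  -- x₀). It is paired with the chain at the fixed parameter E.
  let u : ℂ → ℝ → ℂ := fun z t => φ.u₁ z t * (-φ.u₂ z x₀) + φ.u₂ z t * φ.u₁ z x₀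
  let v : ℂ → ℝ → ℂ := fun z t => φ.v₁ z t * (-φ.u₂ z x₀) + φ.v₂ z t * φ.u₁ z x₀
  have huv : ∀ z, IsSol p q z (u z) (v z) := fun z => φ.isSol_col₂ z x₀
  have hu0 : ∀ z, u z x₀ = 0 := fun z => by simp only [u]; ring
  have hv0 : ∀ z, v z x₀ = 1 := fun z => by simp only [v]; linear_combination φ.det_eq_one z x₀
  let S : ℂ → ℕ → ℝ → ℂ := fun z j t => u z t * w j t 1 + v z t * w j t 0
  -- the derivative of the weighted sum of Wronskians telescopes
  have hsum : ∀ z t, ∀ k ≤ m, HasDerivAt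
      (fun t => ∑ j ∈ Finset.range (k + 1), (z - E) ^ j * (u z t * w j t 1 - v z t * w j t 0))
      (-I * (z - E) ^ (k + 1) * S z k t) t := by
    intro z t k hk
    induction k with
    | zero =>
      simp only [zero_add, Finset.range_one, Finset.sum_singleton, pow_zero, one_mul]
      have h1 := isSol_of_residual (hw 0 hk).1 hr0
      refine ((((huv z).du t).mul (h1.dv t)).sub (((huv z).dv t).mul (h1.du t))).congr_deriv ?_
      simp only [S]
      ring
    | succ k ih =>
      have h1 := hasDerivAt_of_residual (p := p) (q := q) (E := E) (hw (k + 1) hk).1 t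
      rw [hr k hk] at h1
      simp only [Finset.sum_range_succ _ (k + 1)]
      refine ((ih (by omega)).add (((((huv z).du t).mul h1.2).sub
        (((huv z).dv t).mul h1.1)).const_mul ((z - E) ^ (k + 1)))).congr_deriv ?_
      simp only [S]
      ring
  have hbdc : ∀ f : ℝ → ℂ, Continuous f → ∃ K, 0 ≤ K ∧ ∀ t ∈ Set.Icc x₀ (x₀ + Ω), ‖f t‖ ≤ K := by
    intro f hf
    obtain ⟨K, hK⟩ := (isCompact_Icc (a := x₀) (b := x₀ + Ω)).exists_bound_of_continuousOn
      hf.continuousOn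
    exact ⟨K, (norm_nonneg _).trans (hK x₀ (Set.left_mem_Icc.2 (by linarith))), hK⟩
  obtain ⟨Kp, hKp0, hKp⟩ := hbdc p hp
  obtain ⟨Kq, hKq0, hKq⟩ := hbdc q hq
  have hwc := (hw m le_rfl).1.continuous
  obtain ⟨W₀, hW₀, hW₀b⟩ := hbdc (fun t => w m t 0) (by fun_prop)
  obtain ⟨W₁, hW₁, hW₁b⟩ := hbdc (fun t => w m t 1) (by fun_prop)
  set K := 2 * Real.exp ((Kp + Kq) * Ω) * Real.exp ((|E.im| + 1) * Ω) with hK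
  have hb : ∀ z : ℂ, ‖z - E‖ ≤ 1 → ∀ t ∈ Set.Icc x₀ (x₀ + Ω), ‖u z t‖ ≤ K ∧ ‖v z t‖ ≤ K := by
    intro z hz t ht
    have h1 := (huv z).norm_le (K := Kp + Kq) (fun t ht => (hKp t ht).trans (by linarith))
      (fun t ht => (hKq t ht).trans (by linarith)) (by simp [hu0]) (by simp [hv0]) ht
    have h2 : |z.im| ≤ |E.im| + 1 := by
      have h3 := (abs_im_le_norm (z - E)).trans hz
      rw [sub_im] at h3
      have h4 := abs_sub_abs_le_abs_sub z.im E.im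
      linarith
    have h3 : 2 * Real.exp ((Kp + Kq) * (x₀ + Ω - x₀)) * Real.exp (|z.im| * (t - x₀)) ≤ K := by
      rw [hK, add_sub_cancel_left]
      gcongr
      · linarith [ht.1]
      · linarith [ht.2]
    exact ⟨h1.1.trans h3, h1.2.trans h3⟩
  set B := K * W₁ + K * W₀
  have hx : x₀ ≤ x₀ + Ω := by linarith
  -- The Wronskian sum is zero at x₀ and equals the left side at x₀ + Ω, so the telescoped
  -- derivative controls it by the power m + 1.
  have hest : ∀ z : ℂ, ‖z - E‖ ≤ 1 →
      ‖φ.M₁₂ Ω z x₀ * ∑ j ∈ Finset.range (m + 1), (z - E) ^ j * w j (x₀ + Ω) 1‖ ≤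
        ‖z - E‖ ^ (m + 1) * B * Ω := by
    intro z hz
    have key := (convex_Icc x₀ (x₀ + Ω)).norm_image_sub_le_of_norm_hasDerivWithin_le
      (C := ‖z - E‖ ^ (m + 1) * B) (fun t _ => (hsum z t m le_rfl).hasDerivWithinAt)
      (fun t ht => ?_) (Set.left_mem_Icc.2 hx) (Set.right_mem_Icc.2 hx)
    · have h1 : ∑ j ∈ Finset.range (m + 1),
          (z - E) ^ j * (u z x₀ * w j x₀ 1 - v z x₀ * w j x₀ 0) = 0 := by
        refine Finset.sum_eq_zero fun j hj => ?_
        rw [hu0, (hw j (Nat.lt_succ_iff.1 (Finset.mem_range.1 hj))).2.1]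
        ring
      have h2 : ∑ j ∈ Finset.range (m + 1), (z - E) ^ j *
          (u z (x₀ + Ω) * w j (x₀ + Ω) 1 - v z (x₀ + Ω) * w j (x₀ + Ω) 0) =
          φ.M₁₂ Ω z x₀ * ∑ j ∈ Finset.range (m + 1), (z - E) ^ j * w j (x₀ + Ω) 1 := by
        rw [Finset.mul_sum]
        refine Finset.sum_congr rfl fun j hj => ?_
        rw [(hw j (Nat.lt_succ_iff.1 (Finset.mem_range.1 hj))).2.2]
        change (z - E) ^ j * (φ.M₁₂ Ω z x₀ * w j (x₀ + Ω) 1 - v z (x₀ + Ω) * 0) = _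
        ring
      rw [h1, h2, sub_zero, add_sub_cancel_left, Real.norm_of_nonneg hΩ.le] at key
      exact key
    · rw [norm_mul, norm_mul, norm_neg, norm_I, one_mul, norm_pow]
      gcongr
      refine (norm_add_le _ _).trans ?_
      rw [norm_mul, norm_mul]
      have h1 := hb z hz t ht
      have h2 := hW₀b t ht
      have h3 := hW₁b t ht
      have hK0 : 0 ≤ K := by positivity
      change _ ≤ K * W₁ + K * W₀
      gcongr
      · exact h1.1
      · exact h1.2
  -- After division by (z - E)^m and passage to the limit only the term j = 0 survives. As β(E) ≠ 0,
  -- both components of w 0 vanish at x₀ + Ω, contradicting w 0 ≠ 0.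
  have hlim : Filter.Tendsto (fun z => ‖β z * ∑ j ∈ Finset.range (m + 1),
      (z - E) ^ j * w j (x₀ + Ω) 1‖) (nhdsWithin E {E}ᶜ)
      (nhds ‖β E * ∑ j ∈ Finset.range (m + 1), (E - E) ^ j * w j (x₀ + Ω) 1‖) := by
    have h1 : ContinuousAt (fun z => ∑ j ∈ Finset.range (m + 1), (z - E) ^ j * w j (x₀ + Ω) 1) E :=
      Continuous.continuousAt (by fun_prop)
    exact ((hβ.mul h1).norm.tendsto).mono_left nhdsWithin_le_nhds
  have hlim2 : Filter.Tendsto (fun z : ℂ => ‖z - E‖ * B * Ω) (nhdsWithin E {E}ᶜ)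
      (nhds (‖E - E‖ * B * Ω)) :=
    (Continuous.tendsto (by fun_prop) E).mono_left nhdsWithin_le_nhds
  have hle := le_of_tendsto_of_tendsto hlim hlim2 (by
    have h1 : ∀ᶠ z in nhdsWithin E {E}ᶜ, ‖z - E‖ ≤ 1 := by
      refine nhdsWithin_le_nhds ?_
      filter_upwards [Metric.closedBall_mem_nhds E one_pos] with z hz
      simpa [dist_eq_norm] using hz
    filter_upwards [h1, self_mem_nhdsWithin] with z hz hzE
    have hne : 0 < ‖z - E‖ := norm_pos_iff.2 (sub_ne_zero.2 hzE)
    have h2 := hest z hz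
    rw [hM, mul_assoc, norm_mul, norm_pow] at h2
    have h3 : 0 < ‖z - E‖ ^ m := by positivity
    refine le_of_mul_le_mul_left (h2.trans (le_of_eq ?_)) h3
    ring)
  rw [sub_self, norm_zero, zero_mul, zero_mul, norm_le_zero_iff, Finset.sum_range_succ'] at hle
  have h1 : w 0 (x₀ + Ω) 1 = 0 := by
    simpa [hβ0] using hle
  apply hw0
  ext x i
  have := φ.sol_eq_zero (isSol_of_residual (hw 0 (Nat.zero_le _)).1 hr0) (hw 0 (Nat.zero_le _)).2.2
    h1 x
  fin_cases i
  · exact this.1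
  · exact this.2

/-- The algebraic multiplicity of a Dirichlet eigenvalue is at most the order of vanishing of the
corresponding entry of the monodromy matrix. -/
theorem dirichletMult_le {Ω : ℝ} (hΩ : 0 < Ω) (hp : Continuous p) (hq : Continuous q) {E : ℂ}
    {x₀ : ℝ} {m : ℕ} {β : ℂ → ℂ} (hβ : ContinuousAt β E) (hβ0 : β E ≠ 0)
    (hM : ∀ z, φ.M₁₂ Ω z x₀ = (z - E) ^ m * β z) : dirichletMult p q Ω E x₀ ≤ m := by
  have hstep : dirichletKer p q Ω E x₀ (m + 1) ≤ dirichletKer p q Ω E x₀ m := by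
    intro y hy
    by_contra hy'
    obtain ⟨w, -, h2, h3, h4, h5⟩ := exists_jordan_chain hy hy'
    exact no_long_jordan_chain φ hΩ hp hq hβ hβ0 hM h2 h3 h4 h5
  -- Once two consecutive kernels agree the chain is stationary.
  have hall : ∀ k, dirichletKer p q Ω E x₀ (m + k) ≤ dirichletKer p q Ω E x₀ m := by
    intro k
    induction k with
    | zero => exact le_rfl
    | succ k ih =>
      rw [← add_assoc, dirichletKer_succ]
      refine (dirichletStep_mono Ω E x₀ ih).trans ?_
      rw [← dirichletKer_succ]
      exact hstep
  refine iSup_le fun k => ?_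
  rw [Cardinal.toENat_le_natCast]
  refine le_trans (Submodule.rank_mono ?_) (rank_dirichletKer_le φ Ω E x₀ m)
  exact (dirichletKer_mono Ω E x₀ (Nat.le_add_left k m)).trans (hall k)

/-- The solution with data (0, 1) at x₀ is then a Dirichlet eigenfunction. -/
theorem one_le_dirichletMult {Ω : ℝ} {E : ℂ} {x₀ : ℝ} (hM : φ.M₁₂ Ω E x₀ = 0) :
    1 ≤ dirichletMult p q Ω E x₀ := by
  refine le_trans ?_ (le_iSup _ 1)
  rw [Cardinal.one_le_toENat, Cardinal.one_le_iff_ne_zero, ne_eq, Submodule.rank_eq_zero]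
  have hs := (φ.isSol_col₂ E x₀).mem
  have hmem : (fun x => ![φ.u₁ E x * (-φ.u₂ E x₀) + φ.u₂ E x * φ.u₁ E x₀,
      φ.v₁ E x * (-φ.u₂ E x₀) + φ.v₂ E x * φ.u₁ E x₀]) ∈ dirichletKer p q Ω E x₀ 1 := by
    rw [dirichletKer_succ, mem_dirichletStep]
    refine ⟨hs.1, ?_, hM, ?_⟩
    · simp only [Matrix.cons_val_zero]
      ring
    · change residual p q E _ ∈ (⊥ : Submodule ℂ (ℝ → Fin 2 → ℂ))
      rw [Submodule.mem_bot]
      funext x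
      exact sub_eq_zero.2 (hs.2 x)
  intro h0
  rw [h0, Submodule.mem_bot] at hmem
  have h1 := congrFun (congrFun hmem x₀) 1
  simp only [Matrix.cons_val_one, Matrix.cons_val_fin_one, Pi.zero_apply] at h1
  have h2 := φ.det_eq_one E x₀
  exact one_ne_zero (α := ℂ) (by linear_combination h1 - h2)

end Dirichlet

end AKNS

/-! ### Immovable multiplicities against the zeros of the discriminant. -/

namespace AKNS

open Complex

theorem exists_eq_pow_mul_of_le_order {f : ℂ → ℂ} (hf : Differentiable ℂ f) {w : ℂ} {m : ℕ}
    (hm : (m : ℕ∞) ≤ analyticOrderAt f w) :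
    ∃ g : ℂ → ℂ, Differentiable ℂ g ∧ (∀ z, f z = (z - w) ^ m * g z) ∧
      (g w = 0 → (m : ℕ∞) + 1 ≤ analyticOrderAt f w) := by
  have hd : Differentiable ℂ fun z : ℂ => (z - w) ^ m := by fun_prop
  have hdo : analyticOrderAt (fun z : ℂ => (z - w) ^ m) w = m := analyticOrderAt_centeredMonomial
  obtain ⟨g, hg, hfg⟩ := exists_entire_quotient hf hd ⟨w + 1, by simp⟩ (fun z hz => by
    have : z = w := by
      rw [pow_eq_zero_iff'] at hz
      exact sub_eq_zero.1 hz.1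
    rw [this, hdo]
    exact hm)
  refine ⟨g, hg, hfg, fun h0 => ?_⟩
  rw [show f = (fun z : ℂ => (z - w) ^ m) * g from funext hfg,
    analyticOrderAt_mul (hd.analyticAt w) (hg.analyticAt w), hdo]
  gcongr
  exact Order.one_le_iff_ne_zero.2 ((hg.analyticAt w).analyticOrderAt_ne_zero.2 h0)

/-- Extraction of the common zero of three entire functions. -/
theorem exists_common_factor {f g h : ℂ → ℂ} (hf : Differentiable ℂ f) (hg : Differentiable ℂ g)
    (hh : Differentiable ℂ h) (h0 : ∃ z, ¬(f z = 0 ∧ g z = 0 ∧ h z = 0)) (w : ℂ) :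
    ∃ (m : ℕ) (f' g' h' : ℂ → ℂ), Differentiable ℂ f' ∧ Differentiable ℂ g' ∧
      Differentiable ℂ h' ∧ (∀ z, f z = (z - w) ^ m * f' z) ∧ (∀ z, g z = (z - w) ^ m * g' z) ∧
      (∀ z, h z = (z - w) ^ m * h' z) ∧ ¬(f' w = 0 ∧ g' w = 0 ∧ h' w = 0) := by
  set o := analyticOrderAt f w ⊓ (analyticOrderAt g w ⊓ analyticOrderAt h w) with ho
  have hne : o ≠ ⊤ := by
    intro htop
    rw [ho, inf_eq_top_iff, inf_eq_top_iff] at htop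
    obtain ⟨z, hz⟩ := h0
    refine hz ⟨?_, ?_, ?_⟩
    · exact by_contra fun h => analyticOrderAt_ne_top_of_entire hf ⟨z, h⟩ w htop.1
    · exact by_contra fun h => analyticOrderAt_ne_top_of_entire hg ⟨z, h⟩ w htop.2.1
    · exact by_contra fun h => analyticOrderAt_ne_top_of_entire hh ⟨z, h⟩ w htop.2.2
  obtain ⟨m, hm⟩ := ENat.ne_top_iff_exists.1 hne
  obtain ⟨f', hf', hff, hf1⟩ := exists_eq_pow_mul_of_le_order hf (w := w) (m := m)
    (by rw [hm]; exact inf_le_left)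
  obtain ⟨g', hg', hgg, hg1⟩ := exists_eq_pow_mul_of_le_order hg (w := w) (m := m)
    (by rw [hm]; exact inf_le_right.trans inf_le_left)
  obtain ⟨h', hh', hhh, hh1⟩ := exists_eq_pow_mul_of_le_order hh (w := w) (m := m)
    (by rw [hm]; exact inf_le_right.trans inf_le_right)
  refine ⟨m, f', g', h', hf', hg', hh', hff, hgg, hhh, fun hall => ?_⟩
  have h1 : (m : ℕ∞) + 1 ≤ o := le_inf (hf1 hall.1) (le_inf (hg1 hall.2.1) (hh1 hall.2.2))
  rw [← hm] at h1
  exact absurd h1 (by exact_mod_cast Nat.not_succ_le_self m)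

namespace Fundamental

variable {p q : ℝ → ℂ} (φ : Fundamental p q)

/-- If the off-diagonal entry of a conjugated trace-free matrix vanishes identically, then
so does the matrix. -/
theorem eq_zero_of_conj_eq_zero (hq : Continuous q) (hq0 : ∃ x, q x ≠ 0) (E A B C : ℂ)
    (h : ∀ x, φ.u₁ E x ^ 2 * B - 2 * φ.u₁ E x * φ.u₂ E x * A - φ.u₂ E x ^ 2 * C = 0) :
    A = 0 ∧ B = 0 ∧ C = 0 := by
  -- The conjugated matrix satisfies the Lax equation. If its upper right entry is identically zero,
  -- differentiating once gives q a₀ = 0; differentiating a₀ near a point with q ≠ 0 kills the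
  -- remaining entry.
  let a₀ : ℝ → ℂ := fun x => (φ.u₁ E x * φ.v₂ E x + φ.u₂ E x * φ.v₁ E x) * A
    - φ.u₁ E x * φ.v₁ E x * B + φ.u₂ E x * φ.v₂ E x * C
  have ha : ∀ x, q x * a₀ x = 0 := by
    intro x
    have h1 : HasDerivAt (fun x => φ.u₁ E x ^ 2 * B - 2 * φ.u₁ E x * φ.u₂ E x * A
        - φ.u₂ E x ^ 2 * C) (-2 * I * E * (φ.u₁ E x ^ 2 * B - 2 * φ.u₁ E x * φ.u₂ E x * A
        - φ.u₂ E x ^ 2 * C) - 2 * (q x * a₀ x)) x := by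
      refine ((((((φ.sol₁ E).du x).pow 2).mul_const B).sub (((((φ.sol₁ E).du x).const_mul 2).mul
        ((φ.sol₂ E).du x)).mul_const A)).sub
        ((((φ.sol₂ E).du x).pow 2).mul_const C)).congr_deriv ?_
      simp only [a₀, Nat.cast_ofNat, Nat.add_one_sub_one, pow_one]
      ring
    rw [h x] at h1
    have h2 := h1.unique ((hasDerivAt_const x (0 : ℂ)).congr_of_eventuallyEq
      (Filter.Eventually.of_forall h))
    linear_combination (-1 / 2) * h2
  obtain ⟨x, hx⟩ := hq0
  have hax : a₀ =ᶠ[nhds x] 0 := by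
    filter_upwards [hq.continuousAt.eventually_ne hx] with y hy
    exact (mul_eq_zero.1 (ha y)).resolve_left hy
  have hc : HasDerivAt a₀ (q x * (φ.v₂ E x ^ 2 * C + 2 * φ.v₁ E x * φ.v₂ E x * A
      - φ.v₁ E x ^ 2 * B) - p x * (φ.u₁ E x ^ 2 * B - 2 * φ.u₁ E x * φ.u₂ E x * A
        - φ.u₂ E x ^ 2 * C)) x := by
    refine (((((((φ.sol₁ E).du x).mul ((φ.sol₂ E).dv x)).add (((φ.sol₂ E).du x).mul
      ((φ.sol₁ E).dv x))).mul_const A).sub ((((φ.sol₁ E).du x).mul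
      ((φ.sol₁ E).dv x)).mul_const B)).add ((((φ.sol₂ E).du x).mul
      ((φ.sol₂ E).dv x)).mul_const C)).congr_deriv ?_
    ring
  have hc0 := hc.unique ((hasDerivAt_const x (0 : ℂ)).congr_of_eventuallyEq hax)
  rw [h x, mul_zero, sub_zero] at hc0
  have e1 := (mul_eq_zero.1 hc0).resolve_left hx
  have e2 : a₀ x = 0 := hax.eq_of_nhds
  have e3 := h x
  have hd := φ.det_eq_one E x
  simp only [a₀] at e2
  generalize φ.u₁ E x = u₁ at *
  generalize φ.u₂ E x = u₂ at *
  generalize φ.v₁ E x = v₁ at *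
  generalize φ.v₂ E x = v₂ at *
  -- The combinations below invert the conjugation; its coefficients are quadratic in the
  -- fundamental matrix, hence the squared determinant.
  have hd2 : (u₁ * v₂ - u₂ * v₁) ^ 2 = 1 := by rw [hd, one_pow]
  refine ⟨?_, ?_, ?_⟩
  · linear_combination (-A) * hd2 + (u₁ * v₂ + u₂ * v₁) * e2 + v₂ * v₁ * e3 - u₂ * u₁ * e1
  · linear_combination (-B) * hd2 + v₂ ^ 2 * e3 + 2 * v₂ * u₂ * e2 - u₂ ^ 2 * e1
  · linear_combination (-C) * hd2 + u₁ ^ 2 * e1 - 2 * v₁ * u₁ * e2 - v₁ ^ 2 * e3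

/-- Factor (z - w)^m out of W(z,0), with m maximal. The conjugation to x is linear in W(z,0), so for
some x the order of M₁₂(·,x) at w is exactly m, while the discriminant, quadratic in W, gains (z -
w)^(2m). -/
theorem immovableMult_le {Ω : ℝ} (hΩ : 0 < Ω) (hpc : Continuous p) (hqc : Continuous q)
    (hp : Function.Periodic p Ω) (hq : Function.Periodic q Ω) (hq0 : ∃ x, q x ≠ 0)
    (hs : ∃ E, φ.s Ω E ≠ 0) (w : ℂ) :
    ∃ m : ℕ, immovableMult p q Ω w ≤ m ∧ ((2 * m : ℕ) : ℕ∞) ≤ analyticOrderAt (φ.s Ω) w := by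
  obtain ⟨m, A, B, C, hA, hB, hC, eA, eB, eC, hne⟩ := exists_common_factor (φ.hol_a Ω 0)
    (φ.hol_M₁₂ Ω 0) (φ.hol_M₂₁ Ω 0) (by
      obtain ⟨E, hE⟩ := hs
      refine ⟨E, fun h => hE ?_⟩
      rw [φ.s_eq hp hq E 0, h.1, h.2.1]
      ring) w
  refine ⟨m, ?_, ?_⟩
  · obtain ⟨x, hx⟩ : ∃ x, φ.u₁ w x ^ 2 * B w - 2 * φ.u₁ w x * φ.u₂ w x * A w
        - φ.u₂ w x ^ 2 * C w ≠ 0 := by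
      by_contra! hcon
      exact hne (φ.eq_zero_of_conj_eq_zero hqc hq0 w _ _ _ hcon)
    refine (iInf_le _ x).trans (dirichletMult_le φ hΩ hpc hqc (β := fun z =>
      φ.u₁ z x ^ 2 * B z - 2 * φ.u₁ z x * φ.u₂ z x * A z - φ.u₂ z x ^ 2 * C z) ?_ hx fun z => ?_)
    · have h1 := φ.hol_u₁ x
      have h2 := φ.hol_u₂ x
      exact Differentiable.continuous (𝕜 := ℂ) (by fun_prop) |>.continuousAt
    · rw [(φ.conj_M₁₂ hp hq z x).1, eA, eB, eC]
      ring
  · rw [natCast_le_analyticOrderAt ((φ.hol_s Ω).analyticAt w)]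
    refine ⟨fun z => 4 * (A z ^ 2 + B z * C z),
      Differentiable.analyticAt (by fun_prop) w, Filter.Eventually.of_forall fun z => ?_⟩
    rw [φ.s_eq hp hq z 0, eA, eB, eC, smul_eq_mul]
    ring

namespace FarRegion

variable {φ} {Ω R c : ℝ}

/-- The derivative of the discriminant is 2ΔΔ', where Δ ≠ 0 and Δ' has a simple zero. -/
theorem analyticOrderAt_s (h : φ.FarRegion Ω R c) (hp : Function.Periodic p Ω)
    (hq : Function.Periodic q Ω) {w : ℂ} (hw : R ≤ ‖w‖) (h0 : φ.s Ω w = 0) :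
    analyticOrderAt (φ.s Ω) w = 2 := by
  have hd := φ.deriv_tr_eq_zero hp hq h0 (h.degen w hw h0 0)
  have htr := φ.hol_tr Ω
  have h1 : deriv (φ.s Ω) = (fun E => 2 * φ.tr Ω E) * deriv (φ.tr Ω) := by
    funext E
    exact (((((htr E).hasDerivAt).pow 2).sub_const 4).congr_deriv (by simp)).deriv
  have h2 : 2 * φ.tr Ω w ≠ 0 := by
    intro h3
    have h4 : φ.tr Ω w = 0 := by simpa using h3
    rw [s, h4] at h0
    norm_num at h0
  have h3 := ((φ.hol_s Ω).analyticAt w).analyticOrderAt_deriv_add_one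
  have hfun : (fun z => φ.s Ω z - φ.s Ω w) = φ.s Ω := by simp [h0]
  rw [hfun, h1, analyticOrderAt_mul ((htr.const_mul 2).analyticAt w) (htr.deriv.analyticAt w),
    ((htr.const_mul 2).analyticAt w).analyticOrderAt_eq_zero.2 h2,
    (htr.deriv.analyticAt w).analyticOrderAt_eq_one_of_zero_deriv_ne_zero hd
      (h.crit w hw hd).2.1] at h3
  rw [← h3]
  norm_num

end FarRegion

end Fundamental

/-- The immovable Dirichlet eigenvalues against the zeros of the discriminant. -/
structure ZeroData (p q : ℝ → ℂ) (Ω R c : ℝ) (s : ℂ → ℂ) : Prop where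
  R_pos : 0 < R
  c_pos : 0 < c
  hol : Differentiable ℂ s
  ne_top : ∀ w, immovableMult p q Ω w ≠ ⊤
  two_mul_le : ∀ w, ((2 * (immovableMult p q Ω w).toNat : ℕ) : ℕ∞) ≤ analyticOrderAt s w
  far_eq : ∀ w, R ≤ ‖w‖ →
    analyticOrderAt s w = ((2 * (immovableMult p q Ω w).toNat : ℕ) : ℕ∞)
  far_le : ∀ w, R ≤ ‖w‖ → (immovableMult p q Ω w).toNat ≤ 1
  near_int : ∀ w, R ≤ ‖w‖ → s w = 0 → ∃ k : ℤ, ‖Ω * w - k * Real.pi‖ ≤ 1 / 2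
  inj : ∀ w w' : ℂ, R ≤ ‖w‖ → R ≤ ‖w'‖ → s w = 0 → s w' = 0 → ∀ k : ℤ,
    ‖Ω * w - k * Real.pi‖ ≤ 1 / 2 → ‖Ω * w' - k * Real.pi‖ ≤ 1 / 2 → w = w'
  lower : ∀ w : ℂ, R ≤ ‖w‖ → (∀ k : ℤ, 1 / 2 ≤ ‖Ω * w - k * Real.pi‖) → c ≤ ‖s w‖

/-- At a far zero the discriminant has order 2, so the multiplicity is at most 1. It is at least 1
because M₁₂ vanishes there for every base point. -/
theorem Fundamental.FarRegion.zeroData {p q : ℝ → ℂ} {φ : Fundamental p q} {Ω R c : ℝ}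
    (h : φ.FarRegion Ω R c) (hΩ : 0 < Ω) (hpc : Continuous p) (hqc : Continuous q)
    (hp : Function.Periodic p Ω) (hq : Function.Periodic q Ω) (hq0 : ∃ x, q x ≠ 0) :
    ZeroData p q Ω R c (φ.s Ω) := by
  have hs : ∃ E, φ.s Ω E ≠ 0 := (h.exists_deriv_tr_ne_zero hΩ).imp fun _ h => h.2
  have key := φ.immovableMult_le hΩ hpc hqc hp hq hq0 hs
  have hle : ∀ w, ((2 * (immovableMult p q Ω w).toNat : ℕ) : ℕ∞) ≤
      analyticOrderAt (φ.s Ω) w := fun w => by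
    obtain ⟨m, h1, h2⟩ := key w
    have h3 := ENat.toNat_le_of_le_natCast h1
    exact le_trans (by exact_mod_cast Nat.mul_le_mul_left 2 h3) h2
  have hd : ∀ w, R ≤ ‖w‖ → φ.s Ω w = 0 → deriv (φ.tr Ω) w = 0 := fun w hw h0 =>
    φ.deriv_tr_eq_zero hp hq h0 (h.degen w hw h0 0)
  have hne : ∀ w, immovableMult p q Ω w ≠ ⊤ := fun w => by
    obtain ⟨m, h1, -⟩ := key w
    exact ne_top_of_le_ne_top (ENat.natCast_ne_top m) h1
  have hfar : ∀ w, R ≤ ‖w‖ → φ.s Ω w = 0 → (immovableMult p q Ω w).toNat = 1 := by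
    intro w hw h0
    have h1 := hle w
    rw [h.analyticOrderAt_s hp hq hw h0] at h1
    have h2 : 2 * (immovableMult p q Ω w).toNat ≤ 2 := by exact_mod_cast h1
    have h3 : 1 ≤ immovableMult p q Ω w :=
      le_iInf fun x => one_le_dirichletMult φ (h.degen w hw h0 x).2.1
    rw [← ENat.natCast_toNat (hne w)] at h3
    have h4 : 1 ≤ (immovableMult p q Ω w).toNat := by exact_mod_cast h3
    omega
  have hfar0 : ∀ w, φ.s Ω w ≠ 0 → (immovableMult p q Ω w).toNat = 0 := by
    intro w h0
    have h1 := hle w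
    rw [((φ.hol_s Ω).analyticAt w).analyticOrderAt_eq_zero.2 h0] at h1
    have h2 : 2 * (immovableMult p q Ω w).toNat ≤ 0 := by exact_mod_cast h1
    omega
  refine ⟨h.R_pos, h.c_pos, φ.hol_s Ω, hne, hle, fun w hw => ?_, fun w hw => ?_,
    fun w hw h0 => (h.crit w hw (hd w hw h0)).2.2,
    fun w w' hw hw' h0 h0' => h.inj w w' hw hw' (hd w hw h0) (hd w' hw' h0'),
    fun w hw hk => (h.lower w hw hk).2⟩
  · by_cases h0 : φ.s Ω w = 0
    · rw [h.analyticOrderAt_s hp hq hw h0, hfar w hw h0]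
      norm_num
    · rw [((φ.hol_s Ω).analyticAt w).analyticOrderAt_eq_zero.2 h0, hfar0 w h0]
      norm_num
  · by_cases h0 : φ.s Ω w = 0
    · exact (hfar w hw h0).le
    · rw [hfar0 w h0]
      exact zero_le_one

end AKNS

/-! ### Canonical products of genus one. -/

namespace AKNS

open Complex

section CanonicalProduct

/-- The derivative of (1 - w)exp(w) is -w exp(w), giving a quadratic bound near 0. The exponent 3/2
lies strictly between 1, needed for summability over asymptotically equally spaced zeros, and 2,
needed for an affine exponent in Hadamard's argument. -/
theorem norm_primary_sub_one_le (w : ℂ) :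
    ‖(1 - w) * exp w - 1‖ ≤ Real.exp (3 * ‖w‖ ^ (3 / 2 : ℝ)) - 1 := by
  have h1 : ‖(1 - w) * exp w - 1‖ ≤ ‖w‖ ^ 2 * Real.exp ‖w‖ := by
    have key := (convex_closedBall (0 : ℂ) ‖w‖).norm_image_sub_le_of_norm_hasDerivWithin_le
      (f := fun w => (1 - w) * exp w) (f' := fun w => -w * exp w) (C := ‖w‖ * Real.exp ‖w‖)
      (fun z _ => ((((hasDerivAt_id z).const_sub 1).mul (hasDerivAt_exp z)).congr_deriv
        (by simp; ring)).hasDerivWithinAt) (fun z hz => ?_)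
      (Metric.mem_closedBall_self (norm_nonneg w)) (by simp : w ∈ Metric.closedBall 0 ‖w‖)
    · simp only [sub_zero, exp_zero, mul_one] at key
      exact key.trans (le_of_eq (by ring))
    · have hz' : ‖z‖ ≤ ‖w‖ := by simpa using hz
      rw [norm_mul, norm_neg, norm_exp]
      gcongr
      exact (re_le_norm z).trans hz'
  refine h1.trans ?_
  set r := ‖w‖
  have hr : 0 ≤ r := norm_nonneg w
  rcases le_total r 1 with h | h
  · have h2 : r ^ 2 ≤ r ^ (3 / 2 : ℝ) := by
      rw [← Real.rpow_natCast]
      exact Real.rpow_le_rpow_of_exponent_ge' hr h (by norm_num) (by norm_num)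
    have h3 : Real.exp r ≤ 3 := (Real.exp_le_exp.2 h).trans
      (by linarith [Real.exp_one_lt_d9])
    have h4 := Real.add_one_le_exp (3 * r ^ (3 / 2 : ℝ))
    nlinarith [Real.exp_pos r, sq_nonneg r]
  · have h2 : r ≤ r ^ (3 / 2 : ℝ) := by
      conv_lhs => rw [← Real.rpow_one r]
      exact Real.rpow_le_rpow_of_exponent_le h (by norm_num)
    have h3 : Real.exp (3 * r) ≤ Real.exp (3 * r ^ (3 / 2 : ℝ)) := by gcongr
    have h4 : Real.exp (3 * r) = Real.exp (2 * r) * Real.exp r := by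
      rw [← Real.exp_add]; ring_nf
    have h5 := Real.quadratic_le_exp_of_nonneg (x := 2 * r) (by linarith)
    have h6 := Real.one_le_exp hr
    nlinarith

theorem norm_pow_sub_one_le_exp {a : ℂ} {t : ℝ} (h : ‖a - 1‖ ≤ Real.exp t - 1) (m : ℕ) :
    ‖a ^ m - 1‖ ≤ Real.exp (m * t) - 1 := by
  induction m with
  | zero => simp
  | succ m ih =>
    have h1 : a ^ (m + 1) - 1 = (a ^ m - 1) * (a - 1) + (a ^ m - 1) + (a - 1) := by ring
    have h2 : Real.exp ((m + 1 : ℕ) * t) = Real.exp (m * t) * Real.exp t := by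
      rw [← Real.exp_add]; push_cast; ring_nf
    rw [h1, h2]
    refine (norm_add₃_le).trans ?_
    rw [norm_mul]
    have := mul_le_mul ih h (norm_nonneg _) ((norm_nonneg _).trans ih)
    linarith

variable (μ : {z : ℂ // z ≠ 0} → ℕ)

/-- A factor of the canonical product of genus one with zeros of multiplicities `μ`. -/
noncomputable def canonicalFactor (E : ℂ) (z : {z : ℂ // z ≠ 0}) : ℂ :=
  ((1 - E / z.1) * exp (E / z.1)) ^ μ z

/-- The weights which control the convergence of the canonical product. -/
noncomputable def weight (z : {z : ℂ // z ≠ 0}) : ℝ := μ z * ‖z.1‖ ^ (-(3 / 2) : ℝ)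

theorem weight_nonneg (z : {z : ℂ // z ≠ 0}) : 0 ≤ weight μ z := by
  rw [weight]; positivity

theorem norm_canonicalFactor_sub_one_le (E : ℂ) (z : {z : ℂ // z ≠ 0}) :
    ‖canonicalFactor μ E z - 1‖ ≤ Real.exp (3 * ‖E‖ ^ (3 / 2 : ℝ) * weight μ z) - 1 := by
  refine (norm_pow_sub_one_le_exp (norm_primary_sub_one_le _) _).trans (le_of_eq ?_)
  rw [weight, norm_div, Real.div_rpow (norm_nonneg _) (norm_nonneg _),
    Real.rpow_neg (norm_nonneg _)]
  congr 2
  ring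

/-- The canonical product of genus one with zeros of multiplicities `μ`. -/
noncomputable def canonicalProduct (E : ℂ) : ℂ := ∏' z, canonicalFactor μ E z

variable {μ}

theorem summable_exp_sub_one {ι : Type*} {t : ι → ℝ} (h0 : ∀ i, 0 ≤ t i) (ht : Summable t) :
    Summable fun i => Real.exp (t i) - 1 := by
  refine Summable.of_nonneg_of_le (fun i => by linarith [Real.add_one_le_exp (t i), h0 i])
    (fun i => ?_) (ht.mul_right (Real.exp (∑' i, t i)))
  have h1 : t i ≤ ∑' i, t i := ht.le_tsum i fun j _ => h0 j
  have h2 : Real.exp (t i) ≤ Real.exp (∑' i, t i) := by gcongr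
  have h3 := Real.add_one_le_exp (-t i)
  have h4 : Real.exp (-t i) * Real.exp (t i) = 1 := by rw [← Real.exp_add]; simp
  nlinarith [Real.exp_pos (t i), h0 i]

theorem summable_norm_canonicalFactor_sub_one (hμ : Summable (weight μ)) (E : ℂ) :
    Summable fun z => ‖canonicalFactor μ E z - 1‖ :=
  Summable.of_nonneg_of_le (fun _ => norm_nonneg _) (norm_canonicalFactor_sub_one_le μ E)
    (summable_exp_sub_one (fun z => mul_nonneg (by positivity) (weight_nonneg μ z))
      (hμ.mul_left _))

theorem multipliable_canonicalFactor (hμ : Summable (weight μ)) (E : ℂ) :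
    Multipliable (canonicalFactor μ E) := by
  simpa using multipliable_one_add_of_summable (summable_norm_canonicalFactor_sub_one hμ E)

theorem differentiable_canonicalFactor (z : {z : ℂ // z ≠ 0}) :
    Differentiable ℂ fun E => canonicalFactor μ E z := by
  unfold canonicalFactor
  fun_prop

theorem differentiable_canonicalProduct (hμ : Summable (weight μ)) :
    Differentiable ℂ (canonicalProduct μ) := by
  intro E
  set ρ := ‖E‖ + 1
  have hlu := Summable.hasProdLocallyUniformlyOn_one_add
    (f := fun z E => canonicalFactor μ E z - 1) (K := Metric.ball (0 : ℂ) ρ) Metric.isOpen_ball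
    (summable_exp_sub_one (t := fun z => 3 * ρ ^ (3 / 2 : ℝ) * weight μ z)
      (fun z => mul_nonneg (by positivity) (weight_nonneg μ z)) (hμ.mul_left _))
    (Filter.Eventually.of_forall fun z x hx => (norm_canonicalFactor_sub_one_le μ x z).trans (by
      have hx' : ‖x‖ ≤ ρ := by simpa using (mem_ball_zero_iff.1 hx).le
      have := weight_nonneg μ z
      gcongr))
    (fun z => ((differentiable_canonicalFactor z).sub_const 1).continuous.continuousOn)
  simp only [add_sub_cancel] at hlu
  have := TendstoLocallyUniformlyOn.differentiableOn hlu
    (Filter.Eventually.of_forall fun s => by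
      refine Differentiable.differentiableOn ?_
      have h : Differentiable ℂ fun x => ∏ z ∈ s, canonicalFactor μ x z :=
        Differentiable.fun_finsetProd fun z _ => differentiable_canonicalFactor z
      simpa using h)
    Metric.isOpen_ball
  exact this.differentiableAt (Metric.isOpen_ball.mem_nhds (by simp [ρ]))

theorem norm_canonicalProduct_le (hμ : Summable (weight μ)) (E : ℂ) :
    ‖canonicalProduct μ E‖ ≤ Real.exp (3 * (∑' z, weight μ z) * ‖E‖ ^ (3 / 2 : ℝ)) := by
  refine le_of_tendsto (multipliable_canonicalFactor hμ E).hasProd.norm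
    (Filter.Eventually.of_forall fun s => ?_)
  have h1 : ∀ z, ‖canonicalFactor μ E z‖ ≤ Real.exp (3 * ‖E‖ ^ (3 / 2 : ℝ) * weight μ z) := by
    intro z
    have h1 := norm_canonicalFactor_sub_one_le μ E z
    have h2 := norm_sub_norm_le (canonicalFactor μ E z) 1
    rw [norm_one] at h2
    linarith
  refine (Finset.prod_le_prod (fun _ _ => norm_nonneg _) fun z _ => h1 z).trans ?_
  rw [← Real.exp_sum, ← Finset.mul_sum]
  have h2 := hμ.sum_le_tsum s fun z _ => weight_nonneg μ z
  refine Real.exp_le_exp.2 (le_trans ?_ (le_of_eq (by ring :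
    3 * ‖E‖ ^ (3 / 2 : ℝ) * (∑' z, weight μ z) = _)))
  gcongr

theorem canonicalProduct_ne_zero (hμ : Summable (weight μ)) {E : ℂ}
    (h : ∀ z : {z : ℂ // z ≠ 0}, z.1 = E → μ z = 0) : canonicalProduct μ E ≠ 0 := by
  have := tprod_one_add_ne_zero_of_summable (f := fun z => canonicalFactor μ E z - 1)
    (fun z => by
      rw [add_sub_cancel]
      by_cases hz : z.1 = E
      · rw [canonicalFactor, h z hz, pow_zero]
        exact one_ne_zero
      · refine pow_ne_zero _ (mul_ne_zero (sub_ne_zero.2 fun h1 => hz ?_) (exp_ne_zero _))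
        rw [eq_div_iff z.2, one_mul] at h1
        exact h1) (summable_norm_canonicalFactor_sub_one hμ E)
  rw [canonicalProduct]
  simpa only [add_sub_cancel] using this

/-- The canonical product vanishes at `w` to the prescribed order. -/
theorem exists_canonicalProduct_eq (hμ : Summable (weight μ)) (w : {z : ℂ // z ≠ 0}) :
    ∃ k : ℂ → ℂ, Differentiable ℂ k ∧ k w ≠ 0 ∧
      ∀ E, canonicalProduct μ E = (E - w) ^ μ w * k E := by
  classical
  -- Setting the multiplicity at w to zero removes that factor; the remaining product is again
  -- canonical and does not vanish at w.
  have hν : Summable (weight (Function.update μ w 0)) := by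
    refine Summable.of_nonneg_of_le (weight_nonneg _) (fun z => ?_) hμ
    unfold weight
    gcongr
    by_cases hz : z = w
    · subst hz; simp
    · rw [Function.update_of_ne hz]
  refine ⟨fun E => ((-1 / w.1) * exp (E / w.1)) ^ μ w *
    canonicalProduct (Function.update μ w 0) E, ?_, ?_, fun E => ?_⟩
  · have := differentiable_canonicalProduct hν
    fun_prop
  · refine mul_ne_zero (pow_ne_zero _ (mul_ne_zero (div_ne_zero (by norm_num) w.2)
      (exp_ne_zero _))) (canonicalProduct_ne_zero hν fun z hz => ?_)
    rw [Subtype.ext hz, Function.update_self]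
  · have hupd : (fun z => if z = w then 1 else canonicalFactor μ E z) =
        canonicalFactor (Function.update μ w 0) E := by
      funext z
      by_cases hz : z = w
      · subst hz; simp [canonicalFactor]
      · simp [canonicalFactor, hz]
    have hupd' : Function.update (canonicalFactor μ E) w 1 =
        canonicalFactor (Function.update μ w 0) E := by
      rw [← hupd]
      funext z
      simp [Function.update_apply]
    rw [canonicalProduct, Multipliable.tprod_eq_mul_tprod_ite' w
      (by rw [hupd']; exact multipliable_canonicalFactor hν E), hupd, ← canonicalProduct,
      canonicalFactor, ← mul_assoc, ← mul_pow]
    congr 2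
    have := w.2
    field_simp
    ring

end CanonicalProduct

namespace ZeroData

variable {p q : ℝ → ℂ} {Ω R c : ℝ} {s : ℂ → ℂ}

/-- The multiplicities of the immovable Dirichlet eigenvalues. -/
noncomputable def _root_.AKNS.mult (p q : ℝ → ℂ) (Ω : ℝ) (z : {z : ℂ // z ≠ 0}) : ℕ :=
  (immovableMult p q Ω z.1).toNat

theorem eq_zero_of_mult_ne_zero (h : ZeroData p q Ω R c s) {w : ℂ}
    (hw : (immovableMult p q Ω w).toNat ≠ 0) : s w = 0 := by
  by_contra h0
  have h1 := h.two_mul_le w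
  rw [(h.hol.analyticAt w).analyticOrderAt_eq_zero.2 h0] at h1
  have : 2 * (immovableMult p q Ω w).toNat ≤ 0 := by exact_mod_cast h1
  omega

/-- Far zeros are simple for μ and inject into the integers through the nearest multiple of π, so
they compare with a sum of |k|^(-3/2). Inside the disc only finitely many points contribute. -/
theorem summable_weight (h : ZeroData p q Ω R c s) (hΩ : 0 < Ω) (hs : ∃ E, s E ≠ 0) :
    Summable (weight (mult p q Ω)) := by
  rw [← summable_subtype_and_compl (s := {z : {z : ℂ // z ≠ 0} | R ≤ ‖z.1‖ ∧ s z.1 = 0})]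
  constructor
  · choose! kk hkk using h.near_int
    have hinj : Function.Injective
        (fun z : {z : {z : ℂ // z ≠ 0} | R ≤ ‖z.1‖ ∧ s z.1 = 0} => kk z.1.1) := by
      intro z w hzw
      refine Subtype.ext (Subtype.ext ?_)
      refine h.inj _ _ z.2.1 w.2.1 z.2.2 w.2.2 (kk z.1.1) (hkk _ z.2.1 z.2.2) ?_
      rw [show kk z.1.1 = kk w.1.1 from hzw]
      exact hkk _ w.2.1 w.2.2
    have hR := h.R_pos
    -- In Lean 0 to the power -3/2 is 0, so the index k = 0 needs its own term, bounded through ‖z‖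
    -- ≥ R.
    have hsum : Summable fun k : ℤ => Ω ^ (3 / 2 : ℝ) * |(k : ℝ)| ^ (-(3 / 2) : ℝ) +
        (if k = 0 then R ^ (-(3 / 2) : ℝ) else 0) :=
      ((Real.summable_abs_int_rpow (by norm_num)).mul_left _).add
        (hasSum_ite_eq (0 : ℤ) _).summable
    refine Summable.of_nonneg_of_le (fun z => weight_nonneg _ _) (fun z => ?_)
      (hsum.comp_injective hinj)
    have hz := hkk _ z.2.1 z.2.2
    have hzR : 0 < ‖z.1.1‖ := hR.trans_le z.2.1
    have hmu : ((mult p q Ω z.1 : ℕ) : ℝ) ≤ 1 := by exact_mod_cast h.far_le _ z.2.1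
    have h1 : weight (mult p q Ω) z.1 ≤ ‖z.1.1‖ ^ (-(3 / 2) : ℝ) := by
      rw [weight]
      have : 0 ≤ ‖z.1.1‖ ^ (-(3 / 2) : ℝ) := by positivity
      nlinarith
    refine h1.trans ?_
    suffices key : ∀ k : ℤ, ‖Ω * z.1.1 - k * Real.pi‖ ≤ 1 / 2 → ‖z.1.1‖ ^ (-(3 / 2) : ℝ) ≤
        Ω ^ (3 / 2 : ℝ) * |(k : ℝ)| ^ (-(3 / 2) : ℝ) +
          (if k = 0 then R ^ (-(3 / 2) : ℝ) else 0) from key _ hz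
    intro k hz
    by_cases hk : k = 0
    · rw [if_pos hk]
      have h2 : ‖z.1.1‖ ^ (-(3 / 2) : ℝ) ≤ R ^ (-(3 / 2) : ℝ) :=
        Real.rpow_le_rpow_of_nonpos hR z.2.1 (by norm_num)
      have : 0 ≤ Ω ^ (3 / 2 : ℝ) * |(k : ℝ)| ^ (-(3 / 2) : ℝ) := by positivity
      linarith
    · rw [if_neg hk, add_zero]
      have hk1 : 1 ≤ |(k : ℝ)| := by exact_mod_cast Int.one_le_abs hk
      have h3 : ‖(k : ℂ) * Real.pi‖ = |(k : ℝ)| * Real.pi := by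
        rw [norm_mul, norm_intCast, norm_real, Real.norm_of_nonneg Real.pi_pos.le]
      have h4 := norm_sub_norm_le ((k : ℂ) * Real.pi) (Ω * z.1.1)
      rw [h3, norm_mul, norm_real, Real.norm_of_nonneg hΩ.le, norm_sub_rev] at h4
      have h5 : |(k : ℝ)| / Ω ≤ ‖z.1.1‖ := by
        rw [div_le_iff₀ hΩ]
        nlinarith [Real.pi_gt_three]
      refine (Real.rpow_le_rpow_of_nonpos (by positivity) h5 (by norm_num)).trans (le_of_eq ?_)
      rw [Real.div_rpow (abs_nonneg _) hΩ.le, Real.rpow_neg hΩ.le]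
      field_simp
  · refine summable_of_hasFiniteSupport ?_
    have hfin := finite_zeros_inter_closedBall h.hol hs R
    refine Set.Finite.subset (Set.Finite.preimage (f := fun z : ↥{z : {z : ℂ // z ≠ 0} |
      R ≤ ‖z.1‖ ∧ s z.1 = 0}ᶜ => z.1.1) ?_ hfin) fun z hz => ?_
    · exact (Subtype.val_injective.comp Subtype.val_injective).injOn
    · have hm : (immovableMult p q Ω z.1.1).toNat ≠ 0 := by
        intro h0
        refine hz ?_
        change weight (mult p q Ω) z.1 = 0
        rw [weight, mult, h0, Nat.cast_zero, zero_mul]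
      have h0 := h.eq_zero_of_mult_ne_zero hm
      refine ⟨h0, ?_⟩
      by_contra hlt
      exact z.2 ⟨(not_le.1 hlt).le, h0⟩

end ZeroData

end AKNS

/-! ### Hadamard factorization of the discriminant. -/

namespace AKNS

open Complex Polynomial

section Hadamard

/-- A primitive of g'/g, normalized at 0, is a logarithm of g. -/
theorem exists_eq_exp_of_entire {g : ℂ → ℂ} (hg : Differentiable ℂ g) (h0 : ∀ z, g z ≠ 0) :
    ∃ k : ℂ → ℂ, Differentiable ℂ k ∧ ∀ z, g z = exp (k z) := by
  obtain ⟨k, hk0, hk⟩ := (hg.deriv.div hg h0).isExactOn_univ.with_val_at 0 (log (g 0))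
  have hd : ∀ z, HasDerivAt (fun z => g z * exp (-k z)) 0 z := fun z => by
    refine ((hg z).hasDerivAt.mul ((hk z (Set.mem_univ z)).neg.cexp)).congr_deriv ?_
    have := h0 z
    simp only [Pi.div_apply]
    field_simp
    ring
  refine ⟨k, fun z => (hk z (Set.mem_univ z)).differentiableAt, fun z => ?_⟩
  have h1 := is_const_of_deriv_eq_zero (fun z => (hd z).differentiableAt)
    (fun z => (hd z).deriv) z 0
  simp only [hk0] at h1
  rw [exp_neg, exp_neg, exp_log (h0 0), mul_inv_cancel₀ (h0 0)] at h1
  have := exp_ne_zero (k z)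
  field_simp at h1
  exact h1

/-- An entire function without zeros and of order at most `3/2` along a sequence of circles is the
exponential of an affine function. -/
theorem exists_eq_exp_affine {g : ℂ → ℂ} (hg : Differentiable ℂ g) (h0 : ∀ z, g z ≠ 0) {r : ℕ → ℝ}
    (hr : Filter.Tendsto r Filter.atTop Filter.atTop) {K : ℝ} (hK : 0 < K)
    (hb : ∀ᶠ n in Filter.atTop, ∀ z : ℂ, ‖z‖ = r n → ‖g z‖ ≤ Real.exp (K * r n ^ (3 / 2 : ℝ))) :
    ∃ α β : ℂ, ∀ z, g z = exp (α + β * z) := by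
  obtain ⟨k, hk, hgk⟩ := exists_eq_exp_of_entire hg h0
  obtain ⟨P, hP, hPc⟩ := exists_polynomial_of_growth hk (r := fun n => r n / 2)
    (hr.atTop_div_const two_pos) (K := (2 * K + 3 * ‖k 0‖) * 2 ^ (3 / 2 : ℝ)) (s := 3 / 2) (by
      filter_upwards [hb, hr.eventually_ge_atTop 1] with n hn hn1 z hz
      have hrn : 0 < r n := by linarith
      have hre : Set.MapsTo k (Metric.ball 0 (r n)) {z | z.re ≤ K * r n ^ (3 / 2 : ℝ)} := by
        intro w hw
        -- The maximum principle carries the bound from the circle to the disc, so Re k is bounded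
        -- above there. Borel-Carathéodory then bounds |k| on the circle of half the radius, and
        -- growth of order 3/2 < 2 leaves an affine polynomial.
        have h1 := norm_le_of_forall_mem_frontier_norm_le (U := Metric.ball (0 : ℂ) (r n))
          Metric.isBounded_ball hg.diffContOnCl (fun z hz => hn z (by
            rw [frontier_ball _ hrn.ne'] at hz
            simpa using hz)) (subset_closure hw)
        rw [hgk, norm_exp, Real.exp_le_exp] at h1
        exact h1
      have h1 := borelCaratheodory (z := z) (by positivity) hk.differentiableOn hre hrn
        (by rw [mem_ball_zero_iff, hz]; linarith)
      refine h1.trans ?_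
      have h2 : 1 ≤ r n ^ (3 / 2 : ℝ) := Real.one_le_rpow hn1 (by norm_num)
      rw [hz, mul_assoc _ ((2 : ℝ) ^ (3 / 2 : ℝ)), ← Real.mul_rpow two_pos.le (by positivity),
        mul_div_cancel₀ (r n) two_ne_zero]
      have h3 : 2 * (K * r n ^ (3 / 2 : ℝ)) * (r n / 2) / (r n - r n / 2) +
          ‖k 0‖ * (r n + r n / 2) / (r n - r n / 2) =
          2 * (K * r n ^ (3 / 2 : ℝ)) + 3 * ‖k 0‖ := by
        have : r n - r n / 2 ≠ 0 := by linarith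
        field_simp
        ring
      rw [h3]
      nlinarith [norm_nonneg (k 0)])
  refine ⟨P.coeff 0, P.coeff 1, fun z => ?_⟩
  rw [hgk, hP, eval_eq_sum_range' (n := 2) ?_ z]
  · simp [Finset.sum_range_succ]
  · refine Nat.lt_succ_iff.2 (natDegree_le_iff_coeff_eq_zero.2 fun N hN => hPc N ?_)
    have : (2 : ℝ) ≤ N := by exact_mod_cast hN
    linarith

end Hadamard

namespace ZeroData

variable {p q : ℝ → ℂ} {Ω R c : ℝ} {s : ℂ → ℂ}

theorem exists_D_zero_eq (h : ZeroData p q Ω R c s) (hΩ : 0 < Ω) (hs : ∃ E, s E ≠ 0) (w : ℂ) :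
    ∃ k : ℂ → ℂ, Differentiable ℂ k ∧ k w ≠ 0 ∧
      ∀ E, D p q Ω 0 E = (E - w) ^ (immovableMult p q Ω w).toNat * k E := by
  have hμ := h.summable_weight hΩ hs
  have hD : ∀ E, D p q Ω 0 E = E ^ (immovableMult p q Ω 0).toNat *
      canonicalProduct (mult p q Ω) E := fun E => by
    rw [D, zero_mul, exp_zero, one_mul]
    rfl
  by_cases hw : w = 0
  · subst hw
    exact ⟨_, differentiable_canonicalProduct hμ,
      canonicalProduct_ne_zero hμ fun z hz => absurd hz z.2, fun E => by rw [hD, sub_zero]⟩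
  · obtain ⟨k, hk, hk0, hE⟩ := exists_canonicalProduct_eq hμ ⟨w, hw⟩
    refine ⟨fun E => E ^ (immovableMult p q Ω 0).toNat * k E, by fun_prop,
      mul_ne_zero (pow_ne_zero _ hw) hk0, fun E => ?_⟩
    rw [hD, hE]
    simp only [mult]
    ring

theorem differentiable_D_zero (h : ZeroData p q Ω R c s) (hΩ : 0 < Ω) (hs : ∃ E, s E ≠ 0) :
    Differentiable ℂ (D p q Ω 0) := by
  obtain ⟨k, hk, -, hE⟩ := h.exists_D_zero_eq hΩ hs 0
  rw [show D p q Ω 0 = _ from funext hE]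
  fun_prop

theorem analyticOrderAt_D_zero (h : ZeroData p q Ω R c s) (hΩ : 0 < Ω) (hs : ∃ E, s E ≠ 0)
    (w : ℂ) : analyticOrderAt (D p q Ω 0) w = (immovableMult p q Ω w).toNat := by
  obtain ⟨k, hk, hk0, hE⟩ := h.exists_D_zero_eq hΩ hs w
  rw [((h.differentiable_D_zero hΩ hs).analyticAt w).analyticOrderAt_eq_natCast]
  exact ⟨k, hk.analyticAt w, hk0, Filter.Eventually.of_forall hE⟩

theorem norm_D_zero_le (h : ZeroData p q Ω R c s) (hΩ : 0 < Ω) (hs : ∃ E, s E ≠ 0) :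
    ∃ S : ℝ, 0 ≤ S ∧ ∀ E, ‖D p q Ω 0 E‖ ≤
      ‖E‖ ^ (immovableMult p q Ω 0).toNat * Real.exp (S * ‖E‖ ^ (3 / 2 : ℝ)) := by
  have hμ := h.summable_weight hΩ hs
  refine ⟨3 * ∑' z, weight (mult p q Ω) z,
    mul_nonneg (by norm_num) (tsum_nonneg (weight_nonneg _)), fun E => ?_⟩
  rw [D, zero_mul, exp_zero, one_mul, norm_mul, norm_pow]
  gcongr
  exact norm_canonicalProduct_le hμ E

/-- The Hadamard factorization of the discriminant. -/
theorem exists_factorization (h : ZeroData p q Ω R c s) (hΩ : 0 < Ω) (hs : ∃ E, s E ≠ 0) :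
    ∃ (d₀ : ℂ) (P : ℂ[X]), ∀ E, s E = P.eval E * D p q Ω d₀ E ^ 2 := by
  have hD := h.differentiable_D_zero hΩ hs
  have hord := h.analyticOrderAt_D_zero hΩ hs
  have hD2 : ∀ w, analyticOrderAt (D p q Ω 0 ^ 2) w =
      ((2 * (immovableMult p q Ω w).toNat : ℕ) : ℕ∞) := fun w => by
    rw [analyticOrderAt_pow (hD.analyticAt w), hord w]
    simp
  obtain ⟨F, hF, hsF⟩ := exists_entire_quotient h.hol (hD.pow 2) (by
    obtain ⟨k, hk, hk0, hE⟩ := h.exists_D_zero_eq hΩ hs 0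
    by_contra! hcon
    have h1 := hD2 0
    rw [show D p q Ω 0 ^ 2 = 0 from funext hcon, analyticOrderAt_eq_top.2 (by simp)] at h1
    exact ENat.natCast_ne_top _ h1.symm) (fun z _ => (hD2 z).le.trans (h.two_mul_le z))
  have hF0 : ∃ z, F z ≠ 0 := by
    obtain ⟨z, hz⟩ := hs
    exact ⟨z, fun h0 => hz (by rw [hsF, h0, mul_zero])⟩
  -- Far out the orders of s and D² agree exactly, so the quotient has no zeros there.
  have hFfar : ∀ w, R ≤ ‖w‖ → F w ≠ 0 := by
    intro w hw
    have h1 : analyticOrderAt s w = analyticOrderAt (D p q Ω 0 ^ 2) w + analyticOrderAt F w := by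
      rw [← analyticOrderAt_mul ((hD.pow 2).analyticAt w) (hF.analyticAt w)]
      exact congrArg (analyticOrderAt · w) (funext hsF)
    rw [hD2, h.far_eq w hw] at h1
    obtain ⟨n, hn⟩ := ENat.ne_top_iff_exists.1 (analyticOrderAt_ne_top_of_entire hF hF0 w)
    rw [← hn] at h1
    have h2 : 2 * (immovableMult p q Ω w).toNat = 2 * (immovableMult p q Ω w).toNat + n := by
      exact_mod_cast h1
    rw [← (hF.analyticAt w).analyticOrderAt_eq_zero, ← hn, show n = 0 by omega, Nat.cast_zero]
  have hfin := finite_zeros_inter_closedBall hF hF0 R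
  obtain ⟨P, F₁, -, hF₁, hF₁Z, hFP⟩ := exists_monic_mul_of_entire hF hF0 hfin.toFinset
  have hF₁0 : ∀ z, F₁ z ≠ 0 := fun z h0 => by
    have h1 : F z = 0 := by rw [hFP, h0, mul_zero]
    refine hF₁Z z (hfin.mem_toFinset.2 ⟨h1, ?_⟩) h0
    exact (not_le.1 fun hle => hFfar z hle h1).le
  obtain ⟨S, hS, hDS⟩ := h.norm_D_zero_le hΩ hs
  obtain ⟨K, hK, hPK⟩ := exists_norm_eval_le P
  have hc := h.c_pos
  set m := (immovableMult p q Ω 0).toNat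
  -- The reciprocal is estimated because 1/F₁ = P D²/s needs only upper bounds for P and D and the
  -- lower bound for s on the circles; a lower bound for the canonical product is avoided.
  obtain ⟨α, β, hαβ⟩ := exists_eq_exp_affine (g := fun z => (F₁ z)⁻¹) (hF₁.inv hF₁0)
    (fun z => inv_ne_zero (hF₁0 z)) (Fundamental.tendsto_radius hΩ)
    (K := K / c + P.natDegree + 2 * m + 2 * S + 1) (by positivity) (by
      filter_upwards [(Fundamental.tendsto_radius hΩ).eventually_ge_atTop (max R 1)] with n hn z hz
      have hzR : R ≤ ‖z‖ := hz ▸ (le_max_left _ _).trans hn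
      have hz1 : 1 ≤ ‖z‖ := hz ▸ (le_max_right _ _).trans hn
      have hlow := h.lower z hzR (Fundamental.half_le_of_norm_eq_radius hΩ hz)
      have hsz : s z ≠ 0 := norm_pos_iff.1 (hc.trans_le hlow)
      have e1 : (F₁ z)⁻¹ = P.eval z * D p q Ω 0 z ^ 2 / s z := by
        rw [eq_div_iff hsz, hsF, hFP]
        have := hF₁0 z
        simp only [Pi.pow_apply]
        field_simp
      rw [e1, norm_div, norm_mul, norm_pow, ← hz]
      set r := ‖z‖
      set ρ := r ^ (3 / 2 : ℝ)
      have hrρ : r ≤ ρ := by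
        conv_lhs => rw [← Real.rpow_one r]
        exact Real.rpow_le_rpow_of_exponent_le hz1 (by norm_num)
      have hpow : ∀ k : ℕ, r ^ k ≤ Real.exp (k * ρ) := fun k => by
        rw [Real.exp_nat_mul]
        gcongr
        exact hrρ.trans (by linarith [Real.add_one_le_exp ρ])
      have hKc : K / c ≤ Real.exp (K / c * ρ) := by
        have h1 : 0 ≤ K / c := by positivity
        have h2 := Real.add_one_le_exp (K / c * ρ)
        nlinarith
      calc ‖P.eval z‖ * ‖D p q Ω 0 z‖ ^ 2 / ‖s z‖
          ≤ K * r ^ P.natDegree * (r ^ m * Real.exp (S * ρ)) ^ 2 / c := by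
            gcongr
            · exact hPK z hz1
            · exact hDS z
        _ = K / c * r ^ P.natDegree * r ^ (2 * m) * Real.exp ((2 : ℕ) * (S * ρ)) := by
            rw [Real.exp_nat_mul]
            ring
        _ ≤ Real.exp (K / c * ρ) * Real.exp (P.natDegree * ρ) * Real.exp ((2 * m : ℕ) * ρ) *
            Real.exp ((2 : ℕ) * (S * ρ)) := by
            gcongr
            · exact hpow _
            · exact hpow _
        _ ≤ _ := by
            rw [← Real.exp_add, ← Real.exp_add, ← Real.exp_add]
            refine Real.exp_le_exp.2 ?_
            push_cast
            linarith)
  -- F₁ = exp(-α - βE). The square D² absorbs exp(-βE) when d₀ = -β/2, and the constant goes into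
  -- the polynomial.
  refine ⟨-β / 2, P * C (exp (-α)), fun E => ?_⟩
  have h1 : F₁ E = exp (-α) * exp (-β * E) := by
    rw [← exp_add, ← inv_inv (F₁ E), hαβ, ← exp_neg]
    ring_nf
  have h2 : D p q Ω (-β / 2) E ^ 2 = exp (-β * E) * D p q Ω 0 E ^ 2 := by
    rw [D, D, zero_mul, exp_zero, one_mul, show -β * E = (2 : ℕ) * (-β / 2 * E) by push_cast; ring,
      exp_nat_mul]
    ring
  rw [hsF, hFP, h1, h2, eval_mul, eval_C, Pi.pow_apply]
  ring

end ZeroData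

end AKNS

theorem theoremt4p2 (p q : ℝ → ℂ) (Ω : ℝ) (hΩ : 0 < Ω)
    (hp2 : ContDiff ℝ 2 p) (hq2 : ContDiff ℝ 2 q)
    (hp : Function.Periodic p Ω) (hq : Function.Periodic q Ω)
    (hF : {E : ℂ | ¬ AKNS.HasTwoFloquetSolutions p q Ω E}.Finite) :
    ((∃ x, q x ≠ 0) →
      (∀ E, AKNS.immovableMult p q Ω E ≠ ⊤) ∧
      (∀ E, Multipliable (AKNS.hadamardFactor p q Ω E)) ∧
      ∃ (d₀ : ℂ) (P : Polynomial ℂ),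
        (∀ E, AKNS.D p q Ω d₀ E ≠ 0 → AKNS.U hp hq d₀ E = P.eval E) ∧
        (∀ E, AKNS.discr hp hq E = P.eval E * AKNS.D p q Ω d₀ E ^ 2)) ∧
    AKNS.IsAlgebroGeometric p q := by
  obtain ⟨φ⟩ := AKNS.nonempty_fundamental hp2.continuous hq2.continuous
  obtain ⟨R, c, h⟩ := φ.exists_farRegion hΩ hp2 hq2 hp hq hF
  refine ⟨fun hq0 => ?_, AKNS.isAlgebroGeometric_of_floquet hΩ hp2 hq2 hp hq hF⟩
  have hs : ∃ E, φ.s Ω E ≠ 0 := (h.exists_deriv_tr_ne_zero hΩ).imp fun _ h => h.2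
  have hz := h.zeroData hΩ hp2.continuous hq2.continuous hp hq hq0
  obtain ⟨d₀, P, hP⟩ := hz.exists_factorization hΩ hs
  -- By definition `hadamardFactor` is `canonicalFactor` for the multiplicities `mult`.
  refine ⟨hz.ne_top, fun E => AKNS.multipliable_canonicalFactor (hz.summable_weight hΩ hs) E,
    d₀, P, fun E hE => ?_, fun E => by rw [φ.discr_eq, hP]⟩
  rw [AKNS.U, φ.discr_eq, hP, mul_div_cancel_right₀ _ (pow_ne_zero 2 hE)]
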